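/- **The growth process.** Fix a probability distribution $z$ on facet sizes with finite support contained in $\{2,3,\dots\}$ and mean $s=\sum_m m\,z(m)$, a facet density parameter $c>0$ with $cs>1$, and an initial attractiveness $a\ge0$ (default mode: $a=0$). The state is a finite abstract simplicial complex with vertex set $V$ and set $F$ of facets (maximal faces); the facet degree of a vertex is the number of facets containing it. In each step of the GeneSCs process, a facet size $m$ is sampled from $z$, independently of the past; the new facet brings in $\min\bigl(m,\max(0,\lceil(|F|+1)/c\rceil-|V|)\bigr)$ new vertices, and its remaining vertices are merged with existing vertices, which are picked one after another without replacement, each pick choosing an available vertex with probability proportional to its facet degree plus $a$ (if no available vertex is left, the remaining vertices of the facet are new as well). Then the facet is added with subsumption: if it is contained in an existing facet nothing changes, otherwise it becomes a facet and all facets contained in it are deleted. Let $(V_n,F_n)$ be the complex after $n$ steps, started from an arbitrary finite (possibly empty) complex. **Theorem.** Almost surely on the event $|V_n|\to\infty$, the facet density $|F_n|/|V_n|$ tends to $c$, the average facet size tends to $s$, and for every $k\ge1$ the fraction of vertices of facet degree $k$ converges to $$p_k=\frac{B\bigl(k+a,\,1+\frac{cs+a}{cs-1}\bigr)}{B\bigl(1+a,\,1+\frac{cs+a}{cs-1}\bigr)}\cdot\frac{cs+a}{cs-1+cs(1+a)},$$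 where $B$ is the Beta function. Here $(p_k)_{k\ge1}$ is a probability distribution and a power law with exponent $\alpha=2+\frac{1+a}{cs-1}$: there is $C>0$ with $p_k\sim C\,k^{-\alpha}$ as $k\to\infty$. In particular, $\alpha=2+\frac1{cs-1}$ for $a=0$. Moreover, there is $N_0$, depending only on $z,c,a$, such that $|V_n|\to\infty$ almost surely for every initial complex that has at least $N_0$ vertices and all of whose facet sizes lie in the support of $z$. -/

import Mathlib

open Filter Topology MeasureTheory
open scoped ENNReal Asymptotics

universe u

noncomputable section

namespace GeneSCs

/-- A finite abstract simplicial complex with vertices labelled by natural numbers is stored as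
the finite set of its facets, each facet being the set of its vertices. -/
abbrev Facets : Type := Finset (Finset ℕ)

/-- `S` is the set of facets of a (possibly empty) finite simplicial complex: its members are
nonempty and none of them contains another one. -/
def IsFacetFamily (S : Facets) : Prop :=
  ∅ ∉ S ∧ IsAntichain (· ⊆ ·) (S : Set (Finset ℕ))

/-- The abstract simplicial complex whose faces are the nonempty subsets of members of `S`. -/
def toComplex (S : Facets) : PreAbstractSimplicialComplex ℕ where
  faces := {σ | σ.Nonempty ∧ ∃ F ∈ S, σ ⊆ F}
  isRelLowerSet_faces := fun _ h =>
    ⟨h.1, fun _ hts ht => ⟨ht, h.2.imp fun _ hF => ⟨hF.1, Finset.Subset.trans hts hF.2⟩⟩⟩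

/-- The facets (maximal faces) of the complex generated by `S` are exactly the members of `S`. -/
theorem maximal_face_iff {S : Facets} (hS : IsFacetFamily S) (σ : Finset ℕ) :
    Maximal (fun τ => τ ∈ (toComplex S).faces) σ ↔ σ ∈ S := by
  have hne : ∀ F ∈ S, F.Nonempty := fun F hF =>
    Finset.nonempty_iff_ne_empty.2 fun h => hS.1 (h ▸ hF)
  constructor
  · rintro ⟨⟨_, F, hF, hsub⟩, hmax⟩
    have h2 : F ⊆ σ := hmax ⟨hne F hF, F, hF, Finset.Subset.refl F⟩ hsub
    exact (Finset.Subset.antisymm hsub h2) ▸ hF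
  · intro hσ
    refine ⟨⟨hne σ hσ, σ, hσ, Finset.Subset.refl σ⟩, ?_⟩
    rintro τ ⟨_, F, hF, hτ⟩ hle
    have h1 : σ = F := hS.2.eq hσ hF (Finset.Subset.trans hle hτ)
    exact h1 ▸ hτ

/-- The vertex set `V` of the complex. -/
def vertices (S : Facets) : Finset ℕ := S.biUnion id

/-- The facet degree of `v`: the number of facets that contain `v`. -/
def facetDegree (S : Facets) (v : ℕ) : ℕ := (S.filter fun F => v ∈ F).card

/-- The fraction of the vertices that have facet degree `k`. -/
def degreeFraction (S : Facets) (k : ℕ) : ℝ :=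
  (((vertices S).filter fun v => facetDegree S v = k).card : ℝ) / ((vertices S).card : ℝ)

/-- The facet density `|F| / |V|`. -/
def facetDensity (S : Facets) : ℝ := (S.card : ℝ) / ((vertices S).card : ℝ)

/-- The average size of a facet. -/
def averageFacetSize (S : Facets) : ℝ := (∑ F ∈ S, (F.card : ℝ)) / (S.card : ℝ)

/-- Adding a facet `F` with subsumption: if `F` is contained in an existing facet then nothing
changes; otherwise `F` is added and all existing facets contained in `F` are deleted. -/
def addFacet (S : Facets) (F : Finset ℕ) : Facets :=
  if ∃ G ∈ S, F ⊆ G then S else insert F (S.filter fun G => ¬ G ⊆ F)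

/-- The result of adding a facet is again the set of facets of a complex. -/
theorem isFacetFamily_addFacet {S : Facets} (hS : IsFacetFamily S) {F : Finset ℕ}
    (hF : F.Nonempty) : IsFacetFamily (addFacet S F) := by
  unfold addFacet
  split_ifs with h
  · exact hS
  · push Not at h
    refine ⟨?_, ?_⟩
    · intro h0
      rcases Finset.mem_insert.1 h0 with h0 | h0
      · exact hF.ne_empty h0.symm
      · exact hS.1 (Finset.mem_filter.1 h0).1
    · intro A hA B hB hne hAB
      rcases Finset.mem_insert.1 (Finset.mem_coe.1 hA) with rfl | hA'
      · rcases Finset.mem_insert.1 (Finset.mem_coe.1 hB) with rfl | hB'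
        · exact hne rfl
        · exact h B (Finset.mem_filter.1 hB').1 hAB
      · rcases Finset.mem_insert.1 (Finset.mem_coe.1 hB) with rfl | hB'
        · exact (Finset.mem_filter.1 hA').2 hAB
        · exact hS.2 (Finset.mem_filter.1 hA').1 (Finset.mem_filter.1 hB').1 hne hAB

/-- The complex generated by `addFacet S F` is the union of the old complex with the full simplex
on `F`. -/
theorem toComplex_addFacet (S : Facets) (F σ : Finset ℕ) :
    σ ∈ (toComplex (addFacet S F)).faces ↔
      σ ∈ (toComplex S).faces ∨ (σ.Nonempty ∧ σ ⊆ F) := by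
  change (σ.Nonempty ∧ ∃ G ∈ addFacet S F, σ ⊆ G) ↔
    (σ.Nonempty ∧ ∃ G ∈ S, σ ⊆ G) ∨ (σ.Nonempty ∧ σ ⊆ F)
  unfold addFacet
  split_ifs with h
  · obtain ⟨G, hG, hFG⟩ := h
    exact ⟨Or.inl, fun h => h.elim id fun h => ⟨h.1, G, hG, Finset.Subset.trans h.2 hFG⟩⟩
  · constructor
    · rintro ⟨h0, G, hG, hσ⟩
      rcases Finset.mem_insert.1 hG with rfl | hG
      · exact Or.inr ⟨h0, hσ⟩
      · exact Or.inl ⟨h0, G, (Finset.mem_filter.1 hG).1, hσ⟩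
    · rintro (⟨h0, G, hG, hσ⟩ | ⟨h0, hσ⟩)
      · by_cases hGF : G ⊆ F
        · exact ⟨h0, F, Finset.mem_insert_self _ _, Finset.Subset.trans hσ hGF⟩
        · exact ⟨h0, G, Finset.mem_insert_of_mem (Finset.mem_filter.2 ⟨hG, hGF⟩), hσ⟩
      · exact ⟨h0, F, Finset.mem_insert_self _ _, hσ⟩

/-- Unnormalized probability of picking the vertex `v` when the vertices in `A` have been picked
already: facet degree plus initial attractiveness `a` for the remaining vertices, `0` otherwise. -/
def pickWeight (a : ℝ) (S : Facets) (A : Finset ℕ) (v : ℕ) : ℝ≥0∞ :=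
  if v ∈ vertices S \ A then ENNReal.ofReal ((facetDegree S v : ℝ) + a) else 0

theorem tsum_pickWeight_ne_top (a : ℝ) (S : Facets) (A : Finset ℕ) :
    (∑' v, pickWeight a S A v) ≠ ∞ := by
  rw [tsum_eq_sum (s := vertices S \ A) (fun v hv => by simp [pickWeight, hv])]
  refine (ENNReal.sum_lt_top.2 fun v hv => ?_).ne
  rw [pickWeight, if_pos hv]
  exact ENNReal.ofReal_lt_top

/-- One preferential attachment pick, added to the set `A` of vertices picked so far (nothing is
added when no vertex is left). -/
def pick (a : ℝ) (S : Facets) (A : Finset ℕ) : PMF (Finset ℕ) :=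
  if h : (∑' v, pickWeight a S A v) = 0 then PMF.pure A
  else (PMF.normalize (pickWeight a S A) h (tsum_pickWeight_ne_top a S A)).map
    fun v => insert v A

/-- The set of vertices obtained by `m` successive preferential attachment picks without
replacement (all vertices, if there are at most `m`). -/
def picks (a : ℝ) (S : Facets) : ℕ → PMF (Finset ℕ)
  | 0 => PMF.pure ∅
  | m + 1 => (picks a S m).bind (pick a S)

/-- `j` new vertices, with labels larger than all labels in use. -/
def freshVertices (S : Facets) (j : ℕ) : Finset ℕ :=
  Finset.Ico ((vertices S).sup id + 1) ((vertices S).sup id + 1 + j)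

/-- The number of new vertices that a facet of size `s` has to bring in, so that the number of
vertices approaches the target `⌈(|F| + 1) / c⌉`. -/
def newCount (c : ℝ) (S : Facets) (s : ℕ) : ℕ :=
  min s (⌈((S.card : ℝ) + 1) / c⌉₊ - (vertices S).card)

/-- One step of the growth process: sample the size `s` of the new facet from `z`, merge all but
`newCount c S s` of its vertices with existing vertices chosen by preferential attachment, let its
remaining vertices be new, and add the facet with subsumption. -/
def step (z : PMF ℕ) (c a : ℝ) (S : Facets) : PMF Facets :=
  z.bind fun s => (picks a S (s - newCount c S s)).map fun A =>
    addFacet S (A ∪ freshVertices S (s - A.card))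

/-- `X 0, X 1, …` is a run of the growth process from the complex `S₀`: the Markov chain
with initial state `S₀` and transition probabilities `step z c a`. -/
structure IsRun {Ω : Type*} [MeasurableSpace Ω] (z : PMF ℕ) (c a : ℝ) (S₀ : Facets)
    (μ : Measure Ω) (X : ℕ → Ω → Facets) : Prop where
  measurableSet_eq : ∀ n S, MeasurableSet {ω | X n ω = S}
  init : ∀ᵐ ω ∂μ, X 0 ω = S₀
  transition : ∀ (n : ℕ) (x : ℕ → Facets) (S : Facets),
    μ {ω | (∀ i ≤ n, X i ω = x i) ∧ X (n + 1) ω = S} =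
      μ {ω | ∀ i ≤ n, X i ω = x i} * step z c a (x n) S

/-- The mean `∑ m · z(m)` of the facet size distribution. -/
def meanSize (z : PMF ℕ) : ℝ := ∑' m : ℕ, (m : ℝ) * (z m).toReal

end GeneSCs

end

/-! If every new facet were incomparable with all existing facets, then each step would add one
facet of mean size `s`, and the rule for new vertices would keep `|V|` near `|F| / c`. The number `N
k` of vertices of facet degree `k` would change on average by `(s - ν) * ((k - 1 + a) * N (k - 1) -
(k + a) * N k) / T`, plus `ν` if `k = 1`, where `T` is the total weight (facet degrees plus `a`) and
`ν` is the mean number of new vertices. Since `T / n → s + a / c` and `ν` has time average `1 / c`,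
`N k / n` converges to the solution of a linear recursion, a quotient of Beta functions. What has to
be proved is that subsumption and repeated picks become negligible: the probability that two picks
coincide or are adjacent tends to zero (`IsRegular.eventually_rare`). A priori, a few vertices could
hold a positive share of the weight, and most new facets could be lost among them.

Randomness enters through laws of large numbers for bounded increments, obtained from exponential
moments and Borel–Cantelli. One version (`ae_abs_centredSum_le`) is uniform over windows `n₀ ≤ n ≤ K
* n₀`, for functions that may depend on the state at `n₀`. The remaining asymptotic arguments are
deterministic along a path in a set of full measure.

Linear growth: a facet of the maximal size `M` is never removed, and a large complex gains one with
probability bounded below, either because the new facet has a new vertex or because the complex is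
so sparse that the picks are likely to contain two non-adjacent vertices (`exists_le_ex_newMax`). So
the number of facets grows linearly, and with it the number of vertices (`IsPath.exists_regular`).
The same fact gives unbounded growth from a large initial complex, as boundedly many vertices carry
boundedly many facets.

Rarity: at the start of a window, choose sets `H ⊆ O` of vertices. `H` holds the boundedly many
vertices with the largest weight shares; `O` extends this by a finer threshold for shares and by all
vertices of weight above a large constant. A potential that is quadratic in small weights and linear
in large ones grows at most by a constant factor over the window (`IsRegular.exists_potential_le`).
Hence collisions off `H`, and adjacent pairs with one vertex off `O` and the other off `H`, stay
rare, provided that little weight lies between the two thresholds for shares; a pigeonhole over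
boundedly many thresholds achieves this (`IsRegular.exists_levels`). It remains to show that the
share of `O` itself decays. Lost facets can distort this share, but facets inside `O` with at most
one vertex off `H` are few, and for all others the number of picks in `O` is, up to the rare events,
at most its expectation even after unfavourable losses are allowed for (`ex_excess_picks_le`).
Vertices born in maximal facets lie outside `O` and permanently hold a positive proportion of all
incidences. So the share of `O` contracts by a factor `1 - q` whenever time is multiplied by a large
constant (`IsRegular.exists_contraction`), and after several such stretches it is negligible. -/

namespace GeneSCs

/-! ### Expectations under finitely supported probability mass functions -/

section Expectation

variable {α β : Type*}

/-- The expectation of a real function under a probability mass function. -/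
noncomputable def ex (p : PMF α) (f : α → ℝ) : ℝ := ∑' x, (p x).toReal * f x

theorem ex_eq_sum {p : PMF α} {s : Finset α} (hs : p.support ⊆ s) (f : α → ℝ) :
    ex p f = ∑ x ∈ s, (p x).toReal * f x := by
  refine tsum_eq_sum fun x hx => ?_
  have : p x = 0 := by
    by_contra h
    exact hx (hs ((PMF.mem_support_iff p x).2 h))
  simp [this]

theorem toReal_sum_eq_one {p : PMF α} {s : Finset α} (hs : p.support ⊆ s) :
    ∑ x ∈ s, (p x).toReal = 1 := by
  rw [← ENNReal.toReal_sum fun x _ => p.apply_ne_top x]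
  have : ∑ x ∈ s, p x = 1 := by
    rw [← p.tsum_coe]
    refine (tsum_eq_sum fun x hx => ?_).symm
    by_contra h
    exact hx (hs ((PMF.mem_support_iff p x).2 h))
  simp [this]

theorem ex_const {p : PMF α} (hp : p.support.Finite) (c : ℝ) : ex p (fun _ => c) = c := by
  rw [ex_eq_sum (s := hp.toFinset) (by simp), ← Finset.sum_mul,
    toReal_sum_eq_one (by simp), one_mul]

theorem ex_mono {p : PMF α} (hp : p.support.Finite) {f g : α → ℝ}
    (h : ∀ x ∈ p.support, f x ≤ g x) : ex p f ≤ ex p g := by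
  rw [ex_eq_sum (s := hp.toFinset) (by simp), ex_eq_sum (s := hp.toFinset) (by simp)]
  exact Finset.sum_le_sum fun x hx =>
    mul_le_mul_of_nonneg_left (h x (by simpa using hx)) ENNReal.toReal_nonneg

theorem ex_congr {p : PMF α} {f g : α → ℝ} (h : ∀ x ∈ p.support, f x = g x) :
    ex p f = ex p g := by
  refine tsum_congr fun x => ?_
  by_cases hx : x ∈ p.support
  · rw [h x hx]
  · have : p x = 0 := by simpa using hx
    simp [this]

theorem ex_add {p : PMF α} (hp : p.support.Finite) (f g : α → ℝ) :
    ex p (fun x => f x + g x) = ex p f + ex p g := by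
  simp only [ex_eq_sum (s := hp.toFinset) (show p.support ⊆ _ by simp), mul_add,
    Finset.sum_add_distrib]

theorem ex_sub {p : PMF α} (hp : p.support.Finite) (f g : α → ℝ) :
    ex p (fun x => f x - g x) = ex p f - ex p g := by
  simp only [ex_eq_sum (s := hp.toFinset) (show p.support ⊆ _ by simp), mul_sub,
    Finset.sum_sub_distrib]

theorem ex_mul_left (p : PMF α) (c : ℝ) (f : α → ℝ) :
    ex p (fun x => c * f x) = c * ex p f := by
  unfold ex
  rw [← tsum_mul_left]
  exact tsum_congr fun x => by ring

theorem ex_neg (p : PMF α) (f : α → ℝ) : ex p (fun x => -f x) = -ex p f := by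
  have := ex_mul_left p (-1) f
  simpa using this

theorem ex_nonneg {p : PMF α} {f : α → ℝ} (h : ∀ x ∈ p.support, 0 ≤ f x) : 0 ≤ ex p f := by
  refine tsum_nonneg fun x => ?_
  by_cases hx : x ∈ p.support
  · exact mul_nonneg ENNReal.toReal_nonneg (h x hx)
  · have : p x = 0 := by simpa using hx
    simp [this]

theorem ex_le_const {p : PMF α} (hp : p.support.Finite) {f : α → ℝ} {c : ℝ}
    (h : ∀ x ∈ p.support, f x ≤ c) : ex p f ≤ c :=
  (ex_mono hp h).trans_eq (ex_const hp c)

theorem abs_ex_le {p : PMF α} (hp : p.support.Finite) (f : α → ℝ) :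
    |ex p f| ≤ ex p (fun x => |f x|) := by
  rw [abs_le, ← ex_neg]
  exact ⟨ex_mono hp fun x _ => neg_abs_le _, ex_mono hp fun x _ => le_abs_self _⟩

theorem ex_pure (x : α) (f : α → ℝ) : ex (PMF.pure x) f = f x := by
  rw [ex_eq_sum (s := {x}) (by simp)]
  simp

theorem finite_support_pure (x : α) : (PMF.pure x).support.Finite := by simp

theorem finite_support_bind {p : PMF α} {q : α → PMF β} (hp : p.support.Finite)
    (hq : ∀ x ∈ p.support, (q x).support.Finite) : (p.bind q).support.Finite := by
  rw [PMF.support_bind]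
  exact hp.biUnion hq

theorem finite_support_map {p : PMF α} (g : α → β) (hp : p.support.Finite) :
    (p.map g).support.Finite := by
  rw [PMF.support_map]
  exact hp.image g

theorem ex_bind {p : PMF α} {q : α → PMF β} (hp : p.support.Finite)
    (hq : ∀ x ∈ p.support, (q x).support.Finite) (f : β → ℝ) :
    ex (p.bind q) f = ex p (fun x => ex (q x) f) := by
  classical
  have hb := finite_support_bind hp hq
  rw [ex_eq_sum (s := hb.toFinset) (by simp), ex_eq_sum (s := hp.toFinset) (by simp)]
  have h1 : ∀ x ∈ hp.toFinset, (p x).toReal * ex (q x) f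
      = ∑ y ∈ hb.toFinset, (p x).toReal * ((q x y).toReal * f y) := by
    intro x hx
    rw [ex_eq_sum (s := hb.toFinset) ?_, Finset.mul_sum]
    intro y hy
    have hx' : x ∈ p.support := by simpa using hx
    have : y ∈ (p.bind q).support := by
      rw [PMF.support_bind]
      exact Set.mem_biUnion hx' hy
    simpa using this
  rw [Finset.sum_congr rfl h1, Finset.sum_comm]
  refine Finset.sum_congr rfl fun y _ => ?_
  rw [PMF.bind_apply, tsum_eq_sum (s := hp.toFinset) (fun x hx => by
    have : p x = 0 := by simpa using hx
    simp [this]), ENNReal.toReal_sum (fun x _ => ENNReal.mul_ne_top (p.apply_ne_top x)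
      ((q x).apply_ne_top y)), Finset.sum_mul]
  exact Finset.sum_congr rfl fun x _ => by rw [ENNReal.toReal_mul]; ring

theorem ex_map {p : PMF α} (hp : p.support.Finite) (g : α → β) (f : β → ℝ) :
    ex (p.map g) f = ex p (fun x => f (g x)) := by
  rw [← PMF.bind_pure_comp, ex_bind (q := PMF.pure ∘ g) hp fun x _ => finite_support_pure _]
  exact ex_congr fun x _ => by simp [ex_pure]

theorem tsum_mul_ofReal {p : PMF α} (hp : p.support.Finite) {f : α → ℝ} (hf : ∀ x, 0 ≤ f x) :
    ∑' x, p x * ENNReal.ofReal (f x) = ENNReal.ofReal (ex p f) := by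
  rw [ex_eq_sum (s := hp.toFinset) (by simp), tsum_eq_sum (s := hp.toFinset) (fun x hx => by
    have : p x = 0 := by simpa using hx
    simp [this]), ENNReal.ofReal_sum_of_nonneg
      (fun x _ => mul_nonneg ENNReal.toReal_nonneg (hf x))]
  refine Finset.sum_congr rfl fun x _ => ?_
  rw [ENNReal.ofReal_mul ENNReal.toReal_nonneg, ENNReal.ofReal_toReal (p.apply_ne_top x)]

/-- For `|y| ≤ 1`, `exp y ≤ 1 + y + y ^ 2`; the linear term has mean zero, and `1 + y ≤ exp y` turns
the result back into an exponential. -/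
theorem ex_exp_le {p : PMF α} (hp : p.support.Finite) {f : α → ℝ} {c t : ℝ}
    (ht : 0 ≤ t) (htc : t * c ≤ 1) (hf : ∀ x ∈ p.support, |f x| ≤ c) (h0 : ex p f = 0) :
    ex p (fun x => Real.exp (t * f x)) ≤ Real.exp (t ^ 2 * c ^ 2) := by
  have h1 : ex p (fun x => Real.exp (t * f x)) ≤ ex p (fun x => (1 + t ^ 2 * c ^ 2) + t * f x) := by
    refine ex_mono hp fun x hx => ?_
    have hx1 : |t * f x| ≤ t * c := by
      rw [abs_mul, abs_of_nonneg ht]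
      exact mul_le_mul_of_nonneg_left (hf x hx) ht
    have h2 := Real.abs_exp_sub_one_sub_id_le (hx1.trans htc)
    have h3 : (t * f x) ^ 2 ≤ (t * c) ^ 2 := sq_le_sq' (by linarith [neg_abs_le (t * f x)])
      ((le_abs_self _).trans hx1)
    have h4 := (abs_le.1 h2).2
    nlinarith
  rw [ex_add hp, ex_const hp, ex_mul_left, h0, mul_zero, add_zero] at h1
  exact h1.trans (by rw [add_comm]; exact Real.add_one_le_exp _)

end Expectation

/-! ### Conditioning a run on its history -/

section Markov

variable {Ω : Type*} [MeasurableSpace Ω] {z : PMF ℕ} {c a : ℝ} {S₀ : Facets} {μ : Measure Ω}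
  {X : ℕ → Ω → Facets}

/-- The first `n + 1` states of a run. -/
def history (X : ℕ → Ω → Facets) (n : ℕ) (ω : Ω) : Fin (n + 1) → Facets := fun i => X i ω

/-- The Markov property for functionals of the whole past. Histories take countably many values, so
both integrals are sums over atoms, where the identity is the defining transition rule. -/
theorem lintegral_transition (h : IsRun z c a S₀ μ X) (n : ℕ)
    (Ψ : (Fin (n + 1) → Facets) → Facets → ℝ≥0∞) :
    ∫⁻ ω, Ψ (history X n ω) (X (n + 1) ω) ∂μ =
      ∫⁻ ω, ∑' S, step z c a (X n ω) S * Ψ (history X n ω) S ∂μ := by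
  let mF : MeasurableSpace Facets := ⊤
  let mH : MeasurableSpace (Fin (n + 1) → Facets) := ⊤
  have hX : ∀ n, Measurable (X n) := fun n => measurable_to_countable' fun S =>
    h.measurableSet_eq n S
  have hset : ∀ x : Fin (n + 1) → Facets, history X n ⁻¹' {x} =
      {ω | ∀ i ≤ n, X i ω = (fun i => if hi : i < n + 1 then x ⟨i, hi⟩ else ∅) i} := by
    intro x
    ext ω
    simp only [Set.mem_preimage, Set.mem_singleton_iff, Set.mem_ofPred_eq, funext_iff, history]
    constructor
    · intro hx i hi
      rw [dif_pos (Nat.lt_succ_of_le hi)]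
      exact hx ⟨i, Nat.lt_succ_of_le hi⟩
    · intro hx i
      have := hx i (Nat.le_of_lt_succ i.2)
      rw [dif_pos i.2] at this
      exact this
  have hH : Measurable (history X n) := measurable_to_countable' fun x => by
    have : history X n ⁻¹' {x} = ⋂ i : Fin (n + 1), {ω | X i ω = x i} := by
      ext ω
      simp [history, funext_iff]
    rw [this]
    exact MeasurableSet.iInter fun i => h.measurableSet_eq i _
  let mP : MeasurableSpace ((Fin (n + 1) → Facets) × Facets) := ⊤
  have hP : Measurable fun ω => (history X n ω, X (n + 1) ω) := measurable_to_countable' fun y => by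
    have : (fun ω => (history X n ω, X (n + 1) ω)) ⁻¹' {y} =
        history X n ⁻¹' {y.1} ∩ X (n + 1) ⁻¹' {y.2} := by
      ext ω
      simp [Prod.ext_iff]
    rw [this]
    exact (hH (MeasurableSpace.measurableSet_top)).inter (hX _ (MeasurableSpace.measurableSet_top))
  have e1 : ∫⁻ ω, Ψ (history X n ω) (X (n + 1) ω) ∂μ =
      ∫⁻ y, Ψ y.1 y.2 ∂(μ.map fun ω => (history X n ω, X (n + 1) ω)) :=
    (lintegral_map (f := fun y : (Fin (n + 1) → Facets) × Facets => Ψ y.1 y.2)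
      measurable_from_top hP).symm
  have e2 : ∫⁻ ω, ∑' S, step z c a (X n ω) S * Ψ (history X n ω) S ∂μ =
      ∫⁻ x, (∑' S, step z c a (x (Fin.last n)) S * Ψ x S) ∂(μ.map (history X n)) :=
    (lintegral_map (f := fun x : Fin (n + 1) → Facets =>
      ∑' S, step z c a (x (Fin.last n)) S * Ψ x S) measurable_from_top hH).symm
  rw [e1, e2, lintegral_countable', lintegral_countable', ENNReal.tsum_prod']
  refine tsum_congr fun x => ?_
  rw [← ENNReal.tsum_mul_right]
  refine tsum_congr fun S => ?_
  rw [Measure.map_apply hP (MeasurableSpace.measurableSet_top),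
    Measure.map_apply hH (MeasurableSpace.measurableSet_top)]
  have hs : (fun ω => (history X n ω, X (n + 1) ω)) ⁻¹' {(x, S)} =
      {ω | (∀ i ≤ n, X i ω = (fun i => if hi : i < n + 1 then x ⟨i, hi⟩ else ∅) i) ∧
        X (n + 1) ω = S} := by
    ext ω
    have := Set.ext_iff.1 (hset x) ω
    simp only [Set.mem_preimage, Set.mem_singleton_iff, Prod.ext_iff, Set.mem_ofPred_eq] at this ⊢
    rw [this]
  rw [hs, h.transition, ← hset]
  simp only [Nat.lt_succ_self, dif_pos, Fin.last]
  ring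

theorem ae_mem_support_step (h : IsRun z c a S₀ μ X) :
    ∀ᵐ ω ∂μ, ∀ n, X (n + 1) ω ∈ (step z c a (X n ω)).support := by
  refine ae_all_iff.2 fun n => ?_
  classical
  have h1 := lintegral_transition h n fun x S =>
    if step z c a (x (Fin.last n)) S = 0 then 1 else 0
  have h2 : ∫⁻ ω, ∑' S, step z c a (X n ω) S *
      (if step z c a (history X n ω (Fin.last n)) S = 0 then (1 : ℝ≥0∞) else 0) ∂μ = 0 := by
    have : ∀ ω S, step z c a (X n ω) S *
        (if step z c a (history X n ω (Fin.last n)) S = 0 then (1 : ℝ≥0∞) else 0) = 0 := by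
      intro ω S
      have e : history X n ω (Fin.last n) = X n ω := rfl
      rw [e]
      split_ifs with h0 <;> simp [h0]
    simp [this]
  rw [h2] at h1
  have hset : MeasurableSet {ω | step z c a (X n ω) (X (n + 1) ω) = 0} := by
    have : {ω | step z c a (X n ω) (X (n + 1) ω) = 0} =
        ⋃ y : {y : Facets × Facets // step z c a y.1 y.2 = 0},
          ({ω | X n ω = y.1.1} ∩ {ω | X (n + 1) ω = y.1.2}) := by
      ext ω
      simp only [Set.mem_ofPred_eq, Set.mem_iUnion, Set.mem_inter_iff]
      constructor
      · intro h0
        exact ⟨⟨(X n ω, X (n + 1) ω), h0⟩, rfl, rfl⟩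
      · rintro ⟨⟨y, hy⟩, h3, h4⟩
        simp only at h3 h4
        rw [h3, h4]
        exact hy
    rw [this]
    exact MeasurableSet.iUnion fun y => (h.measurableSet_eq _ _).inter (h.measurableSet_eq _ _)
  have h3 : ∫⁻ ω, (if step z c a (history X n ω (Fin.last n)) (X (n + 1) ω) = 0
      then (1 : ℝ≥0∞) else 0) ∂μ = μ {ω | step z c a (X n ω) (X (n + 1) ω) = 0} := by
    rw [← lintegral_indicator_one hset]
    refine lintegral_congr fun ω => ?_
    simp only [Set.indicator_apply, Set.mem_ofPred_eq, Pi.one_apply]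
    rfl
  rw [h3] at h1
  have : ∀ᵐ ω ∂μ, ¬ step z c a (X n ω) (X (n + 1) ω) = 0 := by
    rw [ae_iff]
    simpa using h1
  filter_upwards [this] with ω hω
  exact (PMF.mem_support_iff _ _).2 hω

end Markov

end GeneSCs

namespace GeneSCs

section Support

variable {z : PMF ℕ} {c a : ℝ}

theorem pickWeight_eq_zero {S : Facets} {A : Finset ℕ} {v : ℕ} (h : v ∉ vertices S \ A) :
    pickWeight a S A v = 0 := if_neg h

theorem finite_support_pick (S : Facets) (A : Finset ℕ) : (pick a S A).support.Finite := by
  unfold pick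
  split_ifs with h
  · exact finite_support_pure _
  · refine finite_support_map _ ((vertices S \ A).finite_toSet.subset fun v hv => ?_)
    rw [PMF.mem_support_normalize_iff] at hv
    by_contra h'
    exact hv (pickWeight_eq_zero h')

theorem finite_support_picks (S : Facets) (m : ℕ) : (picks a S m).support.Finite := by
  induction m with
  | zero => exact finite_support_pure _
  | succ m ih => exact finite_support_bind ih fun A _ => finite_support_pick S A

theorem finite_support_step (hz : z.support.Finite) (S : Facets) :
    (step z c a S).support.Finite :=
  finite_support_bind hz fun _ _ => finite_support_map _ (finite_support_picks S _)

end Support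

/-! ### Concentration and laws of large numbers -/

section LargeNumbers

variable {Ω : Type*} [MeasurableSpace Ω] {z : PMF ℕ} {c a : ℝ} {S₀ : Facets} {μ : Measure Ω}
  {X : ℕ → Ω → Facets}

/-- Each step contributes at most the factor `exp (t² C²)`, by conditioning on the history. The
increment may also depend on the state at `n₀`, which is part of the history from then on; this
allows test functions chosen at the start of a window. -/
theorem lintegral_exp_sum_le [IsProbabilityMeasure μ] (hz : z.support.Finite)
    (h : IsRun z c a S₀ μ X)
    {ξ : Facets → Facets → Facets → ℝ} {C t : ℝ} (ht : 0 ≤ t) (htC : t * C ≤ 1)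
    (hb : ∀ R S, ∀ S' ∈ (step z c a S).support, |ξ R S S'| ≤ C)
    (h0 : ∀ R S, ex (step z c a S) (ξ R S) = 0) (n₀ k : ℕ) :
    ∫⁻ ω, ENNReal.ofReal (Real.exp (t * ∑ i ∈ Finset.Ico n₀ (n₀ + k),
      ξ (X n₀ ω) (X i ω) (X (i + 1) ω))) ∂μ ≤ ENNReal.ofReal (Real.exp (k * (t ^ 2 * C ^ 2))) := by
  induction k with
  | zero => simp
  | succ k ih =>
    set n := n₀ + k with hn
    -- A history as a sequence; the value `∅` at times after `n` is never used.
    let e : (Fin (n + 1) → Facets) → ℕ → Facets := fun x i => if hi : i < n + 1 then x ⟨i, hi⟩ else ∅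
    have he : ∀ ω, ∀ i ≤ n, e (history X n ω) i = X i ω := fun ω i hi => by
      simp only [e]
      rw [dif_pos (Nat.lt_succ_of_le hi)]
      rfl
    let Ψ : (Fin (n + 1) → Facets) → Facets → ℝ≥0∞ := fun x S =>
      ENNReal.ofReal (Real.exp (t * ∑ i ∈ Finset.Ico n₀ n, ξ (e x n₀) (e x i) (e x (i + 1)))) *
        ENNReal.ofReal (Real.exp (t * ξ (e x n₀) (e x n) S))
    have h1 : ∀ ω, ENNReal.ofReal (Real.exp (t * ∑ i ∈ Finset.Ico n₀ (n₀ + (k + 1)),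
        ξ (X n₀ ω) (X i ω) (X (i + 1) ω))) = Ψ (history X n ω) (X (n + 1) ω) := by
      intro ω
      simp only [Ψ]
      rw [← ENNReal.ofReal_mul (Real.exp_pos _).le, ← Real.exp_add, ← mul_add, ← add_assoc, ← hn,
        Finset.sum_Ico_succ_top (by omega), he ω n₀ (by omega), he ω n le_rfl]
      congr 4
      refine Finset.sum_congr rfl fun i hi => ?_
      rw [Finset.mem_Ico] at hi
      rw [he ω i (by omega), he ω (i + 1) (by omega)]
    simp_rw [h1]
    rw [lintegral_transition h n Ψ]
    have h2 : ∀ ω, ∑' S, step z c a (X n ω) S * Ψ (history X n ω) S ≤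
        ENNReal.ofReal (Real.exp (t * ∑ i ∈ Finset.Ico n₀ n,
          ξ (X n₀ ω) (X i ω) (X (i + 1) ω))) * ENNReal.ofReal (Real.exp (t ^ 2 * C ^ 2)) := by
      intro ω
      have e1 : ∀ S, step z c a (X n ω) S * Ψ (history X n ω) S =
          ENNReal.ofReal (Real.exp (t * ∑ i ∈ Finset.Ico n₀ n,
            ξ (X n₀ ω) (X i ω) (X (i + 1) ω))) * (step z c a (X n ω) S *
              ENNReal.ofReal (Real.exp (t * ξ (X n₀ ω) (X n ω) S))) := by
        intro S
        simp only [Ψ]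
        have e2 : ∑ i ∈ Finset.Ico n₀ n, ξ (X n₀ ω) (e (history X n ω) i)
            (e (history X n ω) (i + 1)) =
            ∑ i ∈ Finset.Ico n₀ n, ξ (X n₀ ω) (X i ω) (X (i + 1) ω) :=
          Finset.sum_congr rfl fun i hi => by
            rw [Finset.mem_Ico] at hi
            rw [he ω i (by omega), he ω (i + 1) (by omega)]
        rw [he ω n₀ (by omega), he ω n le_rfl, mul_left_comm, e2]
      simp_rw [e1]
      rw [ENNReal.tsum_mul_left, tsum_mul_ofReal (finite_support_step hz _)
        (fun S => (Real.exp_pos _).le)]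
      gcongr
      exact ex_exp_le (finite_support_step hz _) ht htC (hb _ _) (h0 _ _)
    refine (lintegral_mono h2).trans ?_
    rw [lintegral_mul_const' _ _ ENNReal.ofReal_ne_top]
    refine (mul_le_mul_left ih _).trans ?_
    rw [← ENNReal.ofReal_mul (Real.exp_pos _).le, ← Real.exp_add]
    apply ENNReal.ofReal_le_ofReal
    rw [Real.exp_le_exp]
    push_cast
    linarith

/-- The sum of the centred increments of `f` along a run. -/
noncomputable def centredSum (z : PMF ℕ) (c a : ℝ) (f : Facets → Facets → Facets → ℝ)
    (x : ℕ → Facets) (n₀ n : ℕ) : ℝ :=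
  ∑ i ∈ Finset.Ico n₀ n, (f (x n₀) (x i) (x (i + 1)) - ex (step z c a (x i)) (f (x n₀) (x i)))

theorem measure_centredSum_ge_le [IsProbabilityMeasure μ] (hz : z.support.Finite)
    (h : IsRun z c a S₀ μ X) {f : Facets → Facets → Facets → ℝ} {C : ℝ} (hC : 0 < C)
    (hb : ∀ R S, ∀ S' ∈ (step z c a S).support, |f R S S'| ≤ C) (n₀ k N : ℕ) (hk : k ≤ N) {δ : ℝ}
    (hδ : 0 < δ) (hδC : δ ≤ 4 * C) :
    μ {ω | δ * N ≤ centredSum z c a f (fun i => X i ω) n₀ (n₀ + k)} ≤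
      ENNReal.ofReal (Real.exp (-(δ ^ 2 / (16 * C ^ 2)) * N)) := by
  have hfin : ∀ S, (step z c a S).support.Finite := finite_support_step hz
  set ξ : Facets → Facets → Facets → ℝ := fun R S S' => f R S S' - ex (step z c a S) (f R S) with hξ
  -- The centred increments are bounded by `2 * C`, and this `t` minimizes `(2 * C * t) ^ 2 - δ *
  -- t`, with minimum `-δ ^ 2 / (16 * C ^ 2)`. The condition `δ ≤ 4 * C` gives `t * (2 * C) ≤ 1`.
  set t : ℝ := δ / (8 * C ^ 2) with ht
  have ht0 : 0 < t := by positivity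
  have htC : t * (2 * C) ≤ 1 := by
    rw [ht, div_mul_eq_mul_div, div_le_one (by positivity)]
    nlinarith
  have hex : ∀ R S, |ex (step z c a S) (f R S)| ≤ C := fun R S =>
    (abs_ex_le (hfin S) _).trans (ex_le_const (hfin S) (hb R S))
  have hbξ : ∀ R S, ∀ S' ∈ (step z c a S).support, |ξ R S S'| ≤ 2 * C := fun R S S' hS' => by
    refine (abs_sub _ _).trans ?_
    linarith [hb R S S' hS', hex R S]
  have h0 : ∀ R S, ex (step z c a S) (ξ R S) = 0 := fun R S => by
    simp only [hξ]
    rw [ex_sub (hfin S), ex_const (hfin S), sub_self]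
  have h1 := lintegral_exp_sum_le hz h ht0.le htC hbξ h0 n₀ k
  have h2 : {ω | δ * N ≤ centredSum z c a f (fun i => X i ω) n₀ (n₀ + k)} ⊆
      {ω | ENNReal.ofReal (Real.exp (t * (δ * N))) ≤ ENNReal.ofReal (Real.exp (t *
        ∑ i ∈ Finset.Ico n₀ (n₀ + k), ξ (X n₀ ω) (X i ω) (X (i + 1) ω)))} := by
    intro ω hω
    exact ENNReal.ofReal_le_ofReal (Real.exp_le_exp.2 (mul_le_mul_of_nonneg_left hω ht0.le))
  have hpos : 0 < Real.exp (t * (δ * N)) := Real.exp_pos _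
  have hmeas : AEMeasurable (fun ω => ENNReal.ofReal (Real.exp (t *
        ∑ i ∈ Finset.Ico n₀ (n₀ + k), ξ (X n₀ ω) (X i ω) (X (i + 1) ω)))) μ := by
    let mF : MeasurableSpace Facets := ⊤
    let mF3 : MeasurableSpace (Facets × Facets × Facets) := ⊤
    have hX : ∀ n, Measurable (X n) := fun n => measurable_to_countable' fun S =>
      h.measurableSet_eq n S
    refine Measurable.aemeasurable ?_
    refine ENNReal.measurable_ofReal.comp (Real.measurable_exp.comp (Measurable.const_mul ?_ t))
    refine Finset.measurable_fun_sum _ fun i _ => ?_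
    have : Measurable fun ω => (X n₀ ω, X i ω, X (i + 1) ω) := measurable_to_countable' fun y => by
      have : (fun ω => (X n₀ ω, X i ω, X (i + 1) ω)) ⁻¹' {y} =
          X n₀ ⁻¹' {y.1} ∩ (X i ⁻¹' {y.2.1} ∩ X (i + 1) ⁻¹' {y.2.2}) := by
        ext ω
        simp [Prod.ext_iff]
      rw [this]
      exact (h.measurableSet_eq _ _).inter ((h.measurableSet_eq _ _).inter (h.measurableSet_eq _ _))
    exact (measurable_from_top (f := fun y : Facets × Facets × Facets => ξ y.1 y.2.1 y.2.2)).comp this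
  refine (measure_mono h2).trans ?_
  refine (meas_ge_le_lintegral_div hmeas (by simpa using hpos) ENNReal.ofReal_ne_top).trans ?_
  refine (ENNReal.div_le_div_right h1 _).trans ?_
  rw [← ENNReal.ofReal_div_of_pos hpos, ← Real.exp_sub]
  apply ENNReal.ofReal_le_ofReal
  rw [Real.exp_le_exp]
  have hkN : (k : ℝ) ≤ N := by exact_mod_cast hk
  have h3 : (k : ℝ) * (t ^ 2 * (2 * C) ^ 2) ≤ N * (t ^ 2 * (2 * C) ^ 2) := by gcongr
  have h4 : t * (δ * N) = δ ^ 2 / (8 * C ^ 2) * N := by rw [ht]; ring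
  have h5 : (N : ℝ) * (t ^ 2 * (2 * C) ^ 2) = δ ^ 2 / (16 * C ^ 2) * N := by
    rw [ht]; field_simp; ring
  have h6 : δ ^ 2 / (8 * C ^ 2) * N = 2 * (δ ^ 2 / (16 * C ^ 2) * N) := by field_simp; ring
  linarith

theorem centredSum_neg (f : Facets → Facets → Facets → ℝ) (x : ℕ → Facets) (n₀ n : ℕ) :
    centredSum z c a (fun R S S' => -f R S S') x n₀ n = -centredSum z c a f x n₀ n := by
  unfold centredSum
  rw [← Finset.sum_neg_distrib]
  refine Finset.sum_congr rfl fun i _ => ?_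
  rw [ex_neg]
  ring

theorem measure_abs_centredSum_ge_le [IsProbabilityMeasure μ] (hz : z.support.Finite)
    (h : IsRun z c a S₀ μ X) {f : Facets → Facets → Facets → ℝ} {C : ℝ} (hC : 0 < C)
    (hb : ∀ R S, ∀ S' ∈ (step z c a S).support, |f R S S'| ≤ C) (n₀ k N : ℕ) (hk : k ≤ N) {δ : ℝ}
    (hδ : 0 < δ) (hδC : δ ≤ 4 * C) :
    μ {ω | δ * N ≤ |centredSum z c a f (fun i => X i ω) n₀ (n₀ + k)|} ≤
      2 * ENNReal.ofReal (Real.exp (-(δ ^ 2 / (16 * C ^ 2)) * N)) := by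
  have h1 := measure_centredSum_ge_le hz h hC hb n₀ k N hk hδ hδC
  have h2 := measure_centredSum_ge_le hz h (f := fun R S S' => -f R S S') hC
    (by simpa using hb) n₀ k N hk hδ hδC
  rw [two_mul]
  refine (measure_mono ?_).trans ((measure_union_le _ _).trans (add_le_add h1 h2))
  intro ω hω
  rcases le_abs.1 (show δ * N ≤ |_| from hω) with h | h
  · exact Or.inl h
  · refine Or.inr ?_
    change _ ≤ centredSum z c a (fun R S S' => -f R S S') _ _ _
    rwa [centredSum_neg]

theorem summable_mul_exp_neg {b : ℝ} (hb : 0 < b) (K : ℝ) :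
    Summable fun n : ℕ => (K * n + 1) * (2 * Real.exp (-b * n)) := by
  have h1 := Real.summable_pow_mul_exp_neg_nat_mul 1 hb
  have h0 := Real.summable_pow_mul_exp_neg_nat_mul 0 hb
  refine ((h1.mul_left (2 * K)).add (h0.mul_left 2)).congr fun n => ?_
  simp
  ring

/-- Uniform law of large numbers on windows `[n₀, K n₀]`. -/
theorem ae_abs_centredSum_le [IsProbabilityMeasure μ] (hz : z.support.Finite)
    (h : IsRun z c a S₀ μ X) {f : Facets → Facets → Facets → ℝ} {C : ℝ}
    (hb : ∀ R S, ∀ S' ∈ (step z c a S).support, |f R S S'| ≤ C) :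
    ∀ᵐ ω ∂μ, ∀ δ : ℝ, 0 < δ → ∀ K : ℕ, ∀ᶠ n₀ in atTop, ∀ n, n₀ ≤ n → n ≤ K * n₀ →
      |centredSum z c a f (fun i => X i ω) n₀ n| ≤ δ * n₀ := by
  wlog hC : 0 < C generalizing C
  · exact this (C := max C 1) (fun R S S' hS' => (hb R S S' hS').trans (le_max_left _ _))
      (lt_max_of_lt_right one_pos)
  -- Countably many accuracies suffice; `4 * C / (p + 1)` lies in the range of the tail bound. The
  -- union over the linearly many times of a window does not spoil the exponential decay.
  have key : ∀ (p K : ℕ), ∀ᵐ ω ∂μ, ∀ᶠ n₀ in atTop, ∀ n, n₀ ≤ n → n ≤ (K + 1) * n₀ →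
      |centredSum z c a f (fun i => X i ω) n₀ n| ≤ (4 * C / (p + 1)) * ((K + 1 : ℕ) * n₀ : ℕ) := by
    intro p K
    set δ : ℝ := 4 * C / (p + 1) with hδ
    have hδ0 : 0 < δ := by positivity
    have hδC : δ ≤ 4 * C := div_le_self (by positivity) (by linarith [p.cast_nonneg (α := ℝ)])
    let s : ℕ → Set Ω := fun n₀ => ⋃ k ∈ Finset.range ((K + 1) * n₀ + 1),
      {ω | δ * ((K + 1) * n₀ : ℕ) ≤ |centredSum z c a f (fun i => X i ω) n₀ (n₀ + min k ((K+1) * n₀))|}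
    set b : ℝ := δ ^ 2 / (16 * C ^ 2) * (K + 1) with hb'
    have hb0 : 0 < b := by positivity
    have hs : ∀ n₀, μ (s n₀) ≤
        ENNReal.ofReal (((K + 1 : ℝ) * n₀ + 1) * (2 * Real.exp (-b * n₀))) := by
      intro n₀
      refine (measure_biUnion_finset_le _ _).trans ?_
      refine (Finset.sum_le_sum fun k _ => measure_abs_centredSum_ge_le hz h hC hb n₀ _ _
        (min_le_right k ((K + 1) * n₀)) hδ0 hδC).trans ?_
      rw [Finset.sum_const, Finset.card_range, nsmul_eq_mul, ENNReal.ofReal_mul (by positivity),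
        ENNReal.ofReal_mul (by positivity)]
      refine le_of_eq ?_
      congr 1
      · rw [← ENNReal.ofReal_natCast]
        push_cast
        rfl
      · rw [hb']
        push_cast
        simp only [ENNReal.ofReal_ofNat]
        rw [show -(δ ^ 2 / (16 * C ^ 2)) * ((K + 1 : ℝ) * n₀) =
          -(δ ^ 2 / (16 * C ^ 2) * (K + 1)) * n₀ by ring]
    have hsum : ∑' n₀, μ (s n₀) ≠ ∞ := by
      refine ne_top_of_le_ne_top ?_ (ENNReal.tsum_le_tsum hs)
      exact (summable_mul_exp_neg hb0 _).tsum_ofReal_ne_top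
    filter_upwards [ae_eventually_notMem hsum] with ω hω
    filter_upwards [hω] with n₀ hn n hn1 hn2
    by_contra hcon
    push Not at hcon
    refine hn ?_
    simp only [s, Set.mem_iUnion, Finset.mem_range]
    refine ⟨n - n₀, by omega, ?_⟩
    have e : n₀ + min (n - n₀) ((K + 1) * n₀) = n := by
      rw [min_eq_left (by omega)]
      omega
    rw [Set.mem_ofPred_eq, e]
    exact hcon.le
  filter_upwards [ae_all_iff.2 fun p => ae_all_iff.2 fun K => key p K] with ω hω δ hδ K
  obtain ⟨p, hp⟩ := exists_nat_gt (4 * C * (K + 1) / δ)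
  filter_upwards [hω p K] with n₀ hn n hn1 hn2
  refine (hn n hn1 (hn2.trans (Nat.mul_le_mul_right _ (Nat.le_succ K)))).trans ?_
  push_cast
  rw [← mul_assoc]
  refine mul_le_mul_of_nonneg_right ?_ (Nat.cast_nonneg _)
  rw [div_lt_iff₀ hδ] at hp
  rw [div_mul_eq_mul_div, div_le_iff₀ (by positivity)]
  nlinarith

/-- Law of large numbers for the increments of functions of two consecutive states. -/
theorem ae_tendsto_centredSum_div [IsProbabilityMeasure μ] (hz : z.support.Finite)
    (h : IsRun z c a S₀ μ X) {f : Facets → Facets → ℝ} {C : ℝ}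
    (hb : ∀ S, ∀ S' ∈ (step z c a S).support, |f S S'| ≤ C) :
    ∀ᵐ ω ∂μ, Tendsto (fun n : ℕ => (∑ i ∈ Finset.range n, (f (X i ω) (X (i + 1) ω) -
      ex (step z c a (X i ω)) (f (X i ω)))) / n) atTop (𝓝 0) := by
  wlog hC : 0 < C generalizing C
  · exact this (C := max C 1) (fun S S' hS' => (hb S S' hS').trans (le_max_left _ _))
      (lt_max_of_lt_right one_pos)
  have key : ∀ p : ℕ, ∀ᵐ ω ∂μ, ∀ᶠ n in atTop,
      |centredSum z c a (fun _ => f) (fun i => X i ω) 0 n| < (4 * C / (p + 1)) * n := by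
    intro p
    set δ : ℝ := 4 * C / (p + 1) with hδ
    have hδ0 : 0 < δ := by positivity
    have hδC : δ ≤ 4 * C := div_le_self (by positivity) (by linarith [p.cast_nonneg (α := ℝ)])
    set b : ℝ := δ ^ 2 / (16 * C ^ 2) with hb'
    have hb0 : 0 < b := by positivity
    have hs : ∀ n : ℕ, μ {ω | δ * n ≤ |centredSum z c a (fun _ => f) (fun i => X i ω) 0 (0 + n)|} ≤
        ENNReal.ofReal (((0 : ℝ) * n + 1) * (2 * Real.exp (-b * n))) := by
      intro n
      refine (measure_abs_centredSum_ge_le hz h hC (fun _ => hb) 0 n n le_rfl hδ0 hδC).trans ?_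
      rw [zero_mul, zero_add, one_mul, ENNReal.ofReal_mul (by positivity)]
      simp [hb']
    have hsum : ∑' n : ℕ, μ {ω | δ * n ≤
        |centredSum z c a (fun _ => f) (fun i => X i ω) 0 (0 + n)|} ≠ ∞ := by
      refine ne_top_of_le_ne_top ?_ (ENNReal.tsum_le_tsum hs)
      exact (summable_mul_exp_neg hb0 _).tsum_ofReal_ne_top
    filter_upwards [ae_eventually_notMem hsum] with ω hω
    filter_upwards [hω] with n hn
    rw [zero_add] at hn
    exact not_le.1 hn
  filter_upwards [ae_all_iff.2 key] with ω hω
  rw [Metric.tendsto_atTop']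
  intro δ hδ
  obtain ⟨p, hp⟩ := exists_nat_gt (4 * C / δ)
  obtain ⟨N, hN⟩ := eventually_atTop.1 (hω p)
  refine ⟨N, fun n hn => ?_⟩
  have h1 := hN n hn.le
  have hn0 : (0 : ℝ) < n := by exact_mod_cast (Nat.zero_le N).trans_lt hn
  rw [Real.dist_eq, sub_zero, abs_div, abs_of_pos hn0, div_lt_iff₀ hn0]
  unfold centredSum at h1
  rw [← Finset.range_eq_Ico] at h1
  refine h1.trans_le (mul_le_mul_of_nonneg_right ?_ hn0.le)
  rw [div_lt_iff₀ hδ] at hp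
  rw [div_le_iff₀ (by positivity)]
  nlinarith

end LargeNumbers

end GeneSCs

namespace GeneSCs

/-! ### Preferential attachment weights -/

section Weights

variable {a : ℝ} {S : Facets}

/-- The weight of a vertex in preferential attachment: its facet degree plus `a`. -/
noncomputable def wt (a : ℝ) (S : Facets) (v : ℕ) : ℝ :=
  if v ∈ vertices S then (facetDegree S v : ℝ) + a else 0

/-- The total weight of the vertices. -/
noncomputable def totalWt (a : ℝ) (S : Facets) : ℝ := ∑ v ∈ vertices S, wt a S v

/-- The probability that the first pick is `v`. -/
noncomputable def pr (a : ℝ) (S : Facets) (v : ℕ) : ℝ := wt a S v / totalWt a S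

theorem mem_vertices {v : ℕ} : v ∈ vertices S ↔ ∃ F ∈ S, v ∈ F := by
  simp [vertices]

theorem facetDegree_pos {v : ℕ} (hv : v ∈ vertices S) : 0 < facetDegree S v := by
  obtain ⟨F, hF, hvF⟩ := mem_vertices.1 hv
  exact Finset.card_pos.2 ⟨F, Finset.mem_filter.2 ⟨hF, hvF⟩⟩

theorem facetDegree_eq_zero {v : ℕ} (hv : v ∉ vertices S) : facetDegree S v = 0 := by
  rw [facetDegree, Finset.card_eq_zero, Finset.filter_eq_empty_iff]
  exact fun F hF hvF => hv (mem_vertices.2 ⟨F, hF, hvF⟩)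

theorem wt_of_mem {v : ℕ} (hv : v ∈ vertices S) : wt a S v = facetDegree S v + a := if_pos hv

theorem one_le_wt (ha : 0 ≤ a) {v : ℕ} (hv : v ∈ vertices S) : 1 ≤ wt a S v := by
  rw [wt_of_mem hv]
  have : (1 : ℝ) ≤ facetDegree S v := by exact_mod_cast facetDegree_pos hv
  linarith

theorem wt_nonneg (ha : 0 ≤ a) (v : ℕ) : 0 ≤ wt a S v := by
  unfold wt
  split_ifs
  · positivity
  · exact le_rfl

theorem totalWt_nonneg (ha : 0 ≤ a) : 0 ≤ totalWt a S :=
  Finset.sum_nonneg fun v _ => wt_nonneg ha v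

theorem card_le_sum_wt (ha : 0 ≤ a) {A : Finset ℕ} (hA : A ⊆ vertices S) :
    (A.card : ℝ) ≤ ∑ v ∈ A, wt a S v := by
  rw [← mul_one (A.card : ℝ), ← nsmul_eq_mul]
  exact Finset.card_nsmul_le_sum _ _ _ fun v hv => one_le_wt ha (hA hv)

theorem pr_nonneg (ha : 0 ≤ a) (v : ℕ) : 0 ≤ pr a S v :=
  div_nonneg (wt_nonneg ha v) (totalWt_nonneg ha)

theorem sum_pr (hT : totalWt a S ≠ 0) : ∑ v ∈ vertices S, pr a S v = 1 := by
  unfold pr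
  rw [← Finset.sum_div]
  exact div_self hT

theorem pr_le_one (ha : 0 ≤ a) (v : ℕ) : pr a S v ≤ 1 := by
  refine div_le_one_of_le₀ ?_ (totalWt_nonneg ha)
  by_cases hv : v ∈ vertices S
  · exact Finset.single_le_sum (fun v _ => wt_nonneg ha v) hv
  · rw [wt, if_neg hv]
    exact totalWt_nonneg ha

theorem sum_sdiff_wt {A : Finset ℕ} (hA : A ⊆ vertices S) :
    ∑ v ∈ vertices S \ A, wt a S v = totalWt a S - ∑ v ∈ A, wt a S v := by
  rw [totalWt, ← Finset.sum_sdiff hA, add_sub_cancel_right]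

end Weights

/-! ### Successive picks without replacement -/

section Picks

variable {a : ℝ} {S : Facets}

theorem tsum_pickWeight (ha : 0 ≤ a) {A : Finset ℕ} (hA : A ⊆ vertices S) :
    ∑' v, pickWeight a S A v = ENNReal.ofReal (totalWt a S - ∑ v ∈ A, wt a S v) := by
  rw [tsum_eq_sum (s := vertices S \ A) (fun v hv => pickWeight_eq_zero hv), ← sum_sdiff_wt hA,
    ENNReal.ofReal_sum_of_nonneg fun v _ => wt_nonneg ha v]
  refine Finset.sum_congr rfl fun v hv => ?_
  rw [pickWeight, if_pos hv, wt_of_mem (Finset.mem_sdiff.1 hv).1]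

theorem card_sub_le (ha : 0 ≤ a) {A : Finset ℕ} (hA : A ⊆ vertices S) :
    ((vertices S).card : ℝ) - A.card ≤ totalWt a S - ∑ v ∈ A, wt a S v := by
  rw [← sum_sdiff_wt hA, ← Nat.cast_sub (Finset.card_le_card hA), ← Finset.card_sdiff_of_subset hA]
  exact card_le_sum_wt ha Finset.sdiff_subset

theorem totalWt_sub_pos (ha : 0 ≤ a) {A : Finset ℕ} (hA : A ⊆ vertices S)
    (hc : A.card < (vertices S).card) : 0 < totalWt a S - ∑ v ∈ A, wt a S v := by
  refine lt_of_lt_of_le ?_ (card_sub_le ha hA)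
  rw [sub_pos]
  exact_mod_cast hc

theorem pick_eq (ha : 0 ≤ a) {A : Finset ℕ} (hA : A ⊆ vertices S)
    (hc : A.card < (vertices S).card) :
    ∃ h : (∑' v, pickWeight a S A v) ≠ 0, pick a S A =
      (PMF.normalize (pickWeight a S A) h (tsum_pickWeight_ne_top a S A)).map
        fun v => insert v A := by
  have h : (∑' v, pickWeight a S A v) ≠ 0 := by
    rw [tsum_pickWeight ha hA]
    simpa using totalWt_sub_pos ha hA hc
  exact ⟨h, dif_neg h⟩

theorem ex_pick (ha : 0 ≤ a) {A : Finset ℕ} (hA : A ⊆ vertices S)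
    (hc : A.card < (vertices S).card) (f : Finset ℕ → ℝ) :
    ex (pick a S A) f = ∑ v ∈ vertices S \ A,
      wt a S v / (totalWt a S - ∑ v ∈ A, wt a S v) * f (insert v A) := by
  obtain ⟨h, hp⟩ := pick_eq ha hA hc
  have hsup : (PMF.normalize (pickWeight a S A) h (tsum_pickWeight_ne_top a S A)).support ⊆
      (vertices S \ A : Finset ℕ) := by
    intro v hv
    rw [PMF.mem_support_normalize_iff] at hv
    by_contra h'
    exact hv (pickWeight_eq_zero h')
  rw [hp, ex_map (Set.Finite.subset (Finset.finite_toSet _) hsup), ex_eq_sum hsup]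
  refine Finset.sum_congr rfl fun v hv => ?_
  rw [PMF.normalize_apply, tsum_pickWeight ha hA, pickWeight, if_pos hv,
    ← wt_of_mem (Finset.mem_sdiff.1 hv).1, ENNReal.toReal_mul, ENNReal.toReal_inv,
    ENNReal.toReal_ofReal (wt_nonneg ha v),
    ENNReal.toReal_ofReal (totalWt_sub_pos ha hA hc).le, div_eq_mul_inv]

theorem mem_support_pick (ha : 0 ≤ a) {A B : Finset ℕ} (hA : A ⊆ vertices S)
    (hc : A.card < (vertices S).card) (hB : B ∈ (pick a S A).support) :
    ∃ v ∈ vertices S \ A, B = insert v A := by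
  obtain ⟨h, hp⟩ := pick_eq ha hA hc
  rw [hp, PMF.support_map] at hB
  obtain ⟨v, hv, rfl⟩ := hB
  rw [PMF.mem_support_normalize_iff] at hv
  refine ⟨v, ?_, rfl⟩
  by_contra h'
  exact hv (pickWeight_eq_zero h')

theorem mem_support_picks (ha : 0 ≤ a) {m : ℕ} (hm : m ≤ (vertices S).card) {A : Finset ℕ}
    (hA : A ∈ (picks a S m).support) : A ⊆ vertices S ∧ A.card = m := by
  induction m generalizing A with
  | zero =>
    simp only [picks, PMF.support_pure, Set.mem_singleton_iff] at hA
    simp [hA]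
  | succ m ih =>
    simp only [picks, PMF.support_bind, Set.mem_iUnion] at hA
    obtain ⟨B, hB, hAB⟩ := hA
    obtain ⟨h1, h2⟩ := ih (by omega) hB
    obtain ⟨v, hv, rfl⟩ := mem_support_pick ha h1 (by omega) hAB
    rw [Finset.mem_sdiff] at hv
    exact ⟨Finset.insert_subset hv.1 h1, by rw [Finset.card_insert_of_notMem hv.2, h2]⟩

theorem ex_picks_zero (f : Finset ℕ → ℝ) : ex (picks a S 0) f = f ∅ := ex_pure _ _

theorem ex_picks_succ (ha : 0 ≤ a) {m : ℕ} (hm : m < (vertices S).card) (f : Finset ℕ → ℝ) :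
    ex (picks a S (m + 1)) f = ex (picks a S m) fun A => ∑ v ∈ vertices S \ A,
      wt a S v / (totalWt a S - ∑ v ∈ A, wt a S v) * f (insert v A) := by
  rw [picks, ex_bind (finite_support_picks S m) fun A _ => finite_support_pick S A]
  refine ex_congr fun A hA => ?_
  obtain ⟨h1, h2⟩ := mem_support_picks ha hm.le hA
  exact ex_pick ha h1 (by omega) f

theorem ex_picks_mono (ha : 0 ≤ a) {m : ℕ} (hm : m ≤ (vertices S).card) {f g : Finset ℕ → ℝ}
    (h : ∀ A ⊆ vertices S, A.card = m → f A ≤ g A) :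
    ex (picks a S m) f ≤ ex (picks a S m) g :=
  ex_mono (finite_support_picks S m) fun A hA =>
    h A (mem_support_picks ha hm hA).1 (mem_support_picks ha hm hA).2

theorem sum_pick_prob (ha : 0 ≤ a) {A : Finset ℕ} (hA : A ⊆ vertices S)
    (hc : A.card < (vertices S).card) :
    ∑ v ∈ vertices S \ A, wt a S v / (totalWt a S - ∑ v ∈ A, wt a S v) = 1 := by
  rw [← Finset.sum_div, sum_sdiff_wt hA, div_self (totalWt_sub_pos ha hA hc).ne']

end Picks

/-! ### Moments of picks when the weights are spread out -/

/-- The weights are spread out: after any `M` picks a fraction `1 / κ` of the total weight is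
left. -/
structure Spread (a : ℝ) (M : ℕ) (κ : ℝ) (S : Facets) : Prop where
  nonneg : 0 ≤ a
  card_lt : M < (vertices S).card
  le : totalWt a S ≤ κ * ((vertices S).card - M)

namespace Spread

variable {a κ : ℝ} {M : ℕ} {S : Facets}

theorem totalWt_pos (h : Spread a M κ S) : 0 < totalWt a S := by
  have h1 : ((vertices S).card : ℝ) ≤ totalWt a S := card_le_sum_wt h.nonneg subset_rfl
  have h2 : (0 : ℝ) < (vertices S).card := by exact_mod_cast (Nat.zero_le M).trans_lt h.card_lt
  linarith

theorem one_le (h : Spread a M κ S) : 1 ≤ κ := by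
  have h1 : ((vertices S).card : ℝ) ≤ totalWt a S := card_le_sum_wt h.nonneg subset_rfl
  have h2 : (M : ℝ) < (vertices S).card := by exact_mod_cast h.card_lt
  have h3 := h.le
  by_contra hcon
  push Not at hcon
  have : κ * ((vertices S).card - M) < 1 * ((vertices S).card - M) :=
    mul_lt_mul_of_pos_right hcon (by linarith)
  linarith [M.cast_nonneg (α := ℝ)]

theorem sub_pos (h : Spread a M κ S) {A : Finset ℕ} (hA : A ⊆ vertices S) (hc : A.card ≤ M) :
    0 < totalWt a S - ∑ v ∈ A, wt a S v :=
  totalWt_sub_pos h.nonneg hA (hc.trans_lt h.card_lt)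

/-- Every vertex has weight at least one, so after at most `M` picks the remaining weight is at
least the number of vertices minus `M`. -/
theorem inv_le (h : Spread a M κ S) {A : Finset ℕ} (hA : A ⊆ vertices S) (hc : A.card ≤ M) :
    1 / (totalWt a S - ∑ v ∈ A, wt a S v) ≤ κ / totalWt a S := by
  rw [div_le_div_iff₀ (h.sub_pos hA hc) h.totalWt_pos, one_mul]
  refine h.le.trans (mul_le_mul_of_nonneg_left ?_ (zero_le_one.trans h.one_le))
  have h1 := card_sub_le h.nonneg hA
  have h2 : (A.card : ℝ) ≤ M := by exact_mod_cast hc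
  linarith

theorem div_le (h : Spread a M κ S) {A : Finset ℕ} (hA : A ⊆ vertices S) (hc : A.card ≤ M)
    {x : ℝ} (hx : 0 ≤ x) :
    x / (totalWt a S - ∑ v ∈ A, wt a S v) ≤ κ * (x / totalWt a S) := by
  have := mul_le_mul_of_nonneg_left (h.inv_le hA hc) hx
  calc _ = x * (1 / (totalWt a S - ∑ v ∈ A, wt a S v)) := by ring
    _ ≤ _ := this
    _ = _ := by ring

/-- A pick hits `v` with probability at most `κ` times the probability for the first pick. -/
theorem sum_pick_le (h : Spread a M κ S) {A : Finset ℕ} (hA : A ⊆ vertices S) (hc : A.card ≤ M)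
    {g : ℕ → ℝ} (hg : ∀ v, 0 ≤ g v) :
    ∑ v ∈ vertices S \ A, wt a S v / (totalWt a S - ∑ v ∈ A, wt a S v) * g v ≤
      κ * ∑ v ∈ vertices S, pr a S v * g v := by
  rw [Finset.mul_sum]
  refine (Finset.sum_le_sum fun v _ => ?_).trans (Finset.sum_le_sum_of_subset_of_nonneg
    Finset.sdiff_subset fun v _ _ => mul_nonneg (zero_le_one.trans h.one_le)
      (mul_nonneg (pr_nonneg h.nonneg v) (hg v)))
  rw [← mul_assoc]
  exact mul_le_mul_of_nonneg_right (h.div_le hA hc (wt_nonneg h.nonneg v)) (hg v)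

theorem ex_picks_sum_le (h : Spread a M κ S) {m : ℕ} (hm : m ≤ M) {g : ℕ → ℝ}
    (hg : ∀ v, 0 ≤ g v) :
    ex (picks a S m) (fun A => ∑ v ∈ A, g v) ≤ m * κ * ∑ v ∈ vertices S, pr a S v * g v := by
  have hV := h.card_lt
  induction m with
  | zero => simp [ex_picks_zero]
  | succ m ih =>
    rw [ex_picks_succ h.nonneg (by omega)]
    have h1 : ∀ A ⊆ vertices S, A.card = m → ∑ v ∈ vertices S \ A,
        wt a S v / (totalWt a S - ∑ v ∈ A, wt a S v) * ∑ x ∈ insert v A, g x ≤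
          κ * (∑ v ∈ vertices S, pr a S v * g v) + ∑ v ∈ A, g v := by
      intro A hA hAm
      have e : ∀ v ∈ vertices S \ A, wt a S v / (totalWt a S - ∑ v ∈ A, wt a S v) *
          ∑ x ∈ insert v A, g x = wt a S v / (totalWt a S - ∑ v ∈ A, wt a S v) * g v +
            wt a S v / (totalWt a S - ∑ v ∈ A, wt a S v) * ∑ x ∈ A, g x := by
        intro v hv
        rw [Finset.sum_insert (Finset.mem_sdiff.1 hv).2, mul_add]
      rw [Finset.sum_congr rfl e, Finset.sum_add_distrib, ← Finset.sum_mul,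
        sum_pick_prob h.nonneg hA (by omega), one_mul]
      linarith [h.sum_pick_le hA (by omega) hg]
    refine (ex_picks_mono h.nonneg (by omega) h1).trans ?_
    rw [ex_add (finite_support_picks S m), ex_const (finite_support_picks S m)]
    push_cast
    linarith [ih (by omega)]

/-- A further pick creates pairs only with earlier picks, and the linear bound applies both to it
and to them; the increments `2 * m` add up to at most `m ^ 2`. -/
theorem ex_picks_pairs_le (h : Spread a M κ S) {m : ℕ} (hm : m ≤ M) {r : ℕ → ℕ → ℝ}
    (hr : ∀ u v, 0 ≤ r u v) (hr0 : ∀ v, r v v = 0) :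
    ex (picks a S m) (fun A => ∑ u ∈ A, ∑ v ∈ A, r u v) ≤
      (m * κ) ^ 2 * ∑ u ∈ vertices S, ∑ v ∈ vertices S, pr a S u * pr a S v * r u v := by
  have hV := h.card_lt
  have hκ := h.one_le
  set Q := ∑ u ∈ vertices S, ∑ v ∈ vertices S, pr a S u * pr a S v * r u v with hQ
  have hQ0 : 0 ≤ Q := Finset.sum_nonneg fun u _ => Finset.sum_nonneg fun v _ =>
    mul_nonneg (mul_nonneg (pr_nonneg h.nonneg u) (pr_nonneg h.nonneg v)) (hr u v)
  induction m with
  | zero => simp [ex_picks_zero]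
  | succ m ih =>
    rw [ex_picks_succ h.nonneg (by omega)]
    set g : ℕ → ℝ := fun u => ∑ v ∈ vertices S, pr a S v * (r u v + r v u) with hg
    have hg0 : ∀ u, 0 ≤ g u := fun u => Finset.sum_nonneg fun v _ =>
      mul_nonneg (pr_nonneg h.nonneg v) (add_nonneg (hr u v) (hr v u))
    have h1 : ∀ A ⊆ vertices S, A.card = m → ∑ v ∈ vertices S \ A,
        wt a S v / (totalWt a S - ∑ v ∈ A, wt a S v) * ∑ x ∈ insert v A, ∑ y ∈ insert v A, r x y ≤
          κ * (∑ u ∈ A, g u) + ∑ x ∈ A, ∑ y ∈ A, r x y := by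
      intro A hA hAm
      have e : ∀ v ∈ vertices S \ A, wt a S v / (totalWt a S - ∑ v ∈ A, wt a S v) *
          ∑ x ∈ insert v A, ∑ y ∈ insert v A, r x y =
            wt a S v / (totalWt a S - ∑ v ∈ A, wt a S v) * (∑ u ∈ A, (r u v + r v u)) +
            wt a S v / (totalWt a S - ∑ v ∈ A, wt a S v) * ∑ x ∈ A, ∑ y ∈ A, r x y := by
        intro v hv
        have hv' := (Finset.mem_sdiff.1 hv).2
        rw [Finset.sum_insert hv', Finset.sum_insert hv', hr0, Finset.sum_congr rfl fun x _ =>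
          Finset.sum_insert (f := fun y => r x y) hv', Finset.sum_add_distrib,
          Finset.sum_add_distrib]
        ring
      rw [Finset.sum_congr rfl e, Finset.sum_add_distrib, ← Finset.sum_mul,
        sum_pick_prob h.nonneg hA (by omega), one_mul]
      refine add_le_add_left ((h.sum_pick_le hA (by omega) fun v =>
        Finset.sum_nonneg fun u _ => add_nonneg (hr u v) (hr v u)).trans_eq ?_) _
      congr 1
      simp only [hg, Finset.mul_sum]
      exact Finset.sum_comm
    refine (ex_picks_mono h.nonneg (by omega) h1).trans ?_
    rw [ex_add (finite_support_picks S m), ex_mul_left]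
    have h2 := h.ex_picks_sum_le (show m ≤ M by omega) hg0
    have h3 : ∑ u ∈ vertices S, pr a S u * g u = 2 * Q := by
      have e1 : ∀ u ∈ vertices S, pr a S u * g u =
          ∑ v ∈ vertices S, pr a S u * pr a S v * r u v +
          ∑ v ∈ vertices S, pr a S v * pr a S u * r v u := by
        intro u _
        rw [hg, Finset.mul_sum, ← Finset.sum_add_distrib]
        exact Finset.sum_congr rfl fun v _ => by ring
      rw [Finset.sum_congr rfl e1, Finset.sum_add_distrib, two_mul]
      congr 1
      rw [Finset.sum_comm]
    rw [h3] at h2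
    have h4 := mul_le_mul_of_nonneg_left h2 (zero_le_one.trans hκ)
    have h5 := ih (by omega)
    have h6 : 0 ≤ κ ^ 2 * Q := by positivity
    push_cast
    nlinarith

/-- Removing picked vertices increases the chances of all others, so the only loss against
independent picks is the mass of the removed vertices, which is a collision term. -/
theorem le_ex_picks_sum (h : Spread a M κ S) {m : ℕ} (hm : m ≤ M) {g : ℕ → ℝ}
    (hg : ∀ v, 0 ≤ g v) :
    m * ∑ v ∈ vertices S, pr a S v * g v - m ^ 2 * κ * ∑ v ∈ vertices S, pr a S v ^ 2 * g v ≤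
      ex (picks a S m) (fun A => ∑ v ∈ A, g v) := by
  have hV := h.card_lt
  have hκ := h.one_le
  have ha := h.nonneg
  have hQ0 : 0 ≤ ∑ v ∈ vertices S, pr a S v ^ 2 * g v :=
    Finset.sum_nonneg fun v _ => mul_nonneg (sq_nonneg _) (hg v)
  induction m with
  | zero => simp [ex_picks_zero]
  | succ m ih =>
    rw [ex_picks_succ h.nonneg (by omega)]
    have h1 : ∀ A ⊆ vertices S, A.card = m →
        (∑ v ∈ vertices S, pr a S v * g v - ∑ v ∈ A, pr a S v * g v) + ∑ v ∈ A, g v ≤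
        ∑ v ∈ vertices S \ A,
        wt a S v / (totalWt a S - ∑ v ∈ A, wt a S v) * ∑ x ∈ insert v A, g x := by
      intro A hA hAm
      have e : ∀ v ∈ vertices S \ A, wt a S v / (totalWt a S - ∑ v ∈ A, wt a S v) *
          ∑ x ∈ insert v A, g x = wt a S v / (totalWt a S - ∑ v ∈ A, wt a S v) * g v +
            wt a S v / (totalWt a S - ∑ v ∈ A, wt a S v) * ∑ x ∈ A, g x := by
        intro v hv
        rw [Finset.sum_insert (Finset.mem_sdiff.1 hv).2, mul_add]
      rw [Finset.sum_congr rfl e, Finset.sum_add_distrib, ← Finset.sum_mul,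
        sum_pick_prob h.nonneg hA (by omega), one_mul]
      refine add_le_add_left ?_ _
      rw [← Finset.sum_sdiff hA, add_sub_cancel_right]
      refine Finset.sum_le_sum fun v _ => mul_le_mul_of_nonneg_right ?_ (hg v)
      refine div_le_div_of_nonneg_left (wt_nonneg ha v) (h.sub_pos hA (by omega)) ?_
      linarith [Finset.sum_nonneg fun v (_ : v ∈ A) => wt_nonneg (S := S) ha v]
    refine le_trans ?_ (ex_picks_mono h.nonneg (by omega) h1)
    rw [ex_add (finite_support_picks S m), ex_sub (finite_support_picks S m),
      ex_const (finite_support_picks S m)]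
    have h2 := h.ex_picks_sum_le (show m ≤ M by omega) (g := fun v => pr a S v * g v)
      fun v => mul_nonneg (pr_nonneg ha v) (hg v)
    have h3 : ∑ v ∈ vertices S, pr a S v * (pr a S v * g v) =
        ∑ v ∈ vertices S, pr a S v ^ 2 * g v := Finset.sum_congr rfl fun v _ => by ring
    rw [h3] at h2
    have h5 := ih (by omega)
    have h6 : 0 ≤ κ * ∑ v ∈ vertices S, pr a S v ^ 2 * g v := by positivity
    push_cast
    nlinarith [m.cast_nonneg (α := ℝ)]

/-- Unlike `ex_picks_sum_le`, the leading term has constant one: renormalization after picking `A`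
costs a factor at most `1 + κ * ∑ v ∈ A, pr a S v`, and the expected excess is a collision
probability. -/
theorem ex_picks_sum_le' (h : Spread a M κ S) {m : ℕ} (hm : m ≤ M) {g : ℕ → ℝ}
    (hg : ∀ v, 0 ≤ g v) (hg1 : ∀ v, g v ≤ 1) :
    ex (picks a S m) (fun A => ∑ v ∈ A, g v) ≤
      m * ∑ v ∈ vertices S, pr a S v * g v + m ^ 2 * κ ^ 2 * ∑ v ∈ vertices S, pr a S v ^ 2 := by
  have hV := h.card_lt
  have hκ := h.one_le
  have ha := h.nonneg
  have hT := h.totalWt_pos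
  have hQ0 : 0 ≤ ∑ v ∈ vertices S, pr a S v ^ 2 :=
    Finset.sum_nonneg fun v _ => sq_nonneg _
  have hP0 : 0 ≤ ∑ v ∈ vertices S, pr a S v * g v :=
    Finset.sum_nonneg fun v _ => mul_nonneg (pr_nonneg ha v) (hg v)
  have hP1 : ∑ v ∈ vertices S, pr a S v * g v ≤ 1 := by
    rw [← sum_pr hT.ne']
    exact Finset.sum_le_sum fun v _ => mul_le_of_le_one_right (pr_nonneg ha v) (hg1 v)
  induction m with
  | zero => simp [ex_picks_zero]
  | succ m ih =>
    rw [ex_picks_succ h.nonneg (by omega)]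
    have h1 : ∀ A ⊆ vertices S, A.card = m → ∑ v ∈ vertices S \ A,
        wt a S v / (totalWt a S - ∑ v ∈ A, wt a S v) * ∑ x ∈ insert v A, g x ≤
        (∑ v ∈ vertices S, pr a S v * g v + κ * ∑ v ∈ A, pr a S v) + ∑ v ∈ A, g v := by
      intro A hA hAm
      have e : ∀ v ∈ vertices S \ A, wt a S v / (totalWt a S - ∑ v ∈ A, wt a S v) *
          ∑ x ∈ insert v A, g x = wt a S v / (totalWt a S - ∑ v ∈ A, wt a S v) * g v +
            wt a S v / (totalWt a S - ∑ v ∈ A, wt a S v) * ∑ x ∈ A, g x := by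
        intro v hv
        rw [Finset.sum_insert (Finset.mem_sdiff.1 hv).2, mul_add]
      rw [Finset.sum_congr rfl e, Finset.sum_add_distrib, ← Finset.sum_mul,
        sum_pick_prob h.nonneg hA (by omega), one_mul]
      refine add_le_add_left ?_ _
      have hA0 : 0 ≤ ∑ v ∈ A, wt a S v := Finset.sum_nonneg fun v _ => wt_nonneg ha v
      have hp := h.sub_pos hA (show A.card ≤ M by omega)
      have h7 : ∑ v ∈ vertices S \ A, wt a S v / (totalWt a S - ∑ v ∈ A, wt a S v) * g v ≤
          ∑ v ∈ vertices S, wt a S v / (totalWt a S - ∑ v ∈ A, wt a S v) * g v :=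
        Finset.sum_le_sum_of_subset_of_nonneg Finset.sdiff_subset fun v _ _ =>
          mul_nonneg (div_nonneg (wt_nonneg ha v) hp.le) (hg v)
      have h8 : ∑ v ∈ vertices S, wt a S v / (totalWt a S - ∑ v ∈ A, wt a S v) * g v =
          (∑ v ∈ vertices S, pr a S v * g v) *
            (1 + (∑ v ∈ A, wt a S v) / (totalWt a S - ∑ v ∈ A, wt a S v)) := by
        rw [Finset.sum_mul]
        refine Finset.sum_congr rfl fun v _ => ?_
        unfold pr
        field_simp
        ring
      have h9 := h.div_le hA (show A.card ≤ M by omega) hA0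
      have h10 : (∑ v ∈ A, wt a S v) / totalWt a S = ∑ v ∈ A, pr a S v := by
        unfold pr
        rw [Finset.sum_div]
      rw [h10] at h9
      have h11 : 0 ≤ (∑ v ∈ A, wt a S v) / (totalWt a S - ∑ v ∈ A, wt a S v) :=
        div_nonneg hA0 hp.le
      rw [h8] at h7
      nlinarith
    refine (ex_picks_mono h.nonneg (by omega) h1).trans ?_
    rw [ex_add (finite_support_picks S m), ex_add (finite_support_picks S m),
      ex_const (finite_support_picks S m), ex_mul_left]
    have h2 := h.ex_picks_sum_le (show m ≤ M by omega) (pr_nonneg (S := S) ha)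
    have h3 : ∑ v ∈ vertices S, pr a S v * pr a S v =
        ∑ v ∈ vertices S, pr a S v ^ 2 := Finset.sum_congr rfl fun v _ => by ring
    rw [h3] at h2
    have h4 := mul_le_mul_of_nonneg_left h2 (zero_le_one.trans hκ)
    have h5 := ih (by omega)
    have h6 : 0 ≤ κ ^ 2 * ∑ v ∈ vertices S, pr a S v ^ 2 := by positivity
    push_cast
    nlinarith [m.cast_nonneg (α := ℝ)]

/-- For balanced `f`, the next pick has conditional mean `-(∑ v ∈ A, wt a S v * f v)` divided by the
remaining weight: only the already picked vertices unbalance it. A one-sided bound on `f` is enough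
for the lower bound. -/
theorem le_ex_picks_sum_of_balanced (h : Spread a M κ S) {m : ℕ} (hm : m ≤ M) {f n : ℕ → ℝ}
    (hn : ∀ v, 0 ≤ n v) (hfn : ∀ v, f v ≤ n v) (h0 : ∑ v ∈ vertices S, wt a S v * f v = 0) :
    -(m ^ 2 * κ ^ 2 * ∑ v ∈ vertices S, pr a S v ^ 2 * n v) ≤
      ex (picks a S m) (fun A => ∑ v ∈ A, f v) := by
  have hV := h.card_lt
  have hκ := h.one_le
  have ha := h.nonneg
  have hT := h.totalWt_pos
  have hQ0 : 0 ≤ ∑ v ∈ vertices S, pr a S v ^ 2 * n v :=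
    Finset.sum_nonneg fun v _ => mul_nonneg (sq_nonneg _) (hn v)
  induction m with
  | zero => simp [ex_picks_zero]
  | succ m ih =>
    rw [ex_picks_succ h.nonneg (by omega)]
    have h1 : ∀ A ⊆ vertices S, A.card = m → -(κ * ∑ v ∈ A, pr a S v * n v) + ∑ v ∈ A, f v ≤
        ∑ v ∈ vertices S \ A,
        wt a S v / (totalWt a S - ∑ v ∈ A, wt a S v) * ∑ x ∈ insert v A, f x := by
      intro A hA hAm
      have e : ∀ v ∈ vertices S \ A, wt a S v / (totalWt a S - ∑ v ∈ A, wt a S v) *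
          ∑ x ∈ insert v A, f x = wt a S v * f v / (totalWt a S - ∑ v ∈ A, wt a S v) +
            wt a S v / (totalWt a S - ∑ v ∈ A, wt a S v) * ∑ x ∈ A, f x := by
        intro v hv
        rw [Finset.sum_insert (Finset.mem_sdiff.1 hv).2]
        ring
      rw [Finset.sum_congr rfl e, Finset.sum_add_distrib, ← Finset.sum_mul,
        sum_pick_prob h.nonneg hA (by omega), one_mul]
      refine add_le_add_left ?_ _
      have hp := h.sub_pos hA (show A.card ≤ M by omega)
      have h7 : ∑ v ∈ vertices S \ A, wt a S v * f v = -∑ v ∈ A, wt a S v * f v := by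
        rw [← Finset.sum_sdiff hA] at h0
        linarith
      rw [← Finset.sum_div, h7, neg_div, neg_le_neg_iff]
      have h8 : ∑ v ∈ A, wt a S v * f v ≤ ∑ v ∈ A, wt a S v * n v :=
        Finset.sum_le_sum fun v _ => mul_le_mul_of_nonneg_left (hfn v) (wt_nonneg ha v)
      refine (div_le_div_of_nonneg_right h8 hp.le).trans ?_
      refine (h.div_le hA (show A.card ≤ M by omega) (Finset.sum_nonneg fun v _ =>
        mul_nonneg (wt_nonneg ha v) (hn v))).trans_eq ?_
      unfold pr
      rw [Finset.sum_div]
      congr 1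
      exact Finset.sum_congr rfl fun v _ => by ring
    refine le_trans ?_ (ex_picks_mono h.nonneg (by omega) h1)
    rw [ex_add (finite_support_picks S m), ex_neg, ex_mul_left]
    have h2 := h.ex_picks_sum_le (show m ≤ M by omega) (g := fun v => pr a S v * n v)
      fun v => mul_nonneg (pr_nonneg ha v) (hn v)
    have h3 : ∑ v ∈ vertices S, pr a S v * (pr a S v * n v) =
        ∑ v ∈ vertices S, pr a S v ^ 2 * n v := Finset.sum_congr rfl fun v _ => by ring
    rw [h3] at h2
    have h4 := mul_le_mul_of_nonneg_left h2 (zero_le_one.trans hκ)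
    have h5 := ih (by omega)
    have h6 : 0 ≤ κ ^ 2 * ∑ v ∈ vertices S, pr a S v ^ 2 * n v := by positivity
    push_cast
    nlinarith [m.cast_nonneg (α := ℝ)]

end Spread

end GeneSCs

namespace GeneSCs

section

variable {a κ : ℝ} {M : ℕ} {S : Facets}

/-- If exactly one pick falls outside `H`, its position there is nearly distributed according to
weight, so a balanced `f` that vanishes on `H` has mean nearly zero. The induction needs the general
factor `G`: the conditional probabilities of later picks in `H` depend on `A ∩ H` and are absorbed
into a new such factor. -/
theorem Spread.abs_ex_picks_single_le (h : Spread a M κ S) {m : ℕ} (hm : m ≤ M) {H : Finset ℕ}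
    {f : ℕ → ℝ} (hfH : ∀ v ∈ H, f v = 0) (hf1 : ∀ v, |f v| ≤ 1)
    (h0 : ∑ v ∈ vertices S, wt a S v * f v = 0) (G : Finset ℕ → ℝ)
    (hG : ∀ B ⊆ vertices S, |G B| ≤ 1) :
    |ex (picks a S m) fun A => (∑ v ∈ A, f v) * (if (A \ H).card = 1 then G (A ∩ H) else 0)| ≤
      m ^ 2 * κ ^ 2 * ∑ v ∈ vertices S, pr a S v ^ 2 * (if v ∈ H then 0 else 1) := by
  have hV := h.card_lt
  have hκ := h.one_le
  have ha := h.nonneg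
  have hT := h.totalWt_pos
  set n : ℕ → ℝ := fun v => if v ∈ H then 0 else 1 with hn
  have hn0 : ∀ v, 0 ≤ n v := fun v => by simp only [hn]; split_ifs <;> norm_num
  have hfn : ∀ v, |f v| ≤ n v := fun v => by
    by_cases hv : v ∈ H
    · simp [hn, hv, hfH v hv]
    · simpa [hn, hv] using hf1 v
  have hQ0 : 0 ≤ ∑ v ∈ vertices S, pr a S v ^ 2 * n v :=
    Finset.sum_nonneg fun v _ => mul_nonneg (sq_nonneg _) (hn0 v)
  have hfA : ∀ A : Finset ℕ, ∑ v ∈ A, f v = ∑ v ∈ A \ H, f v := fun A =>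
    (Finset.sum_subset Finset.sdiff_subset fun v hv hv' => hfH v (by
      by_contra hh
      exact hv' (Finset.mem_sdiff.2 ⟨hv, hh⟩))).symm
  induction m generalizing G with
  | zero => simp [ex_picks_zero]
  | succ m ih =>
    rw [ex_picks_succ ha (by omega)]
    -- The expected value of `G` after one more pick in `H`, with the remaining weight computed as
    -- if only `B ⊆ H` had been picked.
    set G' : Finset ℕ → ℝ := fun B => (∑ v ∈ (vertices S ∩ H) \ B, wt a S v * G (insert v B)) /
      (totalWt a S - ∑ v ∈ B, wt a S v) with hG'
    have hrem : ∀ B ⊆ vertices S, 0 ≤ totalWt a S - ∑ v ∈ B, wt a S v := fun B hB => by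
      rw [← sum_sdiff_wt hB]
      exact Finset.sum_nonneg fun v _ => wt_nonneg ha v
    have hnum : ∀ B ⊆ vertices S, |∑ v ∈ (vertices S ∩ H) \ B, wt a S v * G (insert v B)| ≤
        totalWt a S - ∑ v ∈ B, wt a S v := by
      intro B hB
      refine (Finset.abs_sum_le_sum_abs _ _).trans ?_
      rw [← sum_sdiff_wt hB]
      have hsub : (vertices S ∩ H) \ B ⊆ vertices S \ B :=
        Finset.sdiff_subset_sdiff Finset.inter_subset_left subset_rfl
      refine (Finset.sum_le_sum fun v hv => ?_).trans
        (Finset.sum_le_sum_of_subset_of_nonneg hsub fun v _ _ => wt_nonneg ha v)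
      rw [abs_mul, abs_of_nonneg (wt_nonneg ha v)]
      refine mul_le_of_le_one_right (wt_nonneg ha v) (hG _ ?_)
      exact Finset.insert_subset (Finset.mem_sdiff.1 (hsub hv)).1 hB
    have hG'1 : ∀ B ⊆ vertices S, |G' B| ≤ 1 := fun B hB => by
      rw [hG', abs_div, abs_of_nonneg (hrem B hB)]
      exact div_le_one_of_le₀ (hnum B hB) (hrem B hB)
    have key : ∀ A ⊆ vertices S, A.card = m →
        |(∑ v ∈ vertices S \ A, wt a S v / (totalWt a S - ∑ v ∈ A, wt a S v) *
          ((∑ x ∈ insert v A, f x) *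
            (if (insert v A \ H).card = 1 then G (insert v A ∩ H) else 0))) -
          (∑ v ∈ A, f v) * (if (A \ H).card = 1 then G' (A ∩ H) else 0)| ≤
        κ * ∑ v ∈ A, pr a S v * n v := by
      intro A hA hAm
      have hpos := h.sub_pos hA (show A.card ≤ M by omega)
      have hR0 : 0 ≤ κ * ∑ v ∈ A, pr a S v * n v :=
        mul_nonneg (by linarith) (Finset.sum_nonneg fun v _ =>
          mul_nonneg (pr_nonneg ha v) (hn0 v))
      have hins : ∀ v ∈ vertices S \ A, v ∉ H → (insert v A \ H).card = (A \ H).card + 1 ∧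
          insert v A ∩ H = A ∩ H := fun v hv hvH => by
        constructor
        · rw [Finset.insert_sdiff_of_notMem _ hvH, Finset.card_insert_of_notMem]
          exact fun hh => (Finset.mem_sdiff.1 hv).2 (Finset.mem_sdiff.1 hh).1
        · rw [Finset.insert_inter_of_notMem hvH]
      have hins' : ∀ v ∈ vertices S \ A, v ∈ H → (insert v A \ H).card = (A \ H).card ∧
          insert v A ∩ H = insert v (A ∩ H) := fun v hv hvH => by
        rw [Finset.insert_sdiff_of_mem _ hvH, Finset.insert_inter_of_mem hvH]
        exact ⟨rfl, rfl⟩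
      have hsum : ∀ v ∈ vertices S \ A, ∑ x ∈ insert v A, f x = f v + ∑ x ∈ A, f x :=
        fun v hv => Finset.sum_insert (Finset.mem_sdiff.1 hv).2
      -- With no pick outside `H`, the contribution of the next pick vanishes exactly by balance.
      -- With one, the next pick must lie in `H`, and replacing the denominator for `A` by that for
      -- `A ∩ H` costs the weight of the one vertex. With more, both terms vanish.
      rcases Nat.lt_trichotomy (A \ H).card 1 with hc | hc | hc
      · have hc0 : (A \ H).card = 0 := by omega
        have hAH : ∑ v ∈ A, f v = 0 := by
          rw [hfA, Finset.card_eq_zero.1 hc0, Finset.sum_empty]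
        have e1 : ∀ v ∈ vertices S \ A, wt a S v / (totalWt a S - ∑ v ∈ A, wt a S v) *
          ((∑ x ∈ insert v A, f x) *
            (if (insert v A \ H).card = 1 then G (insert v A ∩ H) else 0)) =
            wt a S v * f v * (G (A ∩ H) / (totalWt a S - ∑ v ∈ A, wt a S v)) := by
          intro v hv
          rw [hsum v hv, hAH, add_zero]
          by_cases hvH : v ∈ H
          · rw [hfH v hvH]
            ring
          · rw [(hins v hv hvH).1, (hins v hv hvH).2, hc0, if_pos rfl]
            ring
        have e2 : ∑ v ∈ vertices S \ A, wt a S v * f v = 0 := by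
          rw [← Finset.sum_sdiff hA] at h0
          have : ∑ v ∈ A, wt a S v * f v = 0 := Finset.sum_eq_zero fun v hv => by
            have : v ∈ H := by
              by_contra hh
              have := Finset.card_eq_zero.1 hc0
              exact Finset.notMem_empty v (this ▸ Finset.mem_sdiff.2 ⟨hv, hh⟩)
            rw [hfH v this, mul_zero]
          linarith
        rw [Finset.sum_congr rfl e1, ← Finset.sum_mul, e2, zero_mul, hAH, zero_mul, sub_zero,
          abs_zero]
        exact hR0
      · rw [if_pos hc]
        set B := A ∩ H with hB
        have hBV : B ⊆ vertices S := Finset.inter_subset_left.trans hA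
        have hAB : ∑ v ∈ A, wt a S v = ∑ v ∈ A \ H, wt a S v + ∑ v ∈ B, wt a S v := by
          rw [hB, add_comm, Finset.sum_inter_add_sum_sdiff]
        have hw0 : 0 ≤ ∑ v ∈ A \ H, wt a S v := Finset.sum_nonneg fun v _ => wt_nonneg ha v
        set X := ∑ v ∈ (vertices S ∩ H) \ B, wt a S v * G (insert v B) with hX
        have e1 : ∑ v ∈ vertices S \ A, wt a S v / (totalWt a S - ∑ v ∈ A, wt a S v) *
          ((∑ x ∈ insert v A, f x) *
            (if (insert v A \ H).card = 1 then G (insert v A ∩ H) else 0)) =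
            (∑ x ∈ A, f x) * (X / (totalWt a S - ∑ v ∈ A, wt a S v)) := by
          have hsub : (vertices S ∩ H) \ B ⊆ vertices S \ A := by
            intro v hv
            simp only [hB, Finset.mem_sdiff, Finset.mem_inter, not_and] at hv ⊢
            exact ⟨hv.1.1, fun hvA => hv.2 hvA hv.1.2⟩
          rw [hX, Finset.sum_div, Finset.mul_sum]
          refine (Finset.sum_subset_zero_on_sdiff hsub (fun v hv => ?_) fun v hv => ?_).symm
          · rw [Finset.mem_sdiff] at hv
            have hvH : v ∉ H := fun hvH => hv.2 (by
              simp only [hB, Finset.mem_sdiff, Finset.mem_inter, not_and]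
              exact ⟨⟨(Finset.mem_sdiff.1 hv.1).1, hvH⟩,
                fun hvA => absurd hvA (Finset.mem_sdiff.1 hv.1).2⟩)
            rw [(hins v hv.1 hvH).1, hc, if_neg (by omega)]
            ring
          · have hvH : v ∈ H := (Finset.mem_inter.1 (Finset.mem_sdiff.1 hv).1).2
            rw [(hins' v (hsub hv) hvH).1, (hins' v (hsub hv) hvH).2, if_pos hc, hsum v (hsub hv),
              hfH v hvH]
            ring
        have hposB : 0 < totalWt a S - ∑ v ∈ B, wt a S v := by linarith
        have hsingle : |∑ x ∈ A, f x| ≤ 1 := by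
          obtain ⟨v, hv⟩ := Finset.card_eq_one.1 hc
          rw [hfA, hv, Finset.sum_singleton]
          exact hf1 v
        have hXb := hnum B hBV
        rw [e1, hG', ← mul_sub, abs_mul]
        have e3 : X / (totalWt a S - ∑ v ∈ A, wt a S v) - X / (totalWt a S - ∑ v ∈ B, wt a S v) =
            X / (totalWt a S - ∑ v ∈ B, wt a S v) *
              ((∑ v ∈ A \ H, wt a S v) / (totalWt a S - ∑ v ∈ A, wt a S v)) := by
          field_simp
          rw [hAB]
          ring
        have e4 : |X / (totalWt a S - ∑ v ∈ A, wt a S v) -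
            X / (totalWt a S - ∑ v ∈ B, wt a S v)| ≤ κ * ∑ v ∈ A, pr a S v * n v := by
          rw [e3, abs_mul]
          have h1 : |X / (totalWt a S - ∑ v ∈ B, wt a S v)| ≤ 1 := by
            rw [abs_div, abs_of_pos hposB]
            exact div_le_one_of_le₀ hXb hposB.le
          have h2 : |(∑ v ∈ A \ H, wt a S v) / (totalWt a S - ∑ v ∈ A, wt a S v)| ≤
              κ * ∑ v ∈ A, pr a S v * n v := by
            rw [abs_of_nonneg (div_nonneg hw0 hpos.le)]
            refine (h.div_le hA (by omega) hw0).trans_eq ?_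
            congr 1
            rw [Finset.sum_div]
            refine Finset.sum_subset_zero_on_sdiff Finset.sdiff_subset (fun v hv => ?_)
              fun v hv => ?_
            · have : v ∈ H := by
                by_contra hh
                exact (Finset.mem_sdiff.1 hv).2 (Finset.mem_sdiff.2 ⟨(Finset.mem_sdiff.1 hv).1, hh⟩)
              simp [hn, this]
            · simp [hn, (Finset.mem_sdiff.1 hv).2, pr]
          calc _ ≤ 1 * _ := mul_le_mul_of_nonneg_right h1 (abs_nonneg _)
            _ ≤ _ := by rw [one_mul]; exact h2
        calc _ ≤ 1 * _ := mul_le_mul_of_nonneg_right hsingle (abs_nonneg _)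
          _ ≤ _ := by rw [one_mul]; exact e4
      · rw [if_neg (by omega), mul_zero, sub_zero, Finset.sum_eq_zero fun v hv => ?_, abs_zero]
        · exact hR0
        · rw [if_neg, mul_zero, mul_zero]
          by_cases hvH : v ∈ H
          · rw [(hins' v hv hvH).1]
            omega
          · rw [(hins v hv hvH).1]
            omega
    have hfin := finite_support_picks (a := a) S m
    have h1 := ih (by omega) G' hG'1
    have h2 := h.ex_picks_sum_le (show m ≤ M by omega) (g := fun v => pr a S v * n v)
      fun v => mul_nonneg (pr_nonneg ha v) (hn0 v)
    have h3 : ∑ v ∈ vertices S, pr a S v * (pr a S v * n v) =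
        ∑ v ∈ vertices S, pr a S v ^ 2 * n v := Finset.sum_congr rfl fun v _ => by ring
    rw [h3] at h2
    have h4 := mul_le_mul_of_nonneg_left h2 (zero_le_one.trans hκ)
    have h5 := (abs_ex_le hfin _).trans (ex_picks_mono ha (by omega) key)
    rw [ex_sub hfin, ex_mul_left] at h5
    have h6 : 0 ≤ κ ^ 2 * ∑ v ∈ vertices S, pr a S v ^ 2 * n v := by positivity
    have h7 := abs_sub_abs_le_abs_sub (ex (picks a S m) fun A =>
      ∑ v ∈ vertices S \ A, wt a S v / (totalWt a S - ∑ v ∈ A, wt a S v) *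
          ((∑ x ∈ insert v A, f x) *
            (if (insert v A \ H).card = 1 then G (insert v A ∩ H) else 0)))
      (ex (picks a S m) fun A => (∑ v ∈ A, f v) * (if (A \ H).card = 1 then G' (A ∩ H) else 0))
    push_cast
    nlinarith [m.cast_nonneg (α := ℝ)]

theorem ex_picks_le_succ (ha : 0 ≤ a) {m : ℕ} (hm : m < (vertices S).card) {f : Finset ℕ → ℝ}
    (hf : ∀ A v, f A ≤ f (insert v A)) :
    ex (picks a S m) f ≤ ex (picks a S (m + 1)) f := by
  rw [ex_picks_succ ha hm]
  refine ex_picks_mono ha hm.le fun A hA hAm => ?_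
  calc f A = ∑ v ∈ vertices S \ A, wt a S v / (totalWt a S - ∑ v ∈ A, wt a S v) * f A := by
        rw [← Finset.sum_mul, sum_pick_prob ha hA (by omega), one_mul]
    _ ≤ _ := Finset.sum_le_sum fun v _ => mul_le_mul_of_nonneg_left (hf A v)
        (div_nonneg (wt_nonneg ha v) (totalWt_sub_pos ha hA (by omega)).le)

/-- A lower bound for the probability that two of the picks are not related by `R`. -/
theorem le_ex_picks_not_rel (ha : 0 ≤ a) {m : ℕ} (hm2 : 2 ≤ m) (hm : m ≤ (vertices S).card)
    {R : ℕ → ℕ → Prop} [DecidableRel R] (hR : ∀ v, R v v) :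
    (((vertices S ×ˢ vertices S).filter fun p => ¬ R p.1 p.2).card : ℝ) / totalWt a S ^ 2 ≤
      ex (picks a S m) fun A => if ∃ u ∈ A, ∃ v ∈ A, ¬ R u v then 1 else 0 := by
  classical
  set f : Finset ℕ → ℝ := fun A => if ∃ u ∈ A, ∃ v ∈ A, ¬ R u v then 1 else 0 with hf
  have hfm : ∀ A v, f A ≤ f (insert v A) := by
    intro A v
    simp only [hf]
    split_ifs with h1 h2
    · exact le_rfl
    · obtain ⟨x, hx, y, hy, hxy⟩ := h1
      exact absurd ⟨x, Finset.mem_insert_of_mem hx, y, Finset.mem_insert_of_mem hy, hxy⟩ h2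
    · exact zero_le_one
    · exact le_rfl
  have hf0 : ∀ A, 0 ≤ f A := fun A => by simp only [hf]; split_ifs <;> norm_num
  induction m, hm2 using Nat.le_induction with
  | succ m hm2 ih => exact (ih (by omega)).trans (ex_picks_le_succ ha (by omega) hfm)
  | base =>
    have hT : 0 < totalWt a S := by
      have := totalWt_sub_pos ha (S := S) (A := ∅) (by simp) (by rw [Finset.card_empty]; omega)
      simpa using this
    rw [ex_picks_succ ha (by omega), ex_picks_succ ha (by omega), ex_picks_zero]
    rw [Finset.card_filter, Nat.cast_sum, Finset.sum_product, Finset.sum_div]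
    simp only [Finset.sdiff_empty, Finset.sum_empty, sub_zero, insert_empty_eq,
      Finset.sum_singleton]
    refine Finset.sum_le_sum fun u hu => ?_
    have hw := one_le_wt ha hu
    have h1 : 1 / totalWt a S ≤ wt a S u / totalWt a S := div_le_div_of_nonneg_right hw hT.le
    have hpos : 0 < totalWt a S - wt a S u := by
      have := totalWt_sub_pos ha (S := S) (A := {u}) (by simpa using hu) (by rw [Finset.card_singleton]; omega)
      simpa using this
    have h2 : (∑ v ∈ vertices S, ((if ¬ R u v then 1 else 0 : ℕ) : ℝ)) / totalWt a S ≤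
        ∑ v ∈ vertices S \ {u}, wt a S v / (totalWt a S - wt a S u) * f {v, u} := by
      rw [← Finset.sum_sdiff (Finset.singleton_subset_iff.2 hu), Finset.sum_singleton,
        if_neg (not_not.2 (hR u)), Nat.cast_zero, add_zero, Finset.sum_div]
      refine Finset.sum_le_sum fun v hv => ?_
      have hv1 := one_le_wt ha (Finset.mem_sdiff.1 hv).1
      by_cases huv : R u v
      · rw [if_neg (not_not.2 huv)]
        simp only [Nat.cast_zero, zero_div]
        exact mul_nonneg (div_nonneg (by linarith) hpos.le) (hf0 _)
      · rw [if_pos huv]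
        have : f {v, u} = 1 := by
          simp only [hf]
          exact if_pos ⟨u, by simp, v, by simp, huv⟩
        rw [this, mul_one, Nat.cast_one]
        exact div_le_div₀ (by linarith) hv1 hpos (by linarith)
    have h3 : 0 ≤ (∑ v ∈ vertices S, ((if ¬ R u v then 1 else 0 : ℕ) : ℝ)) / totalWt a S :=
      div_nonneg (Finset.sum_nonneg fun v _ => Nat.cast_nonneg _) hT.le
    calc _ = 1 / totalWt a S *
          ((∑ v ∈ vertices S, ((if ¬ R u v then 1 else 0 : ℕ) : ℝ)) / totalWt a S) := by
          push_cast
          field_simp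
      _ ≤ _ := mul_le_mul h1 h2 h3 (by positivity)

end

end GeneSCs

namespace GeneSCs

/-! ### How facets, vertices and degrees change when a facet is added -/

section AddFacet

variable {S : Facets} {G : Finset ℕ}

theorem subset_vertices {F : Finset ℕ} (hF : F ∈ S) : F ⊆ vertices S := fun _ hv =>
  mem_vertices.2 ⟨F, hF, hv⟩

theorem vertices_addFacet (S : Facets) (G : Finset ℕ) :
    vertices (addFacet S G) = vertices S ∪ G := by
  unfold addFacet
  ext v
  split_ifs with h
  · obtain ⟨F, hF, hGF⟩ := h
    rw [Finset.mem_union]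
    exact ⟨Or.inl, fun hv => hv.elim id fun hv => subset_vertices hF (hGF hv)⟩
  · simp only [Finset.mem_union, mem_vertices, Finset.mem_insert, Finset.mem_filter]
    constructor
    · rintro ⟨F, rfl | hF, hv⟩
      · exact Or.inr hv
      · exact Or.inl ⟨F, hF.1, hv⟩
    · rintro (⟨F, hF, hv⟩ | hv)
      · by_cases hFG : F ⊆ G
        · exact ⟨G, Or.inl rfl, hFG hv⟩
        · exact ⟨F, Or.inr ⟨hF, hFG⟩, hv⟩
      · exact ⟨G, Or.inl rfl, hv⟩

theorem addFacet_of_subset (h : ∃ F ∈ S, G ⊆ F) : addFacet S G = S := if_pos h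

theorem addFacet_of_not_subset (h : ¬ ∃ F ∈ S, G ⊆ F) :
    addFacet S G = insert G (S.filter fun F => ¬ F ⊆ G) := if_neg h

theorem eq_of_mem_addFacet_of_notMem {F : Finset ℕ} (hF : F ∈ addFacet S G) (hFS : F ∉ S) :
    F = G ∧ ¬ ∃ F ∈ S, G ⊆ F := by
  by_cases h : ∃ F ∈ S, G ⊆ F
  · rw [addFacet_of_subset h] at hF
    exact absurd hF hFS
  · rw [addFacet_of_not_subset h] at hF
    rcases Finset.mem_insert.1 hF with rfl | hF
    · exact ⟨rfl, h⟩
    · exact absurd (Finset.mem_filter.1 hF).1 hFS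

theorem subset_of_mem_of_notMem_addFacet {F : Finset ℕ} (hF : F ∈ S) (hFS : F ∉ addFacet S G) :
    F ⊂ G ∧ ¬ ∃ F ∈ S, G ⊆ F := by
  by_cases h : ∃ F ∈ S, G ⊆ F
  · rw [addFacet_of_subset h] at hFS
    exact absurd hF hFS
  · rw [addFacet_of_not_subset h] at hFS
    have h1 : F ⊆ G := by
      by_contra hFG
      exact hFS (Finset.mem_insert_of_mem (Finset.mem_filter.2 ⟨hF, hFG⟩))
    exact ⟨Finset.ssubset_iff_subset_ne.2 ⟨h1, fun e => h ⟨F, hF, e ▸ subset_rfl⟩⟩, h⟩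

theorem exists_superset_addFacet (S : Facets) (G : Finset ℕ) : ∃ F ∈ addFacet S G, G ⊆ F := by
  by_cases h : ∃ F ∈ S, G ⊆ F
  · rwa [addFacet_of_subset h]
  · rw [addFacet_of_not_subset h]
    exact ⟨G, Finset.mem_insert_self _ _, subset_rfl⟩

theorem exists_superset_addFacet_of_mem {F : Finset ℕ} (hF : F ∈ S) :
    ∃ F' ∈ addFacet S G, F ⊆ F' := by
  by_cases h : F ∈ addFacet S G
  · exact ⟨F, h, subset_rfl⟩
  · obtain ⟨F', hF', hGF'⟩ := exists_superset_addFacet S G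
    exact ⟨F', hF', (subset_of_mem_of_notMem_addFacet hF h).1.1.trans hGF'⟩

theorem sum_addFacet_sdiff (S : Facets) (G : Finset ℕ) (f : Finset ℕ → ℝ) :
    ∑ F ∈ addFacet S G \ S, f F = if ∃ F ∈ S, G ⊆ F then 0 else f G := by
  split_ifs with h
  · rw [addFacet_of_subset h, sdiff_self, Finset.bot_eq_empty, Finset.sum_empty]
  · have hG : G ∉ S := fun hG => h ⟨G, hG, subset_rfl⟩
    have : addFacet S G \ S = {G} := by
      ext F
      rw [Finset.mem_sdiff, Finset.mem_singleton]
      constructor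
      · exact fun hF => (eq_of_mem_addFacet_of_notMem hF.1 hF.2).1
      · rintro rfl
        rw [addFacet_of_not_subset h]
        exact ⟨Finset.mem_insert_self _ _, hG⟩
    rw [this, Finset.sum_singleton]

theorem sdiff_addFacet_subset (S : Facets) (G : Finset ℕ) :
    S \ addFacet S G ⊆ S.filter (· ⊆ G) := fun F hF => by
  rw [Finset.mem_sdiff] at hF
  exact Finset.mem_filter.2 ⟨hF.1, (subset_of_mem_of_notMem_addFacet hF.1 hF.2).1.1⟩

/-- Only facets contained in `G` are deleted, so degrees can drop only inside `G`. -/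
theorem facetDegree_addFacet_of_notMem {v : ℕ} (hv : v ∉ G) :
    facetDegree (addFacet S G) v = facetDegree S v := by
  unfold facetDegree
  by_cases h : ∃ F ∈ S, G ⊆ F
  · rw [addFacet_of_subset h]
  · rw [addFacet_of_not_subset h, Finset.filter_insert, if_neg hv, Finset.filter_filter]
    congr 1
    refine Finset.filter_congr fun F _ => ?_
    exact ⟨fun h => h.2, fun h => ⟨fun hFG => hv (hFG h), h⟩⟩

theorem facetDegree_addFacet_le (v : ℕ) :
    facetDegree (addFacet S G) v ≤ facetDegree S v + 1 := by
  unfold facetDegree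
  by_cases h : ∃ F ∈ S, G ⊆ F
  · rw [addFacet_of_subset h]
    exact Nat.le_succ _
  · rw [addFacet_of_not_subset h, Finset.filter_insert]
    have h1 : ((S.filter fun F => ¬ F ⊆ G).filter fun F => v ∈ F).card ≤
        (S.filter fun F => v ∈ F).card :=
      Finset.card_le_card (Finset.filter_subset_filter _ (Finset.filter_subset _ _))
    split_ifs
    · exact (Finset.card_insert_le _ _).trans (by omega)
    · omega

theorem addFacet_of_incomparable (h : ∀ F ∈ S, ¬ F ⊆ G ∧ ¬ G ⊆ F) :
    addFacet S G = insert G S ∧ G ∉ S := by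
  have h1 : ¬ ∃ F ∈ S, G ⊆ F := fun ⟨F, hF, hGF⟩ => (h F hF).2 hGF
  refine ⟨?_, fun hG => (h G hG).1 subset_rfl⟩
  rw [addFacet_of_not_subset h1, Finset.filter_true_of_mem fun F hF => (h F hF).1]

theorem facetDegree_addFacet_of_incomparable (h : ∀ F ∈ S, ¬ F ⊆ G ∧ ¬ G ⊆ F) {v : ℕ}
    (hv : v ∈ G) : facetDegree (addFacet S G) v = facetDegree S v + 1 := by
  obtain ⟨h1, h2⟩ := addFacet_of_incomparable h
  rw [facetDegree, h1, Finset.filter_insert, if_pos hv, Finset.card_insert_of_notMem, facetDegree]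
  exact fun h => h2 (Finset.mem_filter.1 h).1

theorem card_addFacet_le : (addFacet S G).card ≤ S.card + 1 := by
  by_cases h : ∃ F ∈ S, G ⊆ F
  · rw [addFacet_of_subset h]
    exact Nat.le_succ _
  · rw [addFacet_of_not_subset h]
    exact (Finset.card_insert_le _ _).trans (Nat.succ_le_succ (Finset.card_filter_le _ _))

end AddFacet

/-! ### One step of the growth process -/

section Step

variable {z : PMF ℕ} {c a : ℝ} {S : Facets}

theorem notMem_freshVertices {v j : ℕ} (hv : v ∈ vertices S) : v ∉ freshVertices S j := by
  have : v ≤ (vertices S).sup id := Finset.le_sup (f := id) hv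
  simp only [freshVertices, Finset.mem_Ico, not_and_or]
  omega

theorem card_freshVertices (S : Facets) (j : ℕ) : (freshVertices S j).card = j := by
  simp [freshVertices]

theorem union_freshVertices_inter {A : Finset ℕ} (hA : A ⊆ vertices S) (j : ℕ) :
    (A ∪ freshVertices S j) ∩ vertices S = A := by
  ext v
  simp only [Finset.mem_inter, Finset.mem_union]
  exact ⟨fun h => h.1.elim id fun h' => absurd h' (notMem_freshVertices h.2),
    fun h => ⟨Or.inl h, hA h⟩⟩

theorem union_freshVertices_sdiff {A : Finset ℕ} (hA : A ⊆ vertices S) (j : ℕ) :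
    (A ∪ freshVertices S j) \ vertices S = freshVertices S j := by
  ext v
  simp only [Finset.mem_sdiff, Finset.mem_union]
  exact ⟨fun h => h.1.elim (fun h' => absurd (hA h') h.2) id,
    fun h => ⟨Or.inr h, fun hv => notMem_freshVertices hv h⟩⟩

theorem disjoint_freshVertices {A : Finset ℕ} (hA : A ⊆ vertices S) (j : ℕ) :
    Disjoint A (freshVertices S j) :=
  Finset.disjoint_left.2 fun _ hv => notMem_freshVertices (hA hv)

theorem card_union_freshVertices {A : Finset ℕ} (hA : A ⊆ vertices S) (j : ℕ) :
    (A ∪ freshVertices S j).card = A.card + j := by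
  rw [Finset.card_union_of_disjoint (disjoint_freshVertices hA j), card_freshVertices]

theorem mem_support_picks_le {m : ℕ} {A : Finset ℕ}
    (hA : A ∈ (picks a S m).support) : A ⊆ vertices S ∧ A.card ≤ m := by
  induction m generalizing A with
  | zero =>
    simp only [picks, PMF.support_pure, Set.mem_singleton_iff] at hA
    simp [hA]
  | succ m ih =>
    simp only [picks, PMF.support_bind, Set.mem_iUnion] at hA
    obtain ⟨B, hB, hAB⟩ := hA
    obtain ⟨h1, h2⟩ := ih hB
    unfold pick at hAB
    split_ifs at hAB with h
    · rw [PMF.support_pure, Set.mem_singleton_iff] at hAB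
      rw [hAB]
      exact ⟨h1, by omega⟩
    · rw [PMF.support_map] at hAB
      obtain ⟨v, hv, rfl⟩ := hAB
      rw [PMF.mem_support_normalize_iff] at hv
      have hv' : v ∈ vertices S \ B := by
        by_contra h'
        exact hv (pickWeight_eq_zero h')
      exact ⟨Finset.insert_subset (Finset.mem_sdiff.1 hv').1 h1,
        (Finset.card_insert_le _ _).trans (by omega)⟩

theorem newCount_le (c : ℝ) (S : Facets) (m : ℕ) : newCount c S m ≤ m := min_le_left _ _

theorem mem_support_step {S' : Facets} (h : S' ∈ (step z c a S).support) :
    ∃ G : Finset ℕ, G.card ∈ z.support ∧ newCount c S G.card ≤ (G \ vertices S).card ∧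
      S' = addFacet S G := by
  unfold step at h
  rw [PMF.support_bind] at h
  simp only [Set.mem_iUnion] at h
  obtain ⟨m, hm, h⟩ := h
  rw [PMF.support_map] at h
  obtain ⟨A, hA, rfl⟩ := h
  obtain ⟨h1, h2⟩ := mem_support_picks_le hA
  have hc : (A ∪ freshVertices S (m - A.card)).card = m := by
    rw [card_union_freshVertices h1]
    omega
  refine ⟨_, by rwa [hc], ?_, rfl⟩
  rw [hc, union_freshVertices_sdiff h1, card_freshVertices]
  have := newCount_le c S m
  omega

theorem card_vertices_of_mem_support_step (ha : 0 ≤ a)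
    (hV : ∀ m ∈ z.support, m ≤ (vertices S).card) {S' : Facets}
    (h : S' ∈ (step z c a S).support) : ∃ m ∈ z.support,
      (vertices S').card = (vertices S).card + newCount c S m := by
  unfold step at h
  rw [PMF.support_bind] at h
  simp only [Set.mem_iUnion] at h
  obtain ⟨m, hm, h⟩ := h
  rw [PMF.support_map] at h
  obtain ⟨A, hA, rfl⟩ := h
  obtain ⟨h1, h2⟩ := mem_support_picks ha ((Nat.sub_le _ _).trans (hV m hm)) hA
  have := newCount_le c S m
  refine ⟨m, hm, ?_⟩
  beta_reduce
  rw [show m - A.card = newCount c S m by omega, vertices_addFacet, ← Finset.union_assoc,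
    Finset.union_eq_left.2 h1, card_union_freshVertices subset_rfl]

theorem ex_step (hz : z.support.Finite) (f : Facets → ℝ) :
    ex (step z c a S) f = ex z fun m => ex (picks a S (m - newCount c S m)) fun A =>
      f (addFacet S (A ∪ freshVertices S (m - A.card))) := by
  unfold step
  rw [ex_bind hz fun m _ => finite_support_map _ (finite_support_picks S _)]
  exact ex_congr fun m _ => ex_map (finite_support_picks S _) _ _

theorem ex_step_mono (hz : z.support.Finite) (ha : 0 ≤ a)
    (hV : ∀ m ∈ z.support, m ≤ (vertices S).card) {f : Facets → ℝ} {g : ℕ → Finset ℕ → ℝ}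
    (hfg : ∀ m ∈ z.support, ∀ A ⊆ vertices S, A.card = m - newCount c S m →
      f (addFacet S (A ∪ freshVertices S (newCount c S m))) ≤ g m A) :
    ex (step z c a S) f ≤ ex z fun m => ex (picks a S (m - newCount c S m)) (g m) := by
  rw [ex_step hz]
  refine ex_mono hz fun m hm => ex_picks_mono ha ((Nat.sub_le _ _).trans (hV m hm))
    fun A hA hAm => ?_
  have := newCount_le c S m
  rw [show m - A.card = newCount c S m by omega]
  exact hfg m hm A hA hAm

theorem le_ex_step (hz : z.support.Finite) (ha : 0 ≤ a)
    (hV : ∀ m ∈ z.support, m ≤ (vertices S).card) {f : Facets → ℝ} {g : ℕ → Finset ℕ → ℝ}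
    (hfg : ∀ m ∈ z.support, ∀ A ⊆ vertices S, A.card = m - newCount c S m →
      g m A ≤ f (addFacet S (A ∪ freshVertices S (newCount c S m)))) :
    ex z (fun m => ex (picks a S (m - newCount c S m)) (g m)) ≤ ex (step z c a S) f := by
  rw [ex_step hz]
  refine ex_mono hz fun m hm => ex_picks_mono ha ((Nat.sub_le _ _).trans (hV m hm))
    fun A hA hAm => ?_
  have := newCount_le c S m
  rw [show m - A.card = newCount c S m by omega]
  exact hfg m hm A hA hAm

theorem newCount_eq_zero_iff (hc : 0 < c) {m : ℕ} (hm : m ≠ 0) :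
    newCount c S m = 0 ↔ (S.card : ℝ) + 1 ≤ c * (vertices S).card := by
  rw [newCount, Nat.min_eq_zero_iff, Nat.sub_eq_zero_iff_le, Nat.ceil_le, div_le_iff₀ hc,
    mul_comm]
  simp [hm]

end Step

section MaximalSize

variable {z : PMF ℕ}

/-- The largest facet size. -/
noncomputable def maxSize (hz : z.support.Finite) : ℕ := hz.toFinset.sup id

theorem le_maxSize (hz : z.support.Finite) {m : ℕ} (hm : m ∈ z.support) : m ≤ maxSize hz :=
  Finset.le_sup (f := id) (hz.mem_toFinset.2 hm)

theorem maxSize_mem (hz : z.support.Finite) : maxSize hz ∈ z.support := by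
  have hne : hz.toFinset.Nonempty := by
    obtain ⟨m, hm⟩ := z.support_nonempty
    exact ⟨m, hz.mem_toFinset.2 hm⟩
  obtain ⟨m, hm, h⟩ := Finset.exists_mem_eq_sup _ hne id
  rw [maxSize, h]
  exact hz.mem_toFinset.1 hm

end MaximalSize

end GeneSCs

namespace GeneSCs

/-! ### Sparse complexes and facets of maximal size -/

section Counting

variable {a : ℝ} {S : Facets}

theorem sum_facetDegree (S : Facets) : ∑ v ∈ vertices S, facetDegree S v = ∑ F ∈ S, F.card := by
  simp only [facetDegree, Finset.card_filter]
  rw [Finset.sum_comm]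
  refine Finset.sum_congr rfl fun F hF => ?_
  rw [← Finset.card_filter]
  congr 1
  rw [Finset.filter_mem_eq_inter]
  exact Finset.inter_eq_right.2 (subset_vertices hF)

theorem totalWt_eq (a : ℝ) (S : Facets) :
    totalWt a S = ∑ F ∈ S, (F.card : ℝ) + a * (vertices S).card := by
  rw [totalWt, Finset.sum_congr rfl fun v hv => wt_of_mem hv, Finset.sum_add_distrib,
    Finset.sum_const, nsmul_eq_mul, mul_comm a]
  congr 1
  exact_mod_cast sum_facetDegree S

theorem totalWt_le {b : ℕ} (hb : ∀ F ∈ S, F.card ≤ b) :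
    totalWt a S ≤ b * S.card + a * (vertices S).card := by
  rw [totalWt_eq]
  refine add_le_add_left ?_ _
  rw [mul_comm, ← nsmul_eq_mul]
  exact Finset.sum_le_card_nsmul _ _ _ fun F hF => by exact_mod_cast hb F hF

/-- Two vertices are adjacent if some facet contains both of them. -/
def Adj (S : Facets) (u v : ℕ) : Prop := ∃ F ∈ S, u ∈ F ∧ v ∈ F

-- Each facet accounts for at most `b ^ 2` ordered pairs. These include the diagonal, because every
-- vertex lies in a facet.
open Classical in
theorem card_not_adj_ge {b : ℕ} (hb : ∀ F ∈ S, F.card ≤ b) :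
    ((vertices S).card : ℝ) ^ 2 - b ^ 2 * S.card ≤
      ((vertices S ×ˢ vertices S).filter fun p => ¬ (p.1 = p.2 ∨ Adj S p.1 p.2)).card := by
  have h1 : ((vertices S ×ˢ vertices S).filter fun p => p.1 = p.2 ∨ Adj S p.1 p.2).card ≤
      b ^ 2 * S.card := by
    have hsub : (vertices S ×ˢ vertices S).filter (fun p => p.1 = p.2 ∨ Adj S p.1 p.2) ⊆
        S.biUnion fun F => F ×ˢ F := by
      intro p hp
      rw [Finset.mem_filter, Finset.mem_product] at hp
      rw [Finset.mem_biUnion]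
      rcases hp with ⟨⟨h1, h2⟩, h3 | ⟨F, hF, h4, h5⟩⟩
      · obtain ⟨F, hF, hv⟩ := mem_vertices.1 h1
        exact ⟨F, hF, Finset.mem_product.2 ⟨hv, h3 ▸ hv⟩⟩
      · exact ⟨F, hF, Finset.mem_product.2 ⟨h4, h5⟩⟩
    refine (Finset.card_le_card hsub).trans (Finset.card_biUnion_le.trans ?_)
    rw [mul_comm, ← smul_eq_mul]
    refine Finset.sum_le_card_nsmul _ _ _ fun F hF => ?_
    rw [Finset.card_product, sq]
    exact Nat.mul_le_mul (hb F hF) (hb F hF)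
  have h2 := Finset.card_filter_add_card_filter_not (s := vertices S ×ˢ vertices S)
    fun p => p.1 = p.2 ∨ Adj S p.1 p.2
  rw [Finset.card_product] at h2
  have h1' : (((vertices S ×ˢ vertices S).filter fun p => p.1 = p.2 ∨ Adj S p.1 p.2).card : ℝ) ≤
      b ^ 2 * S.card := by exact_mod_cast h1
  have h2' : (((vertices S ×ˢ vertices S).filter fun p => p.1 = p.2 ∨ Adj S p.1 p.2).card : ℝ) +
      ((vertices S ×ˢ vertices S).filter fun p => ¬ (p.1 = p.2 ∨ Adj S p.1 p.2)).card =
      ((vertices S).card : ℝ) * (vertices S).card := by exact_mod_cast h2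
  rw [sq]
  linarith

/-- The number of facets of maximal size that a step adds. -/
noncomputable def newMax (M : ℕ) (S S' : Facets) : ℝ :=
  ∑ F ∈ S' \ S, if F.card = M then 1 else 0

theorem abs_newMax_le {z : PMF ℕ} {c : ℝ} (M : ℕ) (S S' : Facets)
    (h : S' ∈ (step z c a S).support) : |newMax M S S'| ≤ 1 := by
  obtain ⟨G, _, _, rfl⟩ := mem_support_step h
  rw [newMax, sum_addFacet_sdiff]
  split_ifs <;> simp

/-- From every large complex, a step adds a facet of maximal size with a probability that is
bounded below. -/
theorem exists_le_ex_newMax {z : PMF ℕ} (hz : z.support.Finite) (hz2 : ∀ m ∈ z.support, 2 ≤ m)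
    {c : ℝ} (hc : 0 < c) (ha : 0 ≤ a) (b : ℕ) :
    ∃ σ : ℝ, 0 < σ ∧ ∃ N : ℕ, ∀ S : Facets, (∀ F ∈ S, F.card ≤ b) → N ≤ (vertices S).card →
      σ ≤ ex (step z c a S) (newMax (maxSize hz) S) := by
  classical
  set M := maxSize hz with hM
  have hM2 : 2 ≤ M := hz2 M (maxSize_mem hz)
  set ζ : ℝ := (z M).toReal with hζ
  have hζ0 : 0 < ζ := ENNReal.toReal_pos ((PMF.mem_support_iff _ _).1 (maxSize_mem hz))
    (z.apply_ne_top _)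
  -- When no new vertices are due, the facet density is at most `c` and the total weight is at most
  -- `D` times the number of vertices. At least half of all ordered pairs of vertices are then
  -- non-adjacent and distinct, and each is picked with probability at least `1 / T ^ 2`; this gives
  -- `1 / (2 * D ^ 2)`.
  set D : ℝ := b * c + a + 1 with hD
  have hD1 : 1 ≤ D := by
    have : 0 ≤ (b : ℝ) * c := by positivity
    linarith
  set τ : ℝ := min 1 (1 / (2 * D ^ 2)) with hτ
  have hτ0 : 0 < τ := lt_min one_pos (by positivity)
  refine ⟨ζ * τ, mul_pos hζ0 hτ0, max M ⌈2 * (b : ℝ) ^ 2 * c + 1⌉₊, fun S hb hV => ?_⟩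
  have hVM : M ≤ (vertices S).card := (le_max_left _ _).trans hV
  have hVc : 2 * (b : ℝ) ^ 2 * c + 1 ≤ (vertices S).card :=
    (Nat.le_ceil _).trans (by exact_mod_cast (le_max_right _ _).trans hV)
  set V : ℝ := ((vertices S).card : ℝ) with hVdef
  have hV1 : 1 ≤ V := by
    have : 0 ≤ 2 * (b : ℝ) ^ 2 * c := by positivity
    linarith
  let g : ℕ → Finset ℕ → ℝ := fun m A => if m = M then
    (if newCount c S M = 0 then
      (if ∃ u ∈ A, ∃ v ∈ A, ¬ (u = v ∨ Adj S u v) then 1 else 0) else 1) else 0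
  have hstep := le_ex_step (c := c) (S := S) hz ha (fun m hm => (le_maxSize hz hm).trans hVM)
    (f := newMax M S) (g := g) (by
      intro m hm A hA hAm
      simp only [g]
      rw [newMax, sum_addFacet_sdiff, card_union_freshVertices hA, hAm,
        Nat.sub_add_cancel (newCount_le c S m)]
      by_cases hmM : m = M
      · subst hmM
        rw [if_pos rfl, if_pos rfl]
        by_cases h0 : newCount c S M = 0
        · rw [if_pos h0]
          split_ifs with h1 h2
          · obtain ⟨F, hF, hAF⟩ := h2
            obtain ⟨u, hu, v, hv, huv⟩ := h1
            exact absurd (Or.inr ⟨F, hF, hAF (Finset.mem_union_left _ hu),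
              hAF (Finset.mem_union_left _ hv)⟩) huv
          · exact le_rfl
          · exact le_rfl
          · exact zero_le_one
        -- A facet with a fresh vertex cannot be contained in an existing one.
        · rw [if_neg h0, if_neg]
          rintro ⟨F, hF, hAF⟩
          have : (freshVertices S (newCount c S M)).Nonempty := by
            rw [← Finset.card_pos, card_freshVertices]
            omega
          obtain ⟨v, hv⟩ := this
          exact notMem_freshVertices (subset_vertices hF (hAF (Finset.mem_union_right _ hv))) hv
      · rw [if_neg hmM]
        split_ifs <;> simp)
  refine le_trans ?_ hstep
  have h1 : ∀ m ∈ z.support, (if m = M then τ else 0) ≤ ex (picks a S (m - newCount c S m)) (g m) := by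
    intro m _
    split_ifs with hmM
    · subst hmM
      by_cases h0 : newCount c S M = 0
      · have hg : g M = fun A => if ∃ u ∈ A, ∃ v ∈ A, ¬ (u = v ∨ Adj S u v) then 1 else 0 := by
          funext A
          simp only [g]
          rw [if_pos trivial, if_pos h0]
        rw [hg, h0, Nat.sub_zero]
        refine le_trans ?_ (le_ex_picks_not_rel ha hM2 hVM (R := fun u v => u = v ∨ Adj S u v)
          fun v => Or.inl rfl)
        have hF := (newCount_eq_zero_iff hc (by omega)).1 h0
        have hn := card_not_adj_ge hb
        have hT := totalWt_le (a := a) hb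
        have hb0 : (0 : ℝ) ≤ b := Nat.cast_nonneg _
        have hF0 : (0 : ℝ) ≤ S.card := Nat.cast_nonneg _
        rw [← hVdef] at hF hn hT
        have hT2 : totalWt a S ≤ D * V := by
          have : (b : ℝ) * S.card ≤ b * (c * V) := mul_le_mul_of_nonneg_left (by linarith) hb0
          rw [hD]
          nlinarith
        have hTpos : 0 < totalWt a S := by
          have := card_le_sum_wt ha (subset_refl (vertices S))
          rw [← hVdef] at this
          unfold totalWt
          linarith
        have hn2 : V ^ 2 / 2 ≤ V ^ 2 - (b : ℝ) ^ 2 * S.card := by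
          have : (b : ℝ) ^ 2 * S.card ≤ (b : ℝ) ^ 2 * (c * V) :=
            mul_le_mul_of_nonneg_left (by linarith) (by positivity)
          nlinarith
        refine (min_le_right _ _).trans ?_
        rw [div_le_div_iff₀ (by positivity) (by positivity)]
        have : totalWt a S ^ 2 ≤ (D * V) ^ 2 := pow_le_pow_left₀ hTpos.le hT2 2
        nlinarith [sq_nonneg D]
      · have hg : g M = fun A => 1 := by
          funext A
          simp only [g]
          rw [if_pos trivial, if_neg h0]
        rw [hg, ex_const (finite_support_picks S _)]
        exact min_le_left _ _
    · have hg : g m = fun A => 0 := by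
        funext A
        simp only [g]
        rw [if_neg hmM]
      rw [hg, ex_const (finite_support_picks S _)]
  refine le_trans (le_of_eq ?_) (ex_mono hz h1)
  unfold ex
  rw [tsum_eq_single M fun m hm => by simp [hm]]
  simp [hζ]

end Counting

/-! ### Deterministic properties of paths and linear growth -/

/-- A sequence of complexes each of which arises from its predecessor by adding a facet that a step
of the growth process can add. -/
structure IsPath (z : PMF ℕ) (c : ℝ) (x : ℕ → Facets) : Prop where
  exists_facet : ∀ n, ∃ G : Finset ℕ, G.card ∈ z.support ∧
    newCount c (x n) G.card ≤ (G \ vertices (x n)).card ∧ x (n + 1) = addFacet (x n) G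
  card_vertices_succ : ∀ n, (∀ m ∈ z.support, m ≤ (vertices (x n)).card) →
    ∃ m ∈ z.support, (vertices (x (n + 1))).card = (vertices (x n)).card + newCount c (x n) m

namespace IsPath

variable {z : PMF ℕ} {c a : ℝ} {x : ℕ → Facets}

theorem vertices_subset_succ (h : IsPath z c x) (n : ℕ) :
    vertices (x n) ⊆ vertices (x (n + 1)) := by
  obtain ⟨G, _, _, hG⟩ := h.exists_facet n
  rw [hG, vertices_addFacet]
  exact Finset.subset_union_left

theorem vertices_mono (h : IsPath z c x) : Monotone fun n => vertices (x n) :=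
  monotone_nat_of_le_succ h.vertices_subset_succ

theorem card_vertices_mono (h : IsPath z c x) : Monotone fun n => (vertices (x n)).card :=
  fun _ _ hij => Finset.card_le_card (h.vertices_mono hij)

theorem card_vertices_succ_le (h : IsPath z c x) (hz : z.support.Finite) (n : ℕ) :
    (vertices (x (n + 1))).card ≤ (vertices (x n)).card + maxSize hz := by
  obtain ⟨G, hm, _, hG⟩ := h.exists_facet n
  rw [hG, vertices_addFacet]
  exact (Finset.card_union_le _ _).trans (Nat.add_le_add_left (le_maxSize hz hm) _)

theorem card_vertices_le (h : IsPath z c x) (hz : z.support.Finite) (n : ℕ) :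
    (vertices (x n)).card ≤ (vertices (x 0)).card + maxSize hz * n := by
  induction n with
  | zero => simp
  | succ n ih =>
    have := h.card_vertices_succ_le hz n
    rw [Nat.mul_succ]
    omega

theorem card_le (h : IsPath z c x) (n : ℕ) : (x n).card ≤ (x 0).card + n := by
  induction n with
  | zero => simp
  | succ n ih =>
    obtain ⟨G, _, _, hG⟩ := h.exists_facet n
    have := card_addFacet_le (S := x n) (G := G)
    rw [hG]
    omega

theorem facet_card_le (h : IsPath z c x) (hz : z.support.Finite) {b : ℕ} (hb : maxSize hz ≤ b)
    (h0 : ∀ F ∈ x 0, F.card ≤ b) (n : ℕ) : ∀ F ∈ x n, F.card ≤ b := by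
  induction n with
  | zero => exact h0
  | succ n ih =>
    intro F hF
    obtain ⟨G, hm, _, hG⟩ := h.exists_facet n
    by_cases hFn : F ∈ x n
    · exact ih F hFn
    · rw [hG] at hF
      rw [(eq_of_mem_addFacet_of_notMem hF hFn).1]
      exact (le_maxSize hz hm).trans hb

theorem card_vertices_lt_succ (h : IsPath z c x) (hz2 : ∀ m ∈ z.support, 2 ≤ m) (hc : 0 < c) {n : ℕ}
    (hn : c * (vertices (x n)).card < (x n).card + 1) :
    (vertices (x n)).card < (vertices (x (n + 1))).card := by
  obtain ⟨G, hm, hnew, hG⟩ := h.exists_facet n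
  have h2 := hz2 _ hm
  have h1 : newCount c (x n) G.card ≠ 0 := fun h0 =>
    absurd ((newCount_eq_zero_iff hc (by omega)).1 h0) (not_le.2 hn)
  rw [hG, vertices_addFacet, ← Finset.union_sdiff_self_eq_union,
    Finset.card_union_of_disjoint Finset.disjoint_sdiff]
  omega

/-- Deletion happens only in favour of a strictly larger facet, and every face stays covered
thereafter. This is what prevents a deleted facet from being added again. -/
theorem exists_ssuperset_of_removed (h : IsPath z c x) {F : Finset ℕ} {i : ℕ} (hF : F ∈ x i)
    (hF' : F ∉ x (i + 1)) {k : ℕ} (hk : i + 1 ≤ k) : ∃ F' ∈ x k, F ⊂ F' := by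
  induction k, hk using Nat.le_induction with
  | base =>
    obtain ⟨G, _, _, hG⟩ := h.exists_facet i
    rw [hG] at hF' ⊢
    obtain ⟨F', h1, h2⟩ := exists_superset_addFacet (x i) G
    exact ⟨F', h1, (subset_of_mem_of_notMem_addFacet hF hF').1.trans_subset h2⟩
  | succ k hk ih =>
    obtain ⟨F', h1, h2⟩ := ih
    obtain ⟨G, _, _, hG⟩ := h.exists_facet k
    rw [hG]
    obtain ⟨F'', h3, h4⟩ := exists_superset_addFacet_of_mem (G := G) h1
    exact ⟨F'', h3, h2.trans_subset h4⟩

/-- A facet that has been removed never reappears. -/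
theorem notMem_of_removed (h : IsPath z c x) {F : Finset ℕ} {i j : ℕ} (hF : F ∈ x i) (hij : i ≤ j)
    (hj : F ∉ x j) {k : ℕ} (hk : j ≤ k) : F ∉ x k := by
  obtain ⟨l, hl, hl1, hl2⟩ : ∃ l, l < j ∧ F ∈ x l ∧ F ∉ x (l + 1) := by
    induction j, hij using Nat.le_induction with
    | base => exact absurd hF hj
    | succ j hij ih =>
      by_cases hFj : F ∈ x j
      · exact ⟨j, Nat.lt_succ_self j, hFj, hj⟩
      · obtain ⟨l, hl, h1⟩ := ih hFj (by omega)
        exact ⟨l, by omega, h1⟩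
  have : ∀ k, l + 1 ≤ k → F ∉ x k := by
    intro k hk
    induction k, hk using Nat.le_induction with
    | base => exact hl2
    | succ k hk ih =>
      intro hFk
      obtain ⟨G, _, _, hG⟩ := h.exists_facet k
      rw [hG] at hFk
      obtain ⟨rfl, h2⟩ := eq_of_mem_addFacet_of_notMem hFk ih
      obtain ⟨F', h3, h4⟩ := h.exists_ssuperset_of_removed hl1 hl2 hk
      exact h2 ⟨F', h3, h4.1⟩
  exact this k (by omega)

theorem maxFacet_mem_succ (h : IsPath z c x) (hz : z.support.Finite) {F : Finset ℕ} {n : ℕ}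
    (hF : F ∈ x n) (hFM : F.card = maxSize hz) : F ∈ x (n + 1) := by
  by_contra hF'
  obtain ⟨G, hm, _, hG⟩ := h.exists_facet n
  rw [hG] at hF'
  have h1 := Finset.card_lt_card (subset_of_mem_of_notMem_addFacet hF hF').1
  have h2 := le_maxSize hz hm
  omega

/-- Facets of maximal size accumulate, since no new facet can strictly contain one. -/
theorem sum_newMax_le (h : IsPath z c x) (hz : z.support.Finite) (n : ℕ) :
    ∑ i ∈ Finset.range n, newMax (maxSize hz) (x i) (x (i + 1)) ≤
      ((x n).filter fun F => F.card = maxSize hz).card := by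
  induction n with
  | zero => simp
  | succ n ih =>
    rw [Finset.sum_range_succ]
    refine (add_le_add_left ih _).trans ?_
    rw [newMax, Finset.sum_boole, ← Nat.cast_add, Nat.cast_le, ← Finset.card_union_of_disjoint]
    · refine Finset.card_le_card (Finset.union_subset (fun F hF => ?_) fun F hF => ?_)
      · rw [Finset.mem_filter] at hF ⊢
        exact ⟨h.maxFacet_mem_succ hz hF.1 hF.2, hF.2⟩
      · rw [Finset.mem_filter] at hF ⊢
        exact ⟨(Finset.mem_sdiff.1 hF.1).1, hF.2⟩
    · rw [Finset.disjoint_left]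
      intro F h1 h2
      rw [Finset.mem_filter, Finset.mem_sdiff] at h2
      exact h2.1.2 (Finset.mem_filter.1 h1).1

end IsPath

theorem eventually_mul_le_sum {u : ℕ → ℝ} {σ σ' : ℝ} (hσ : σ' < σ) (h : ∀ᶠ i in atTop, σ ≤ u i) :
    ∀ᶠ n : ℕ in atTop, σ' * n ≤ ∑ i ∈ Finset.range n, u i := by
  obtain ⟨N, hN⟩ := eventually_atTop.1 h
  set B := ∑ i ∈ Finset.range N, u i - σ * N with hB
  have h1 : ∀ n, N ≤ n → B + σ * n ≤ ∑ i ∈ Finset.range n, u i := by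
    intro n hn
    induction n, hn using Nat.le_induction with
    | base => rw [hB]; linarith
    | succ n hn ih =>
      rw [Finset.sum_range_succ]
      push_cast
      linarith [hN n hn]
  obtain ⟨K, hK⟩ := exists_nat_gt (-B / (σ - σ'))
  filter_upwards [eventually_ge_atTop N, eventually_ge_atTop K] with n hn hKn
  refine le_trans ?_ (h1 n hn)
  rw [div_lt_iff₀ (by linarith)] at hK
  have : (K : ℝ) ≤ n := by exact_mod_cast hKn
  nlinarith

theorem eventually_mul_le_sum_of_centred {f e : ℕ → ℝ} {σ : ℝ} (hσ : 0 < σ)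
    (he : ∀ᶠ i in atTop, σ ≤ e i)
    (h : Tendsto (fun n : ℕ => (∑ i ∈ Finset.range n, (f i - e i)) / n) atTop (𝓝 0)) :
    ∀ᶠ n : ℕ in atTop, σ / 2 * n ≤ ∑ i ∈ Finset.range n, f i := by
  filter_upwards [eventually_mul_le_sum (show 3 / 4 * σ < σ by linarith) he,
    h.eventually (eventually_gt_nhds (show -(σ / 4) < 0 by linarith)), eventually_gt_atTop 0]
    with n h1 h2 hn
  have hn0 : (0 : ℝ) < n := by exact_mod_cast hn
  rw [lt_div_iff₀ hn0, Finset.sum_sub_distrib] at h2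
  linarith

/-- Along a path with unboundedly many vertices, the numbers of vertices and facets grow
linearly. -/
theorem IsPath.exists_regular {z : PMF ℕ} {c a : ℝ} {x : ℕ → Facets} (h : IsPath z c x)
    (hz : z.support.Finite) (hz2 : ∀ m ∈ z.support, 2 ≤ m) (hc : 0 < c) (ha : 0 ≤ a)
    (hlln : Tendsto (fun n : ℕ => (∑ i ∈ Finset.range n, (newMax (maxSize hz) (x i) (x (i + 1)) -
      ex (step z c a (x i)) (newMax (maxSize hz) (x i)))) / n) atTop (𝓝 0))
    (hV : Tendsto (fun n => (vertices (x n)).card) atTop atTop) :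
    ∃ η C κ : ℝ, 0 < η ∧ 0 < C ∧ ∀ᶠ n : ℕ in atTop, η * n ≤ (vertices (x n)).card ∧
      totalWt a (x n) ≤ C * n ∧ Spread a (maxSize hz) κ (x n) := by
  set M := maxSize hz with hM
  set b : ℕ := max M ((x 0).sup Finset.card) with hb
  have hbn := h.facet_card_le hz (le_max_left M _) (b := b)
    fun F hF => (Finset.le_sup (f := Finset.card) hF).trans (le_max_right _ _)
  obtain ⟨σ, hσ, N, hN⟩ := exists_le_ex_newMax hz hz2 hc ha b
  have he : ∀ᶠ i in atTop, σ ≤ ex (step z c a (x i)) (newMax M (x i)) := by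
    filter_upwards [hV.eventually_ge_atTop N] with i hi
    exact hN _ (hbn i) hi
  have h1 := eventually_mul_le_sum_of_centred hσ he hlln
  obtain ⟨K, hK⟩ := eventually_atTop.1 h1
  have hF : ∀ n, K ≤ n → σ / 2 * n ≤ (x n).card := fun n hn =>
    ((hK n hn).trans (h.sum_newMax_le hz n)).trans (by exact_mod_cast Finset.card_filter_le _ _)
  -- The second bound serves if at some time in the second half of `[0, n]` the target for the
  -- vertices is already met, so that `|V| ≥ |F| / c`. Otherwise every step of that half adds a
  -- vertex, which gives `n / 4`.
  set η : ℝ := min (1 / 4) (σ / (4 * c)) with hη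
  have hη0 : 0 < η := lt_min (by norm_num) (by positivity)
  have hVη : ∀ᶠ n : ℕ in atTop, η * n ≤ (vertices (x n)).card := by
    filter_upwards [eventually_ge_atTop (2 * K), eventually_ge_atTop 4] with n hn hn4
    have hn0 : (0 : ℝ) ≤ n := Nat.cast_nonneg n
    set k := (n + 1) / 2 with hk
    by_cases hcase : ∃ i, k ≤ i ∧ i < n ∧ ((x i).card : ℝ) + 1 ≤ c * (vertices (x i)).card
    · obtain ⟨i, hi1, hi2, hi3⟩ := hcase
      have h2 := hF i (by omega)
      have h3 : ((vertices (x i)).card : ℝ) ≤ (vertices (x n)).card := by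
        exact_mod_cast h.card_vertices_mono hi2.le
      have h4 : (n : ℝ) ≤ 2 * i := by exact_mod_cast (show n ≤ 2 * i by omega)
      have h5 : σ / (4 * c) * n ≤ (vertices (x i)).card := by
        rw [div_mul_eq_mul_div, div_le_iff₀ (by positivity)]
        nlinarith
      have h6 : η * n ≤ σ / (4 * c) * n := mul_le_mul_of_nonneg_right (min_le_right _ _) hn0
      linarith
    · push Not at hcase
      have h2 : ∀ i, k ≤ i → i ≤ n → i - k ≤ (vertices (x i)).card := by
        intro i hi
        induction i, hi using Nat.le_induction with
        | base => intro _; omega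
        | succ i hi ih =>
          intro hin
          have := h.card_vertices_lt_succ hz2 hc (hcase i hi (by omega))
          have := ih (by omega)
          omega
      have h3 := h2 n (by omega) le_rfl
      have h4 : (n : ℝ) ≤ 4 * (n - k : ℕ) := by exact_mod_cast (show n ≤ 4 * (n - k) by omega)
      have h5 : η * n ≤ 1 / 4 * n := mul_le_mul_of_nonneg_right (min_le_left _ _) hn0
      have h6 : ((n - k : ℕ) : ℝ) ≤ (vertices (x n)).card := by exact_mod_cast h3
      linarith
  set C : ℝ := b * ((x 0).card + 1) + a * ((vertices (x 0)).card + M) + 1 with hC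
  have hC0 : 0 < C := by positivity
  have hT : ∀ᶠ n : ℕ in atTop, totalWt a (x n) ≤ C * n := by
    filter_upwards [eventually_ge_atTop 1] with n hn
    have hn1 : (1 : ℝ) ≤ n := by exact_mod_cast hn
    refine (totalWt_le (hbn n)).trans ?_
    have h2 : ((x n).card : ℝ) ≤ (x 0).card + n := by exact_mod_cast h.card_le n
    have h3 : ((vertices (x n)).card : ℝ) ≤ (vertices (x 0)).card + M * n := by
      exact_mod_cast h.card_vertices_le hz n
    have h4 : ((x n).card : ℝ) ≤ ((x 0).card + 1) * n := by
      nlinarith [(x 0).card.cast_nonneg (α := ℝ)]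
    have h5 : ((vertices (x n)).card : ℝ) ≤ ((vertices (x 0)).card + M) * n := by
      nlinarith [(vertices (x 0)).card.cast_nonneg (α := ℝ)]
    have h6 := mul_le_mul_of_nonneg_left h4 (b.cast_nonneg (α := ℝ))
    have h7 := mul_le_mul_of_nonneg_left h5 ha
    rw [hC]
    nlinarith
  -- Once there are more than `2 * M` vertices, removing `M` of them leaves at least half, and `T ≤
  -- C * n ≤ (C / η) * |V|`.
  refine ⟨η, C, 2 * C / η, hη0, hC0, ?_⟩
  filter_upwards [hVη, hT, hV.eventually_ge_atTop (2 * M + 1)] with n h2 h3 h4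
  refine ⟨h2, h3, ha, by omega, ?_⟩
  have h5 : (2 * M + 1 : ℝ) ≤ (vertices (x n)).card := by exact_mod_cast h4
  rw [div_mul_eq_mul_div, le_div_iff₀ hη0]
  have h6 : η * totalWt a (x n) ≤ η * (C * n) := mul_le_mul_of_nonneg_left h3 hη0.le
  nlinarith

/-- A path in which all facet sizes are possible sizes of new facets and which starts with enough
vertices has unboundedly many vertices. -/
theorem IsPath.tendsto_card_vertices {z : PMF ℕ} {c a : ℝ} {x : ℕ → Facets} (h : IsPath z c x)
    (hz : z.support.Finite) {σ : ℝ} (hσ : 0 < σ) {N : ℕ}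
    (hN : ∀ S : Facets, (∀ F ∈ S, F.card ≤ maxSize hz) → N ≤ (vertices S).card →
      σ ≤ ex (step z c a S) (newMax (maxSize hz) S))
    (hlln : Tendsto (fun n : ℕ => (∑ i ∈ Finset.range n, (newMax (maxSize hz) (x i) (x (i + 1)) -
      ex (step z c a (x i)) (newMax (maxSize hz) (x i)))) / n) atTop (𝓝 0))
    (h0 : ∀ F ∈ x 0, F.card ≤ maxSize hz) (hV0 : N ≤ (vertices (x 0)).card) :
    Tendsto (fun n => (vertices (x n)).card) atTop atTop := by
  have hb := h.facet_card_le hz le_rfl h0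
  have h1 := eventually_mul_le_sum_of_centred hσ (Eventually.of_forall fun i =>
    hN (x i) (hb i) (hV0.trans (h.card_vertices_mono (Nat.zero_le i)))) hlln
  refine tendsto_atTop_atTop_of_monotone h.card_vertices_mono fun B => ?_
  -- At most `B` vertices carry at most `2 ^ B` facets, against a number of maximal facets of at
  -- least `σ / 2 * n`.
  obtain ⟨n, hn1, hn2⟩ := (h1.and (eventually_gt_atTop ⌈2 / σ * 2 ^ B⌉₊)).exists
  refine ⟨n, ?_⟩
  by_contra hcon
  push Not at hcon
  have h2 : ((x n).filter fun F => F.card = maxSize hz).card ≤ 2 ^ B := by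
    refine (Finset.card_le_card (t := (vertices (x n)).powerset) fun F hF => ?_).trans ?_
    · exact Finset.mem_powerset.2 (subset_vertices (Finset.mem_filter.1 hF).1)
    · rw [Finset.card_powerset]
      exact Nat.pow_le_pow_right (by norm_num) hcon.le
  have h3 : (((x n).filter fun F => F.card = maxSize hz).card : ℝ) ≤ 2 ^ B := by exact_mod_cast h2
  have h4 := hn1.trans (h.sum_newMax_le hz n)
  have h5 : 2 / σ * 2 ^ B < n := (Nat.le_ceil _).trans_lt (by exact_mod_cast hn2)
  rw [div_mul_eq_mul_div, div_lt_iff₀ hσ] at h5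
  linarith

end GeneSCs

/-! ### Collisions, adjacent picks and the excess of picks in the notable set -/

namespace GeneSCs

/-- The indicator function of the complement of `B`. -/
def off (B : Finset ℕ) (v : ℕ) : ℝ := if v ∈ B then 0 else 1

theorem off_nonneg (B : Finset ℕ) (v : ℕ) : 0 ≤ off B v := by
  unfold off; split_ifs <;> norm_num

theorem off_le_one (B : Finset ℕ) (v : ℕ) : off B v ≤ 1 := by
  unfold off; split_ifs <;> norm_num

theorem off_anti {H O : Finset ℕ} (h : H ⊆ O) (v : ℕ) : off O v ≤ off H v := by
  unfold off
  split_ifs with h1 h2 h2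
  · exact le_rfl
  · exact zero_le_one
  · exact absurd (h h2) h1
  · exact le_rfl

theorem sum_off (A B : Finset ℕ) : ∑ v ∈ A, off B v = (A \ B).card := by
  unfold off
  have : ∀ v ∈ A, (if v ∈ B then (0 : ℝ) else 1) = if v ∉ B then 1 else 0 := fun v _ => by
    split_ifs <;> rfl
  rw [Finset.sum_congr rfl this, Finset.sum_boole, Finset.filter_notMem_eq_sdiff]

/-- The probability that the first pick is not in `B`. -/
noncomputable def prOff (a : ℝ) (B : Finset ℕ) (S : Facets) : ℝ :=
  ∑ v ∈ vertices S, pr a S v * off B v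

/-- The probability that two independent first picks coincide and are not in `H`. -/
noncomputable def collisionOff (a : ℝ) (H : Finset ℕ) (S : Facets) : ℝ :=
  ∑ v ∈ vertices S, pr a S v ^ 2 * off H v

open Classical in
/-- The indicator function of the adjacent pairs `(u, v)` with `u ∉ O` and `v ∉ H`. -/
noncomputable def adjOff (O H : Finset ℕ) (S : Facets) (u v : ℕ) : ℝ :=
  if u ≠ v ∧ u ∉ O ∧ v ∉ H ∧ Adj S u v then 1 else 0

/-- The probability that two independent first picks `u`, `v` are adjacent, `u ∉ O` and `v ∉ H`. -/
noncomputable def prAdjOff (a : ℝ) (O H : Finset ℕ) (S : Facets) : ℝ :=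
  ∑ u ∈ vertices S, ∑ v ∈ vertices S, pr a S u * pr a S v * adjOff O H S u v

theorem adjOff_nonneg (O H : Finset ℕ) (S : Facets) (u v : ℕ) : 0 ≤ adjOff O H S u v := by
  unfold adjOff; split_ifs <;> norm_num

theorem adjOff_self (O H : Finset ℕ) (S : Facets) (v : ℕ) : adjOff O H S v v = 0 :=
  if_neg fun h => h.1 rfl

theorem prOff_nonneg {a : ℝ} (ha : 0 ≤ a) (B : Finset ℕ) (S : Facets) : 0 ≤ prOff a B S :=
  Finset.sum_nonneg fun v _ => mul_nonneg (pr_nonneg ha v) (off_nonneg B v)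

theorem collisionOff_nonneg (a : ℝ) (H : Finset ℕ) (S : Facets) : 0 ≤ collisionOff a H S :=
  Finset.sum_nonneg fun v _ => mul_nonneg (sq_nonneg _) (off_nonneg H v)

theorem prAdjOff_nonneg {a : ℝ} (ha : 0 ≤ a) (O H : Finset ℕ) (S : Facets) :
    0 ≤ prAdjOff a O H S :=
  Finset.sum_nonneg fun u _ => Finset.sum_nonneg fun v _ =>
    mul_nonneg (mul_nonneg (pr_nonneg ha u) (pr_nonneg ha v)) (adjOff_nonneg O H S u v)

theorem prOff_le_one {a κ : ℝ} {M : ℕ} {S : Facets} (h : Spread a M κ S) (B : Finset ℕ) :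
    prOff a B S ≤ 1 := by
  rw [← sum_pr h.totalWt_pos.ne']
  exact Finset.sum_le_sum fun v _ => mul_le_of_le_one_right (pr_nonneg h.nonneg v) (off_le_one B v)

/-- Two vertices of a common facet are adjacent. Not being inside `O` supplies `u`, and among two
vertices off `H` at least one differs from `u`. -/
theorem one_le_sum_adjOff {O H A : Finset ℕ} {S : Facets} {F : Finset ℕ} (hF : F ∈ S)
    (hFA : A ⊆ F) {B : Finset ℕ} (hB : A ⊆ B) (hO : ¬ A ⊆ O) (hH : 2 ≤ (A \ H).card) :
    1 ≤ ∑ u ∈ B, ∑ v ∈ B, adjOff O H S u v := by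
  obtain ⟨u, huA, huO⟩ := Finset.not_subset.1 hO
  obtain ⟨v, hv, hvu⟩ : ∃ v ∈ A \ H, v ≠ u := by
    by_contra hcon
    push Not at hcon
    have : A \ H ⊆ {u} := fun v hv => Finset.mem_singleton.2 (hcon v hv)
    have := Finset.card_le_card this
    simp at this
    omega
  rw [Finset.mem_sdiff] at hv
  have h1 : adjOff O H S u v = 1 :=
    if_pos ⟨hvu.symm, huO, hv.2, F, hF, hFA huA, hFA hv.1⟩
  calc (1 : ℝ) = adjOff O H S u v := h1.symm
    _ ≤ ∑ v ∈ B, adjOff O H S u v :=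
        Finset.single_le_sum (fun w _ => adjOff_nonneg O H S u w) (hB hv.1)
    _ ≤ _ := Finset.single_le_sum
        (f := fun u => ∑ v ∈ B, adjOff O H S u v)
        (fun w _ => Finset.sum_nonneg fun w' _ => adjOff_nonneg O H S w w') (hB huA)

/-- The number of picks in `O` for a new facet, compared with its mean if all attempts to add a
facet succeed; negative contributions of facets that may be lost are replaced by zero. -/
noncomputable def excess (H O V : Finset ℕ) (y : ℝ) (G : Finset ℕ) : ℝ :=
  if 2 ≤ (G \ H).card then (G ∩ O).card - y * (G ∩ V).card
  else if G ⊆ O then 0 else max ((G ∩ O).card - y * (G ∩ V).card) 0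

section Excess

variable {a κ : ℝ} {M : ℕ} {S : Facets} {H O : Finset ℕ}

theorem card_inter_eq_sub (A O : Finset ℕ) : ((A ∩ O).card : ℝ) = A.card - (A \ O).card := by
  rw [eq_sub_iff_add_eq]
  exact_mod_cast Finset.card_inter_add_card_sdiff A O

/-- On `m` picks the unmodified difference is `m * l - (A \ O).card`, with mean at most a collision
term; the issue is that discarding facets inside `O` and clipping negative values might raise the
mean. The comparison uses that, given exactly one pick off `H`, this pick is off `O` with
probability close to `q = l / n`, the conditional share of the complement of `O` in that of `H`. -/
theorem ex_excess_picks_le (h : Spread a M κ S) (hHO : H ⊆ O) {m : ℕ} (hm : m ≤ M) :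
    ex (picks a S m) (excess H O (vertices S) (1 - prOff a O S)) ≤
      2 * (m ^ 2 * κ ^ 2 * collisionOff a H S) := by
  have ha := h.nonneg
  have hκ := h.one_le
  have hV := h.card_lt
  have hT := h.totalWt_pos
  have hfin := finite_support_picks (a := a) S m
  set S2 := collisionOff a H S with hS2
  have hS20 : 0 ≤ S2 := collisionOff_nonneg a H S
  set l := prOff a O S with hl
  set n := prOff a H S with hn
  have hl0 : 0 ≤ l := prOff_nonneg ha O S
  have hn0 : 0 ≤ n := prOff_nonneg ha H S
  have hln : l ≤ n := Finset.sum_le_sum fun v _ =>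
    mul_le_mul_of_nonneg_left (off_anti hHO v) (pr_nonneg ha v)
  -- If `n = 0`, division by zero gives `q = 0`, and `q * n = l` still holds because `l ≤ n`.
  set q := l / n with hq
  have hq0 : 0 ≤ q := div_nonneg hl0 hn0
  have hq1 : q ≤ 1 := div_le_one_of_le₀ hln hn0
  have hqn : q * n = l := by
    rcases hn0.eq_or_lt with h0 | h0
    · rw [← h0, mul_zero]
      linarith
    · rw [hq, div_mul_cancel₀ _ h0.ne']
  -- Balanced with respect to the weights and zero on `H`, so its sum over the picks, and that sum
  -- restricted to exactly one pick off `H`, have controlled means.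
  set f : ℕ → ℝ := fun v => off O v - q * off H v with hf
  have hfH : ∀ v ∈ H, f v = 0 := fun v hv => by simp [hf, off, hv, hHO hv]
  have hf1 : ∀ v, |f v| ≤ 1 := fun v => by
    have h1 := mul_nonneg hq0 (off_nonneg H v)
    have h2 := mul_le_of_le_one_left (off_nonneg H v) hq1
    rw [abs_le]
    constructor <;> simp only [hf] <;>
      linarith [off_nonneg O v, off_le_one O v, off_le_one H v]
  have hfn : ∀ v, f v ≤ off H v := fun v => by
    have h1 := mul_nonneg hq0 (off_nonneg H v)
    simp only [hf]
    linarith [off_anti hHO v]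
  have h0 : ∑ v ∈ vertices S, wt a S v * f v = 0 := by
    have e : ∀ v ∈ vertices S, wt a S v * f v =
        totalWt a S * (pr a S v * off O v) - totalWt a S * q * (pr a S v * off H v) := by
      intro v _
      simp only [hf, pr]
      field_simp
    rw [Finset.sum_congr rfl e, Finset.sum_sub_distrib, ← Finset.mul_sum, ← Finset.mul_sum]
    change totalWt a S * l - totalWt a S * q * n = 0
    rw [mul_assoc, hqn, sub_self]
  have hfA : ∀ A : Finset ℕ, ∑ v ∈ A, f v = (A \ O).card - q * (A \ H).card := fun A => by
    simp only [hf]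
    rw [Finset.sum_sub_distrib, ← Finset.mul_sum, sum_off, sum_off]
  have F1 := h.le_ex_picks_sum hm (g := off O) (off_nonneg O)
  have F1' : m * l - m ^ 2 * κ ^ 2 * S2 ≤ ex (picks a S m) fun A => ((A \ O).card : ℝ) := by
    have h1 : ∑ v ∈ vertices S, pr a S v ^ 2 * off O v ≤ S2 := Finset.sum_le_sum fun v _ =>
      mul_le_mul_of_nonneg_left (off_anti hHO v) (sq_nonneg _)
    have h2 : (m : ℝ) ^ 2 * κ * ∑ v ∈ vertices S, pr a S v ^ 2 * off O v ≤ m ^ 2 * κ ^ 2 * S2 := by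
      have hκ2 : κ ≤ κ ^ 2 := by nlinarith
      have hc0 : 0 ≤ ∑ v ∈ vertices S, pr a S v ^ 2 * off O v := collisionOff_nonneg a O S
      gcongr
    simp only [sum_off] at F1
    change m * l - _ ≤ _ at F1
    linarith
  have F2 := h.abs_ex_picks_single_le hm hfH hf1 h0 (fun _ => 1) (fun _ _ => by simp)
  have F3 := h.le_ex_picks_sum_of_balanced hm (off_nonneg H) hfn h0
  change -(m ^ 2 * κ ^ 2 * S2) ≤ _ at F3
  change _ ≤ (m : ℝ) ^ 2 * κ ^ 2 * S2 at F2
  have hNsub : ∀ A : Finset ℕ, (A \ O).card ≤ (A \ H).card := fun A =>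
    Finset.card_le_card (Finset.sdiff_subset_sdiff subset_rfl hHO)
  have hp : ∀ A ⊆ vertices S, A.card = m → ((A ∩ O).card : ℝ) - (1 - l) * (A ∩ vertices S).card =
      m * l - (A \ O).card := by
    intro A hA hAm
    rw [card_inter_eq_sub, Finset.inter_eq_left.2 hA, hAm]
    ring
  have hsubO : ∀ A : Finset ℕ, A ⊆ O ↔ (A \ O).card = 0 := fun A => by
    rw [Finset.card_eq_zero, Finset.sdiff_eq_empty_iff_subset]
  have hml0 : 0 ≤ (m : ℝ) * l := mul_nonneg (Nat.cast_nonneg _) hl0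
  -- If `m * l ≥ 1`, no value with at most one pick off `H` is negative, so clipping is vacuous and
  -- discarding only decreases. If `m * l < 1`, only the event of two or more picks off `H`
  -- contributes.
  rcases le_or_gt 1 ((m : ℝ) * l) with hml | hml
  · have hle : ∀ A ⊆ vertices S, A.card = m → excess H O (vertices S) (1 - l) A ≤
        m * l - (A \ O).card := by
      intro A hA hAm
      have h3 := hNsub A
      unfold excess
      rw [hp A hA hAm]
      split_ifs with h1 h2
      · exact le_rfl
      · have h4 : (A \ O).card = 0 := (hsubO A).1 h2
        rw [h4]
        simpa using hml0
      · have h4 : ((A \ O).card : ℝ) ≤ 1 := by exact_mod_cast (show (A \ O).card ≤ 1 by omega)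
        rw [max_eq_left (by linarith)]
    refine (ex_picks_mono ha (by omega) hle).trans ?_
    rw [ex_sub hfin, ex_const hfin]
    have : 0 ≤ (m : ℝ) ^ 2 * κ ^ 2 * S2 := by positivity
    linarith
  · have hle : ∀ A ⊆ vertices S, A.card = m → excess H O (vertices S) (1 - l) A ≤
        if 2 ≤ (A \ H).card then m * l - (A \ O).card else 0 := by
      intro A hA hAm
      unfold excess
      rw [hp A hA hAm]
      split_ifs with h1 h2
      · exact le_rfl
      · exact le_rfl
      · have h4 : (1 : ℝ) ≤ (A \ O).card := by
          rw [hsubO] at h2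
          exact_mod_cast Nat.one_le_iff_ne_zero.2 h2
        rw [max_eq_right (by linarith)]
    refine (ex_picks_mono ha (by omega) hle).trans ?_
    -- If `m * n ≥ 1`, then `q ≤ m * l`, and the terms with at most one pick off `H` that are
    -- removed have nonnegative mean up to collisions. If `m * n < 1`, then `m * l ≤ 2 * q`, and on
    -- two or more picks off `H` the value is at most `-∑ v ∈ A, f v`.
    rcases le_or_gt 1 ((m : ℝ) * n) with hmn | hmn
    · have hq2 : q ≤ m * l := by nlinarith
      have hle2 : ∀ A ⊆ vertices S, A.card = m →
          (if 2 ≤ (A \ H).card then m * l - ((A \ O).card : ℝ) else 0) ≤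
          (m * l - ((A \ O).card : ℝ)) + (∑ v ∈ A, f v) * (if (A \ H).card = 1 then 1 else 0) := by
        intro A hA hAm
        have h3 := hNsub A
        rw [hfA]
        split_ifs with h1 h2 h2
        · omega
        · linarith
        · rw [h2]
          push_cast
          linarith
        · have h4 : (A \ O).card = 0 := by omega
          rw [h4]
          simpa using hml0
      refine (ex_picks_mono ha (by omega) hle2).trans ?_
      rw [ex_add hfin, ex_sub hfin, ex_const hfin]
      linarith [(abs_le.1 F2).2]
    · have hq2 : m * l - 2 * q ≤ 0 := by
        have : m * l = (m * n) * q := by rw [← hqn]; ring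
        nlinarith
      have hle2 : ∀ A ⊆ vertices S, A.card = m →
          (if 2 ≤ (A \ H).card then m * l - ((A \ O).card : ℝ) else 0) ≤
          (∑ v ∈ A, f v) * (if (A \ H).card = 1 then 1 else 0) - ∑ v ∈ A, f v := by
        intro A hA hAm
        have h3 := hNsub A
        rw [hfA]
        split_ifs with h1 h2 h2
        · omega
        · have : (2 : ℝ) ≤ (A \ H).card := by exact_mod_cast h1
          nlinarith
        · linarith
        · have h4 : (A \ H).card = 0 := by omega
          have h5 : (A \ O).card = 0 := by omega
          rw [h4, h5]
          simp
      refine (ex_picks_mono ha (by omega) hle2).trans ?_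
      rw [ex_sub hfin]
      linarith [(abs_le.1 F2).2]

/-- Losing a facet hurts only if its excess is negative, hence only if it leaves `O` and has two
vertices off `H`; being lost, it then exhibits an adjacent pair counted by `adjOff`, and the excess
is at least `-M`. A facet with a new vertex is never lost. -/
theorem ex_excess_step_le {z : PMF ℕ} (hz : z.support.Finite) {c : ℝ}
    (h : Spread a (maxSize hz) κ S) (hHO : H ⊆ O) (hOV : O ⊆ vertices S) :
    ex (step z c a S) (fun S' => ∑ G ∈ S' \ S,
      excess H O (vertices S) (1 - prOff a O S) G) ≤
      2 * maxSize hz ^ 3 * κ ^ 2 * (collisionOff a H S + prAdjOff a O H S) := by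
  set M := maxSize hz with hM
  have ha := h.nonneg
  have hκ := h.one_le
  have hV := h.card_lt
  set l := prOff a O S with hl
  have hl0 : 0 ≤ l := prOff_nonneg ha O S
  have hl1 : l ≤ 1 := prOff_le_one h O
  have hc0 := collisionOff_nonneg a H S
  have hd0 := prAdjOff_nonneg ha O H S
  let g : ℕ → Finset ℕ → ℝ := fun m A => if newCount c S m = 0 then
    excess H O (vertices S) (1 - l) A + M * ∑ u ∈ A, ∑ v ∈ A, adjOff O H S u v
    else ((m - newCount c S m : ℕ) : ℝ) * l - ∑ v ∈ A, off O v
  have h1 := ex_step_mono (c := c) (S := S) hz ha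
    (fun m hm => (le_maxSize hz hm).trans hV.le)
    (f := fun S' => ∑ G ∈ S' \ S, excess H O (vertices S) (1 - l) G) (g := g) (by
      intro m hm A hA hAm
      rw [sum_addFacet_sdiff]
      simp only [g]
      have hmM : m ≤ M := le_maxSize hz hm
      have hadj : 0 ≤ ∑ u ∈ A, ∑ v ∈ A, adjOff O H S u v := Finset.sum_nonneg fun u _ =>
        Finset.sum_nonneg fun v _ => adjOff_nonneg O H S u v
      by_cases h0 : newCount c S m = 0
      · rw [if_pos h0, h0]
        have hfr : freshVertices S 0 = ∅ := by
          rw [← Finset.card_eq_zero, card_freshVertices]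
        rw [hfr, Finset.union_empty]
        have hMadj : 0 ≤ (M : ℝ) * ∑ u ∈ A, ∑ v ∈ A, adjOff O H S u v :=
          mul_nonneg (Nat.cast_nonneg _) hadj
        split_ifs with hsub
        · obtain ⟨F, hF, hAF⟩ := hsub
          unfold excess
          rw [Finset.inter_eq_left.2 hA]
          have hAM : (A.card : ℝ) ≤ M := by exact_mod_cast (show A.card ≤ M by omega)
          have hA0 : (0 : ℝ) ≤ A.card := Nat.cast_nonneg _
          split_ifs with h2 h3
          · by_cases hAO : A ⊆ O
            · rw [Finset.inter_eq_left.2 hAO]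
              nlinarith
            · have h4 := one_le_sum_adjOff hF hAF subset_rfl hAO h2
              have h5 : (M : ℝ) * 1 ≤ M * ∑ u ∈ A, ∑ v ∈ A, adjOff O H S u v :=
                mul_le_mul_of_nonneg_left h4 (Nat.cast_nonneg _)
              have h6 : (0 : ℝ) ≤ (A ∩ O).card := Nat.cast_nonneg _
              nlinarith
          · linarith
          · exact add_nonneg (le_max_right _ _) hMadj
        · linarith
      · rw [if_neg h0]
        set j := newCount c S m with hj
        set G := A ∪ freshVertices S j with hG
        have hfr : (freshVertices S j).Nonempty := by
          rw [← Finset.card_pos, card_freshVertices]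
          omega
        obtain ⟨w, hw⟩ := hfr
        have hwV : w ∉ vertices S := fun hh => notMem_freshVertices hh hw
        have hwG : w ∈ G := Finset.mem_union_right _ hw
        rw [if_neg (by
          rintro ⟨F, hF, hAF⟩
          exact hwV (subset_vertices hF (hAF hwG)))]
        have hGO : G ∩ O = A ∩ O := by
          ext v
          simp only [hG, Finset.mem_inter, Finset.mem_union]
          exact ⟨fun hh => ⟨hh.1.resolve_right (notMem_freshVertices (hOV hh.2)), hh.2⟩,
            fun hh => ⟨Or.inl hh.1, hh.2⟩⟩
        have hnO : ¬ G ⊆ O := fun hh => hwV (hOV (hh hwG))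
        have hval : ((G ∩ O).card : ℝ) - (1 - l) * (G ∩ vertices S).card =
            ((m - j : ℕ) : ℝ) * l - ∑ v ∈ A, off O v := by
          rw [hGO, union_freshVertices_inter hA, card_inter_eq_sub, sum_off, hAm]
          ring
        unfold excess
        split_ifs with h2
        · exact hval.le
        -- The fresh vertex is already one vertex off `H`, so all picks lie in `H ⊆ O` and the
        -- difference is nonnegative; clipping has no effect.
        · have hAH : A ⊆ H := by
            by_contra hcon
            obtain ⟨v, hv, hvH⟩ := Finset.not_subset.1 hcon
            have : ({v, w} : Finset ℕ) ⊆ G \ H := by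
              intro y hy
              rw [Finset.mem_insert, Finset.mem_singleton] at hy
              rw [Finset.mem_sdiff]
              rcases hy with rfl | rfl
              · exact ⟨Finset.mem_union_left _ hv, hvH⟩
              · exact ⟨hwG, fun hh => hwV (hOV (hHO hh))⟩
            have h3 := Finset.card_le_card this
            rw [Finset.card_pair (fun e => hwV (hA (by rw [← e]; exact hv)))] at h3
            omega
          rw [max_eq_left, hval]
          rw [hval, sum_off, Finset.sdiff_eq_empty_iff_subset.2 (hAH.trans hHO)]
          simp
          positivity)
  refine h1.trans (ex_le_const hz fun m hm => ?_)
  have hmM : m ≤ M := le_maxSize hz hm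
  have hmM' : (m : ℝ) ≤ M := by exact_mod_cast hmM
  have hm0 : (0 : ℝ) ≤ m := Nat.cast_nonneg _
  have hM1 : (1 : ℝ) ≤ M ∨ m = 0 := by
    rcases Nat.eq_zero_or_pos m with h0 | h0
    · exact Or.inr h0
    · exact Or.inl (by exact_mod_cast h0.trans_le hmM)
  have hbig : 2 * ((m : ℝ) ^ 2 * κ ^ 2 * collisionOff a H S) ≤
      2 * M ^ 3 * κ ^ 2 * collisionOff a H S := by
    have : (m : ℝ) ^ 2 ≤ M ^ 3 := by
      rcases hM1 with h1 | h1
      · calc (m : ℝ) ^ 2 ≤ M ^ 2 := pow_le_pow_left₀ hm0 hmM' 2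
          _ ≤ M ^ 3 := pow_le_pow_right₀ h1 (by norm_num)
      · subst h1
        simp
    have := mul_le_mul_of_nonneg_right this (show 0 ≤ 2 * (κ ^ 2 * collisionOff a H S) by positivity)
    linarith
  by_cases h0 : newCount c S m = 0
  · have hg : g m = fun A => excess H O (vertices S) (1 - l) A +
        M * ∑ u ∈ A, ∑ v ∈ A, adjOff O H S u v := by
      funext A
      exact if_pos h0
    rw [hg, h0, Nat.sub_zero, ex_add (finite_support_picks S m), ex_mul_left]
    have h2 := ex_excess_picks_le h hHO hmM
    have h3 := h.ex_picks_pairs_le hmM (adjOff_nonneg O H S) (adjOff_self O H S)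
    change _ ≤ ((m : ℝ) * κ) ^ 2 * prAdjOff a O H S at h3
    have h4 : ((m : ℝ) * κ) ^ 2 * prAdjOff a O H S ≤ (M * κ) ^ 2 * prAdjOff a O H S := by gcongr
    have h5 := mul_le_mul_of_nonneg_left (h3.trans h4) (Nat.cast_nonneg (α := ℝ) M)
    have h6 : 0 ≤ (M : ℝ) ^ 3 * κ ^ 2 * prAdjOff a O H S := by positivity
    nlinarith
  · have hg : g m = fun A => ((m - newCount c S m : ℕ) : ℝ) * l - ∑ v ∈ A, off O v := by
      funext A
      exact if_neg h0
    have hfin := finite_support_picks (a := a) S (m - newCount c S m)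
    rw [hg, ex_sub hfin, ex_const hfin]
    have hr : ((m - newCount c S m : ℕ) : ℝ) ≤ m := by exact_mod_cast Nat.sub_le _ _
    have hr0 : (0 : ℝ) ≤ ((m - newCount c S m : ℕ) : ℝ) := Nat.cast_nonneg _
    have F1 := h.le_ex_picks_sum ((Nat.sub_le m (newCount c S m)).trans hmM) (off_nonneg O)
    change _ * l - _ ≤ _ at F1
    have h2 : ∑ v ∈ vertices S, pr a S v ^ 2 * off O v ≤ collisionOff a H S :=
      Finset.sum_le_sum fun v _ => mul_le_mul_of_nonneg_left (off_anti hHO v) (sq_nonneg _)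
    have h3 : ((m - newCount c S m : ℕ) : ℝ) ^ 2 * κ *
        ∑ v ∈ vertices S, pr a S v ^ 2 * off O v ≤ m ^ 2 * κ ^ 2 * collisionOff a H S := by
      have hκ2 : κ ≤ κ ^ 2 := by nlinarith
      have hc0 : 0 ≤ ∑ v ∈ vertices S, pr a S v ^ 2 * off O v := collisionOff_nonneg a O S
      gcongr
    have h4 : 0 ≤ (m : ℝ) ^ 2 * κ ^ 2 * collisionOff a H S := by positivity
    have h6 : 0 ≤ 2 * (M : ℝ) ^ 3 * κ ^ 2 * prAdjOff a O H S := by positivity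
    linarith

/-- The number of facets that a step removes, not counting those that are contained in `O` or have
at most one vertex outside `H`. -/
noncomputable def removedSafe (H O : Finset ℕ) (S S' : Facets) : ℝ :=
  ((S \ S').filter fun F => ¬ F ⊆ O ∧ 2 ≤ (F \ H).card).card

/-- A removed facet consists of picked old vertices, so one counted here forces an adjacent pair
among the picks. The picks have at most `2 ^ M` subsets. -/
theorem ex_removedSafe_le {z : PMF ℕ} (hz : z.support.Finite) {c : ℝ}
    (h : Spread a (maxSize hz) κ S) :
    ex (step z c a S) (removedSafe H O S) ≤
      2 ^ maxSize hz * (maxSize hz * κ) ^ 2 * prAdjOff a O H S := by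
  set M := maxSize hz with hM
  have ha := h.nonneg
  have hκ := h.one_le
  have hV := h.card_lt
  have hd0 := prAdjOff_nonneg ha O H S
  let g : ℕ → Finset ℕ → ℝ := fun m A => 2 ^ M * ∑ u ∈ A, ∑ v ∈ A, adjOff O H S u v
  have h1 := ex_step_mono (c := c) (S := S) hz ha
    (fun m hm => (le_maxSize hz hm).trans hV.le)
    (f := removedSafe H O S) (g := g) (by
      intro m hm A hA hAm
      simp only [g, removedSafe]
      set G := A ∪ freshVertices S (newCount c S m) with hG
      have hmM : m ≤ M := le_maxSize hz hm
      have hadj : 0 ≤ ∑ u ∈ A, ∑ v ∈ A, adjOff O H S u v := Finset.sum_nonneg fun u _ =>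
        Finset.sum_nonneg fun v _ => adjOff_nonneg O H S u v
      have hsub : ∀ F ∈ S \ addFacet S G, F ⊆ A := fun F hF => by
        have h2 := Finset.mem_filter.1 (sdiff_addFacet_subset S G hF)
        rw [← union_freshVertices_inter hA (newCount c S m)]
        exact Finset.subset_inter h2.2 (subset_vertices h2.1)
      rcases ((S \ addFacet S G).filter fun F => ¬ F ⊆ O ∧ 2 ≤ (F \ H).card).eq_empty_or_nonempty
        with he | ⟨F, hF⟩
      · rw [he, Finset.card_empty, Nat.cast_zero]
        positivity
      · rw [Finset.mem_filter] at hF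
        have h3 := one_le_sum_adjOff (Finset.mem_sdiff.1 hF.1).1 subset_rfl (hsub F hF.1)
          hF.2.1 hF.2.2
        have h4 : ((S \ addFacet S G).filter fun F => ¬ F ⊆ O ∧ 2 ≤ (F \ H).card).card ≤ 2 ^ M := by
          refine (Finset.card_le_card (t := A.powerset) fun F hF => ?_).trans ?_
          · exact Finset.mem_powerset.2 (hsub F (Finset.mem_filter.1 hF).1)
          · rw [Finset.card_powerset]
            exact Nat.pow_le_pow_right (by norm_num) (by omega)
        have h5 : (((S \ addFacet S G).filter fun F => ¬ F ⊆ O ∧ 2 ≤ (F \ H).card).card : ℝ) ≤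
            2 ^ M := by exact_mod_cast h4
        have h6 : (2 : ℝ) ^ M * 1 ≤ 2 ^ M * ∑ u ∈ A, ∑ v ∈ A, adjOff O H S u v :=
          mul_le_mul_of_nonneg_left h3 (by positivity)
        linarith)
  refine h1.trans (ex_le_const hz fun m hm => ?_)
  have hmM : m - newCount c S m ≤ M := (Nat.sub_le _ _).trans (le_maxSize hz hm)
  have hmM' : ((m - newCount c S m : ℕ) : ℝ) ≤ M := by exact_mod_cast hmM
  simp only [g]
  rw [ex_mul_left, mul_assoc]
  refine mul_le_mul_of_nonneg_left ?_ (by positivity)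
  have h3 := h.ex_picks_pairs_le hmM (adjOff_nonneg O H S) (adjOff_self O H S)
  change _ ≤ (((m - newCount c S m : ℕ) : ℝ) * κ) ^ 2 * prAdjOff a O H S at h3
  exact h3.trans (by gcongr)

end Excess

end GeneSCs

/-! ### Truncated quadratic potentials -/

namespace GeneSCs

/-- A function of the weight that is quadratic up to `k` and linear afterwards. -/
noncomputable def psi (k w : ℝ) : ℝ := min (w ^ 2 / k) w

section Psi

variable {k w : ℝ}

theorem psi_zero (k : ℝ) : psi k 0 = 0 := by simp [psi]

theorem psi_le_self (k w : ℝ) : psi k w ≤ w := min_le_right _ _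

theorem psi_nonneg (hk : 1 ≤ k) (hw : 0 ≤ w) : 0 ≤ psi k w :=
  le_min (by positivity) hw

theorem psi_mono (hk : 1 ≤ k) {w' : ℝ} (hw : 0 ≤ w) (h : w ≤ w') : psi k w ≤ psi k w' :=
  min_le_min (by gcongr) h

/-- The quadratic part yields `(2 * w + 1) / k ≤ 3 * w / k` and the linear part at most one. A bound
proportional to `psi k w / w` is what preferential attachment needs: weighting it by `pr` gives the
potential divided by the total weight. -/
theorem psi_add_one_sub_le (hk : 1 ≤ k) (hw : 1 ≤ w) :
    psi k (w + 1) - psi k w ≤ 3 * (psi k w / w) := by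
  have hk0 : 0 < k := by linarith
  have hw0 : 0 < w := by linarith
  rcases le_total w k with h | h
  · have h1 : psi k w = w ^ 2 / k := min_eq_left (by rw [div_le_iff₀ hk0]; nlinarith)
    have h2 : psi k (w + 1) ≤ (w + 1) ^ 2 / k := min_le_left _ _
    have h3 : 3 * (w ^ 2 / k / w) = 3 * w / k := by field_simp
    rw [h1, h3]
    have h4 : (w + 1) ^ 2 / k - w ^ 2 / k ≤ 3 * w / k := by
      rw [← sub_div]
      gcongr
      nlinarith
    linarith
  · have h1 : psi k w = w := min_eq_right (by rw [le_div_iff₀ hk0]; nlinarith)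
    rw [h1, div_self hw0.ne']
    linarith [psi_le_self k (w + 1)]

theorem psi_div_le_one (hw : 0 ≤ w) : psi k w / w ≤ 1 := div_le_one_of_le₀ (psi_le_self k w) hw

end Psi

/-- The sum of `psi k` over the vertex weights, where `v` is counted `χ v` times. -/
noncomputable def potential (a : ℝ) (χ : ℕ → ℝ) (k : ℝ) (S : Facets) : ℝ :=
  ∑ v ∈ vertices S, χ v * psi k (wt a S v)

/-- The sum of the positive increments of the terms of the potential. -/
noncomputable def potentialGain (a : ℝ) (χ : ℕ → ℝ) (k : ℝ) (S S' : Facets) : ℝ :=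
  ∑ v ∈ vertices S', χ v * max (psi k (wt a S' v) - psi k (wt a S v)) 0

section Potential

variable {a : ℝ} {χ : ℕ → ℝ} {k : ℝ} {S : Facets}

theorem wt_of_notMem {v : ℕ} (hv : v ∉ vertices S) : wt a S v = 0 := if_neg hv

theorem potential_nonneg (ha : 0 ≤ a) (hχ : ∀ v, 0 ≤ χ v) (hk : 1 ≤ k) :
    0 ≤ potential a χ k S :=
  Finset.sum_nonneg fun v _ => mul_nonneg (hχ v) (psi_nonneg hk (wt_nonneg ha v))

theorem potentialGain_nonneg (hχ : ∀ v, 0 ≤ χ v) (S S' : Facets) :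
    0 ≤ potentialGain a χ k S S' :=
  Finset.sum_nonneg fun v _ => mul_nonneg (hχ v) (le_max_right _ _)

theorem potential_le_add_gain (hχ : ∀ v, 0 ≤ χ v) {S' : Facets}
    (h : vertices S ⊆ vertices S') :
    potential a χ k S' ≤ potential a χ k S + potentialGain a χ k S S' := by
  have h1 : potential a χ k S = ∑ v ∈ vertices S', χ v * psi k (wt a S v) :=
    Finset.sum_subset h fun v _ hv => by rw [wt_of_notMem hv, psi_zero, mul_zero]
  rw [h1, potentialGain, ← Finset.sum_add_distrib]
  refine Finset.sum_le_sum fun v _ => ?_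
  rw [← mul_add]
  refine mul_le_mul_of_nonneg_left ?_ (hχ v)
  linarith [le_max_left (psi k (wt a S' v) - psi k (wt a S v)) 0]

theorem potentialGain_addFacet_le (ha : 0 ≤ a) (hχ : ∀ v, 0 ≤ χ v) (hk : 1 ≤ k) (G : Finset ℕ) :
    potentialGain a χ k S (addFacet S G) ≤
      ∑ v ∈ G ∩ vertices S, χ v * (3 * (psi k (wt a S v) / wt a S v)) +
        ∑ v ∈ G \ vertices S, χ v * psi k (1 + a) := by
  have hV : vertices (addFacet S G) = (vertices S \ G) ∪ G := by
    rw [vertices_addFacet, Finset.sdiff_union_self_eq_union]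
  rw [potentialGain, hV, Finset.sum_union Finset.sdiff_disjoint,
    ← Finset.sum_inter_add_sum_sdiff G (vertices S)]
  have hmem : ∀ v, v ∈ G → v ∈ vertices (addFacet S G) := fun v hv => by
    rw [hV]; exact Finset.mem_union_right _ hv
  have h0 : ∑ v ∈ vertices S \ G,
      χ v * max (psi k (wt a (addFacet S G) v) - psi k (wt a S v)) 0 ≤ 0 := by
    refine Finset.sum_nonpos fun v hv => ?_
    rw [Finset.mem_sdiff] at hv
    have h1 : wt a (addFacet S G) v = wt a S v := by
      rw [wt_of_mem hv.1, wt_of_mem (by rw [vertices_addFacet]; exact Finset.mem_union_left _ hv.1),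
        facetDegree_addFacet_of_notMem hv.2]
    rw [h1, sub_self, max_self, mul_zero]
  have h1 : ∑ v ∈ G ∩ vertices S,
      χ v * max (psi k (wt a (addFacet S G) v) - psi k (wt a S v)) 0 ≤
      ∑ v ∈ G ∩ vertices S, χ v * (3 * (psi k (wt a S v) / wt a S v)) := by
    refine Finset.sum_le_sum fun v hv => mul_le_mul_of_nonneg_left ?_ (hχ v)
    rw [Finset.mem_inter] at hv
    have hw := one_le_wt ha hv.2
    have hw' : wt a (addFacet S G) v ≤ wt a S v + 1 := by
      rw [wt_of_mem hv.2, wt_of_mem (hmem v hv.1)]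
      have : (facetDegree (addFacet S G) v : ℝ) ≤ facetDegree S v + 1 := by
        exact_mod_cast facetDegree_addFacet_le (S := S) (G := G) v
      linarith
    refine max_le ?_ ?_
    · exact le_trans (sub_le_sub_right (psi_mono hk (wt_nonneg ha v) hw') _)
        (psi_add_one_sub_le hk hw)
    · exact mul_nonneg (by norm_num) (div_nonneg (psi_nonneg hk (by linarith)) (by linarith))
  have h2 : ∑ v ∈ G \ vertices S,
      χ v * max (psi k (wt a (addFacet S G) v) - psi k (wt a S v)) 0 ≤
      ∑ v ∈ G \ vertices S, χ v * psi k (1 + a) := by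
    refine Finset.sum_le_sum fun v hv => mul_le_mul_of_nonneg_left ?_ (hχ v)
    rw [Finset.mem_sdiff] at hv
    have hw' : wt a (addFacet S G) v ≤ 1 + a := by
      rw [wt_of_mem (hmem v hv.1)]
      have h3 : (facetDegree (addFacet S G) v : ℝ) ≤ facetDegree S v + 1 := by
        exact_mod_cast facetDegree_addFacet_le (S := S) (G := G) v
      rw [facetDegree_eq_zero hv.2] at h3
      push_cast at h3
      linarith
    rw [wt_of_notMem hv.2, psi_zero, sub_zero]
    exact max_le (psi_mono hk (wt_nonneg ha v) hw') (psi_nonneg hk (by linarith))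
  linarith

/-- The linear tail of `psi` keeps the gain per step bounded, as the laws of large numbers require;
sums of squared weights would not have this property. -/
theorem potentialGain_le {z : PMF ℕ} (hz : z.support.Finite) {c : ℝ} (ha : 0 ≤ a)
    (hχ : ∀ v, 0 ≤ χ v) (hχ1 : ∀ v, χ v ≤ 1) (hk : 1 ≤ k) {S' : Facets}
    (hS' : S' ∈ (step z c a S).support) :
    |potentialGain a χ k S S'| ≤ maxSize hz * (4 + a) := by
  rw [abs_of_nonneg (potentialGain_nonneg hχ S S')]
  obtain ⟨G, hG, _, rfl⟩ := mem_support_step hS'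
  refine (potentialGain_addFacet_le ha hχ hk G).trans ?_
  have h1 : ∑ v ∈ G ∩ vertices S, χ v * (3 * (psi k (wt a S v) / wt a S v)) ≤
      ∑ v ∈ G ∩ vertices S, (4 + a) := Finset.sum_le_sum fun v _ => by
    have h2 : psi k (wt a S v) / wt a S v ≤ 1 := psi_div_le_one (wt_nonneg ha v)
    have h3 : 0 ≤ psi k (wt a S v) / wt a S v :=
      div_nonneg (psi_nonneg hk (wt_nonneg ha v)) (wt_nonneg ha v)
    nlinarith [hχ v, hχ1 v]
  have h2 : ∑ v ∈ G \ vertices S, χ v * psi k (1 + a) ≤ ∑ v ∈ G \ vertices S, (4 + a) :=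
    Finset.sum_le_sum fun v _ => by
      have h2 := psi_le_self k (1 + a)
      have h3 : 0 ≤ psi k (1 + a) := psi_nonneg hk (by linarith)
      nlinarith [hχ v, hχ1 v]
  have h3 := Finset.sum_inter_add_sum_sdiff G (vertices S) fun _ => 4 + a
  rw [Finset.sum_const (s := G), nsmul_eq_mul] at h3
  have h4 : (G.card : ℝ) ≤ maxSize hz := by exact_mod_cast le_maxSize hz hG
  nlinarith

/-- The expected gain on old vertices is proportional to the potential itself, divided by the total
weight; `β` accounts for each newborn vertex. -/
theorem ex_potentialGain_le {z : PMF ℕ} (hz : z.support.Finite) {c κ : ℝ}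
    (h : Spread a (maxSize hz) κ S) (hχ : ∀ v, 0 ≤ χ v) (hk : 1 ≤ k) {β : ℝ} (hβ0 : 0 ≤ β)
    (hβ : ∀ v, v ∉ vertices S → χ v * psi k (1 + a) ≤ β) :
    ex (step z c a S) (potentialGain a χ k S) ≤
      3 * maxSize hz * κ * potential a χ k S / totalWt a S + maxSize hz * β := by
  set M := maxSize hz with hM
  have ha := h.nonneg
  have hκ := h.one_le
  have hV := h.card_lt
  have hT := h.totalWt_pos
  have hpot := potential_nonneg (S := S) ha hχ hk
  let g : ℕ → Finset ℕ → ℝ := fun m A =>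
    ∑ v ∈ A, χ v * (3 * (psi k (wt a S v) / wt a S v)) + M * β
  have hg0 : ∀ v, 0 ≤ χ v * (3 * (psi k (wt a S v) / wt a S v)) := fun v =>
    mul_nonneg (hχ v) (mul_nonneg (by norm_num)
      (div_nonneg (psi_nonneg hk (wt_nonneg ha v)) (wt_nonneg ha v)))
  refine (ex_step_mono (c := c) (S := S) hz ha
    (fun m hm => (le_maxSize hz hm).trans hV.le)
    (f := potentialGain a χ k S) (g := g) ?_).trans (ex_le_const hz fun m hm => ?_)
  · intro m hm A hA hAm
    refine (potentialGain_addFacet_le ha hχ hk _).trans ?_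
    rw [union_freshVertices_inter hA, union_freshVertices_sdiff hA]
    simp only [g]
    refine add_le_add_right ?_ _
    have h1 : ∑ v ∈ freshVertices S (newCount c S m), χ v * psi k (1 + a) ≤
        ∑ v ∈ freshVertices S (newCount c S m), β := Finset.sum_le_sum fun v hv =>
      hβ v fun hh => notMem_freshVertices hh hv
    rw [Finset.sum_const, card_freshVertices, nsmul_eq_mul] at h1
    have h2 : (newCount c S m : ℝ) ≤ M := by
      exact_mod_cast (newCount_le c S m).trans (le_maxSize hz hm)
    exact h1.trans (mul_le_mul_of_nonneg_right h2 hβ0)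
  · have hmM : m - newCount c S m ≤ M := (Nat.sub_le _ _).trans (le_maxSize hz hm)
    have hmM' : ((m - newCount c S m : ℕ) : ℝ) ≤ M := by exact_mod_cast hmM
    simp only [g]
    rw [ex_add (finite_support_picks S _), ex_const (finite_support_picks S _)]
    refine add_le_add_left ?_ _
    refine (h.ex_picks_sum_le hmM hg0).trans ?_
    have e : ∑ v ∈ vertices S, pr a S v * (χ v * (3 * (psi k (wt a S v) / wt a S v))) =
        3 * (potential a χ k S / totalWt a S) := by
      rw [potential, Finset.sum_div, Finset.mul_sum]
      refine Finset.sum_congr rfl fun v hv => ?_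
      have := one_le_wt ha hv
      have h0 : wt a S v ≠ 0 := by linarith
      rw [pr]
      field_simp
    rw [e]
    have h1 : ((m - newCount c S m : ℕ) : ℝ) * κ * (3 * (potential a χ k S / totalWt a S)) ≤
        M * κ * (3 * (potential a χ k S / totalWt a S)) := by gcongr
    refine h1.trans (le_of_eq ?_)
    ring

end Potential

/-- Discrete Grönwall inequality. -/
theorem le_mul_one_add_pow_of_le_sum {y : ℕ → ℝ} {A r : ℝ} (hr : 0 ≤ r) {n₀ N : ℕ}
    (h : ∀ n, n₀ ≤ n → n ≤ N → y n ≤ A + r * ∑ i ∈ Finset.Ico n₀ n, y i) {n : ℕ} (hn : n₀ ≤ n)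
    (hnN : n ≤ N) : y n ≤ A * (1 + r) ^ (n - n₀) := by
  refine (h n hn hnN).trans ?_
  induction n, hn using Nat.le_induction with
  | base => simp
  | succ n hn ih =>
    have h1 := ih (by omega)
    have h2 := h n hn (by omega)
    rw [Finset.sum_Ico_succ_top hn, show n + 1 - n₀ = (n - n₀) + 1 by omega, pow_succ]
    nlinarith

/-- The sums of the centred increments of `f` are small compared with the initial time, uniformly
in time windows. -/
def Controlled (z : PMF ℕ) (c a : ℝ) (x : ℕ → Facets) (f : Facets → Facets → Facets → ℝ) : Prop :=
  ∀ δ : ℝ, 0 < δ → ∀ K : ℕ, ∀ᶠ n₀ : ℕ in atTop, ∀ n, n₀ ≤ n → n ≤ K * n₀ →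
    |centredSum z c a f x n₀ n| ≤ δ * n₀

/-- A path of bounded facet sizes whose numbers of vertices and facets grow linearly. -/
structure IsRegular {z : PMF ℕ} (hz : z.support.Finite) (c a : ℝ) (x : ℕ → Facets) (η C κ : ℝ)
    (b : ℕ) : Prop where
  isPath : IsPath z c x
  pos : 0 < η
  pos' : 0 < C
  facet_card_le : ∀ n, ∀ F ∈ x n, F.card ≤ b
  le_card : ∀ᶠ n : ℕ in atTop, η * n ≤ (vertices (x n)).card
  totalWt_le : ∀ᶠ n : ℕ in atTop, totalWt a (x n) ≤ C * n
  spread : ∀ᶠ n : ℕ in atTop, Spread a (maxSize hz) κ (x n)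

theorem card_le_totalWt {a : ℝ} (ha : 0 ≤ a) (S : Facets) :
    ((vertices S).card : ℝ) ≤ totalWt a S := card_le_sum_wt ha subset_rfl

namespace IsRegular

variable {z : PMF ℕ} {hz : z.support.Finite} {c a : ℝ} {x : ℕ → Facets} {η C κ : ℝ} {b : ℕ}

/-- A window has at most `L * n₀` steps, each with relative growth of order `1 / n₀`, so Grönwall
gives a constant factor. The order of quantifiers matters: `B` is chosen before the weights `χ`, the
scale `k` and the accuracy `δ`, so these can be adapted to it. -/
theorem exists_potential_le (h : IsRegular hz c a x η C κ b) (ha : 0 ≤ a) (L : ℕ) :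
    ∃ B : ℝ, 0 < B ∧ ∀ (χ : Facets → ℕ → ℝ) (k β : Facets → ℝ), (∀ S v, 0 ≤ χ S v) →
      (∀ S, 1 ≤ k S) → (∀ S, 0 ≤ β S) →
      (∀ S, ∀ v, v ∉ vertices S → χ S v * psi (k S) (1 + a) ≤ β S) →
      Controlled z c a x (fun R => potentialGain a (χ R) (k R)) →
      ∀ δ : ℝ, 0 < δ → ∀ᶠ n₀ : ℕ in atTop, ∀ n, n₀ ≤ n → n ≤ L * n₀ →
        potential a (χ (x n₀)) (k (x n₀)) (x n) ≤
          B * (potential a (χ (x n₀)) (k (x n₀)) (x n₀) + β (x n₀) * n₀ + δ * n₀) := by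
  set M := maxSize hz with hM
  have hη := h.pos
  refine ⟨Real.exp (3 * M * κ * L / η) * (M * L + 1), by positivity, ?_⟩
  intro χ k β hχ hk hβ0 hβ hctl δ hδ
  filter_upwards [hctl δ hδ L, eventually_forall_ge_atTop.2 h.le_card,
    eventually_forall_ge_atTop.2 h.spread, eventually_gt_atTop 0] with n₀ h1 h2 h3 hn₀ n hn hnL
  have hn₀' : (0 : ℝ) < n₀ := by exact_mod_cast hn₀
  have hκ := (h3 n₀ le_rfl).one_le
  set R := x n₀ with hR
  set P : ℕ → ℝ := fun i => potential a (χ R) (k R) (x i) with hP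
  have hP0 : ∀ i, 0 ≤ P i := fun i => potential_nonneg ha (hχ R) (hk R)
  have hδn : 0 ≤ δ * n₀ := by positivity
  have hβn : 0 ≤ β R * n₀ := mul_nonneg (hβ0 R) hn₀'.le
  set A := P n₀ + M * L * (β R * n₀) + δ * n₀ with hA
  have hA0 : 0 ≤ A := by
    have := hP0 n₀
    positivity
  set r : ℝ := 3 * M * κ / (η * n₀) with hr
  have hr0 : 0 ≤ r := by positivity
  have key : ∀ m, n₀ ≤ m → m ≤ L * n₀ → P m ≤ A + r * ∑ i ∈ Finset.Ico n₀ m, P i := by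
    intro m hm hmL
    have e1 : P m ≤ P n₀ +
        ∑ i ∈ Finset.Ico n₀ m, potentialGain a (χ R) (k R) (x i) (x (i + 1)) := by
      clear hmL
      induction m, hm using Nat.le_induction with
      | base => simp
      | succ m hm ih =>
        rw [Finset.sum_Ico_succ_top hm]
        have := potential_le_add_gain (a := a) (k := k R) (hχ R) (h.isPath.vertices_subset_succ m)
        simp only [hP] at ih ⊢
        linarith
    have e2 := (abs_le.1 (h1 m hm hmL)).2
    rw [centredSum, Finset.sum_sub_distrib] at e2
    have e3 : ∑ i ∈ Finset.Ico n₀ m, ex (step z c a (x i)) (potentialGain a (χ R) (k R) (x i)) ≤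
        ∑ i ∈ Finset.Ico n₀ m, (r * P i + M * β R) := by
      refine Finset.sum_le_sum fun i hi => ?_
      rw [Finset.mem_Ico] at hi
      have hS := h3 i hi.1
      have hβi : ∀ v, v ∉ vertices (x i) → χ R v * psi (k R) (1 + a) ≤ β R := fun v hv =>
        hβ R v fun hv' => hv (h.isPath.vertices_mono hi.1 hv')
      refine (ex_potentialGain_le hz hS (hχ R) (hk R) (hβ0 R) hβi).trans ?_
      refine add_le_add_left ?_ _
      have hT : η * n₀ ≤ totalWt a (x i) := by
        refine le_trans ?_ ((h2 i hi.1).trans (card_le_totalWt ha _))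
        have : (n₀ : ℝ) ≤ i := by exact_mod_cast hi.1
        gcongr
      rw [hr, div_mul_eq_mul_div]
      have := hP0 i
      gcongr
    rw [Finset.sum_add_distrib, ← Finset.mul_sum, Finset.sum_const, Nat.card_Ico,
      nsmul_eq_mul] at e3
    have e4 : ((m - n₀ : ℕ) : ℝ) * (M * β R) ≤ M * L * (β R * n₀) := by
      have : ((m - n₀ : ℕ) : ℝ) ≤ L * n₀ := by exact_mod_cast (Nat.sub_le _ _).trans hmL
      have := mul_le_mul_of_nonneg_right this
        (mul_nonneg (M.cast_nonneg (α := ℝ)) (hβ0 R))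
      linarith
    linarith
  have hfin := le_mul_one_add_pow_of_le_sum hr0 key hn hnL
  have hpow : (1 + r) ^ (n - n₀) ≤ Real.exp (3 * M * κ * L / η) := by
    have h4 : (1 + r) ^ (n - n₀) ≤ Real.exp r ^ (n - n₀) := by
      refine pow_le_pow_left₀ (by positivity) ?_ _
      linarith [Real.add_one_le_exp r]
    rw [← Real.exp_nat_mul] at h4
    refine h4.trans (Real.exp_le_exp.2 ?_)
    have h5 : ((n - n₀ : ℕ) : ℝ) ≤ L * n₀ := by exact_mod_cast (Nat.sub_le _ _).trans hnL
    refine (mul_le_mul_of_nonneg_right h5 hr0).trans (le_of_eq ?_)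
    rw [hr]
    field_simp
  refine hfin.trans ((mul_le_mul_of_nonneg_left hpow hA0).trans ?_)
  rw [mul_comm A, mul_assoc (Real.exp _)]
  refine mul_le_mul_of_nonneg_left ?_ (Real.exp_pos _).le
  have h6 : 0 ≤ (M : ℝ) * L := by positivity
  have h7 := mul_nonneg h6 (hP0 n₀)
  have h8 := mul_nonneg h6 hδn
  change A ≤ (M * L + 1) * (P n₀ + β R * n₀ + δ * n₀)
  rw [hA]
  linarith

end IsRegular

end GeneSCs

/-! ### Heavy and notable vertices -/

namespace GeneSCs

/-- The vertices that are picked first with probability at least `1 / E`. -/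
noncomputable def heavy (a : ℝ) (E : ℕ) (S : Facets) : Finset ℕ :=
  (vertices S).filter fun v => 1 ≤ (E : ℝ) * pr a S v

/-- The vertices that are picked first with probability at least `1 / E` or have weight larger
than `K`. -/
noncomputable def notable (a : ℝ) (K E : ℕ) (S : Facets) : Finset ℕ :=
  (vertices S).filter fun v => 1 ≤ (E : ℝ) * pr a S v ∨ (K : ℝ) < wt a S v

/-- The indicator function of the vertices that are in `heavy a E' S`, but not in `heavy a E S`. -/
noncomputable def mid (a : ℝ) (E E' : ℕ) (S : Facets) (v : ℕ) : ℝ :=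
  off (heavy a E S) v * (1 - off (heavy a E' S) v)

section Heavy

variable {a : ℝ} {S : Facets}

theorem off_of_mem {B : Finset ℕ} {v : ℕ} (h : v ∈ B) : off B v = 0 := if_pos h

theorem off_of_notMem {B : Finset ℕ} {v : ℕ} (h : v ∉ B) : off B v = 1 := if_neg h

theorem heavy_mono (ha : 0 ≤ a) {E E' : ℕ} (h : E ≤ E') (S : Facets) :
    heavy a E S ⊆ heavy a E' S := by
  intro v hv
  rw [heavy, Finset.mem_filter] at hv ⊢
  refine ⟨hv.1, hv.2.trans ?_⟩
  have : (E : ℝ) ≤ E' := by exact_mod_cast h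
  exact mul_le_mul_of_nonneg_right this (pr_nonneg ha v)

theorem heavy_subset_notable (a : ℝ) (K E : ℕ) (S : Facets) : heavy a E S ⊆ notable a K E S := by
  intro v hv
  rw [heavy, Finset.mem_filter] at hv
  exact Finset.mem_filter.2 ⟨hv.1, Or.inl hv.2⟩

theorem notable_subset (a : ℝ) (K E : ℕ) (S : Facets) : notable a K E S ⊆ vertices S :=
  Finset.filter_subset _ _

theorem sum_pr_le_one (a : ℝ) (S : Facets) : ∑ v ∈ vertices S, pr a S v ≤ 1 := by
  by_cases h : totalWt a S = 0
  · simp [pr, h]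
  · exact (sum_pr h).le

theorem card_heavy_le (ha : 0 ≤ a) (E : ℕ) (S : Facets) : (heavy a E S).card ≤ E := by
  have h1 : ((heavy a E S).card : ℝ) ≤ ∑ v ∈ heavy a E S, E * pr a S v := by
    rw [← mul_one ((heavy a E S).card : ℝ), ← nsmul_eq_mul]
    exact Finset.card_nsmul_le_sum _ _ _ fun v hv => (Finset.mem_filter.1 hv).2
  have h2 : ∑ v ∈ heavy a E S, E * pr a S v ≤ ∑ v ∈ vertices S, E * pr a S v :=
    Finset.sum_le_sum_of_subset_of_nonneg (Finset.filter_subset _ _) fun v _ _ =>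
      mul_nonneg (Nat.cast_nonneg _) (pr_nonneg ha v)
  rw [← Finset.mul_sum] at h1
  rw [← Finset.mul_sum, ← Finset.mul_sum] at h2
  have h3 := mul_le_mul_of_nonneg_left (sum_pr_le_one a S) (Nat.cast_nonneg (α := ℝ) E)
  have : ((heavy a E S).card : ℝ) ≤ E := by linarith
  exact_mod_cast this

theorem card_notable_le (ha : 0 ≤ a) {K : ℕ} (hK : 0 < K) (E : ℕ) (S : Facets) :
    ((notable a K E S).card : ℝ) ≤ E + totalWt a S / K := by
  have hK' : (0 : ℝ) < K := by exact_mod_cast hK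
  rw [notable, Finset.filter_or]
  have h1 : (((vertices S).filter fun v => (K : ℝ) < wt a S v).card : ℝ) ≤ totalWt a S / K := by
    rw [le_div_iff₀ hK', ← nsmul_eq_mul]
    refine (Finset.card_nsmul_le_sum _ _ _ fun v hv => (Finset.mem_filter.1 hv).2.le).trans ?_
    exact Finset.sum_le_sum_of_subset_of_nonneg (Finset.filter_subset _ _) fun v _ _ =>
      wt_nonneg ha v
  have h2 : ((heavy a E S).card : ℝ) ≤ E := by exact_mod_cast card_heavy_le ha E S
  have h3 : ((heavy a E S ∪ (vertices S).filter fun v => (K : ℝ) < wt a S v).card : ℝ) ≤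
      (heavy a E S).card + ((vertices S).filter fun v => (K : ℝ) < wt a S v).card := by
    exact_mod_cast Finset.card_union_le _ _
  exact h3.trans (add_le_add h2 h1)

theorem mid_nonneg (a : ℝ) (E E' : ℕ) (S : Facets) (v : ℕ) : 0 ≤ mid a E E' S v :=
  mul_nonneg (off_nonneg _ v) (sub_nonneg.2 (off_le_one _ v))

theorem mid_le_one (a : ℝ) (E E' : ℕ) (S : Facets) (v : ℕ) : mid a E E' S v ≤ 1 :=
  mul_le_one₀ (off_le_one _ v) (sub_nonneg.2 (off_le_one _ v)) (by linarith [off_nonneg (heavy a E' S) v])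

theorem mid_eq (ha : 0 ≤ a) {E E' : ℕ} (h : E ≤ E') (S : Facets) (v : ℕ) :
    mid a E E' S v = off (heavy a E S) v - off (heavy a E' S) v := by
  unfold mid
  by_cases h1 : v ∈ heavy a E S
  · rw [off_of_mem h1, off_of_mem (heavy_mono ha h S h1)]
    simp
  · rw [off_of_notMem h1]
    simp

theorem mid_of_notMem {E E' : ℕ} {v : ℕ} (hv : v ∉ vertices S) : mid a E E' S v = 0 := by
  have : v ∉ heavy a E' S := fun h => hv (Finset.mem_filter.1 h).1
  rw [mid, off_of_notMem this, sub_self, mul_zero]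

/-- Pigeonhole: the layers between consecutive levels are disjoint and their shares sum to at most
one. -/
theorem exists_mid_le (ha : 0 ≤ a) {E : ℕ → ℕ} (hE : Monotone E) {J : ℕ} (hJ : 0 < J) (S : Facets) :
    ∃ j < J, ∑ v ∈ vertices S, mid a (E j) (E (j + 1)) S v * pr a S v ≤ 1 / J := by
  by_contra hcon
  push Not at hcon
  have hJ' : (0 : ℝ) < J := by exact_mod_cast hJ
  have h1 : ∑ j ∈ Finset.range J, (1 / (J : ℝ)) <
      ∑ j ∈ Finset.range J, ∑ v ∈ vertices S, mid a (E j) (E (j + 1)) S v * pr a S v :=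
    Finset.sum_lt_sum_of_nonempty (Finset.nonempty_range_iff.2 hJ.ne') fun j hj =>
      hcon j (Finset.mem_range.1 hj)
  rw [Finset.sum_const, Finset.card_range, nsmul_eq_mul, mul_one_div_cancel hJ'.ne',
    Finset.sum_comm] at h1
  refine absurd (h1.trans_le ((Finset.sum_le_sum fun v _ => ?_).trans (sum_pr_le_one a S)))
    (lt_irrefl _)
  rw [← Finset.sum_mul]
  refine mul_le_of_le_one_left (pr_nonneg ha v) ?_
  rw [Finset.sum_congr rfl fun j _ => mid_eq ha (hE (Nat.le_succ j)) S v,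
    Finset.sum_range_sub' fun j => off (heavy a (E j) S) v]
  linarith [off_le_one (heavy a (E 0) S) v, off_nonneg (heavy a (E J) S) v]

open Classical in
theorem card_adj_le {b : ℕ} (hb : ∀ F ∈ S, F.card ≤ b) (v : ℕ) :
    ((vertices S).filter fun u => Adj S u v).card ≤ b * facetDegree S v := by
  have hsub : ((vertices S).filter fun u => Adj S u v) ⊆ (S.filter fun F => v ∈ F).biUnion id := by
    intro u hu
    obtain ⟨_, F, hF, h1, h2⟩ := Finset.mem_filter.1 hu
    exact Finset.mem_biUnion.2 ⟨F, Finset.mem_filter.2 ⟨hF, h2⟩, h1⟩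
  refine (Finset.card_le_card hsub).trans (Finset.card_biUnion_le.trans ?_)
  rw [facetDegree, mul_comm, ← smul_eq_mul]
  exact Finset.sum_le_card_nsmul _ _ _ fun F hF => hb F (Finset.mem_filter.1 hF).1

variable {H H' O : Finset ℕ} {k₁ k₂ B : ℝ}

theorem psi_one {w : ℝ} (hw : 1 ≤ w) : psi 1 w = w :=
  min_eq_right (by rw [div_one]; nlinarith)

/-- On the quadratic branch of `psi`, the scale `k₂` is at most a multiple of the total weight; on
the linear branch, `pr² ≤ pr`. -/
theorem sq_pr_le (ha : 0 ≤ a) (hT : 0 < totalWt a S) (hk : 1 ≤ k₂) (hB : 1 ≤ B)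
    (hkB : k₂ ≤ B * totalWt a S) {v : ℕ} :
    pr a S v ^ 2 ≤ B * (psi k₂ (wt a S v) / totalWt a S) := by
  set T := totalWt a S
  have hw := wt_nonneg (S := S) ha v
  have hk0 : 0 < k₂ := by linarith
  have hpr1 := pr_le_one (S := S) ha v
  have hpr0 := pr_nonneg (S := S) ha v
  rw [psi]
  rcases min_choice (wt a S v ^ 2 / k₂) (wt a S v) with h | h <;> rw [h]
  · rw [pr, div_pow, div_div, mul_div_assoc', div_le_div_iff₀ (by positivity) (by positivity)]
    have := mul_le_mul_of_nonneg_left hkB (show 0 ≤ wt a S v ^ 2 * T by positivity)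
    linarith
  · change pr a S v ^ 2 ≤ B * pr a S v
    nlinarith

/-- Split the vertices off `H` by membership in `H'`: those in the layer contribute at most their
share, and for the others the squared share is controlled by the potential. -/
theorem collisionOff_le (ha : 0 ≤ a) (hT : 0 < totalWt a S) (hk : 1 ≤ k₂) (hB : 1 ≤ B)
    (hkB : k₂ ≤ B * totalWt a S) :
    collisionOff a H S ≤
      potential a (fun v => off H v * (1 - off H' v)) 1 S / totalWt a S +
        B * (potential a (off H') k₂ S / totalWt a S) := by
  rw [collisionOff, potential, potential, Finset.sum_div, Finset.sum_div, Finset.mul_sum,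
    ← Finset.sum_add_distrib]
  refine Finset.sum_le_sum fun v hv => ?_
  have hw := one_le_wt ha hv
  have hpr1 := pr_le_one (S := S) ha v
  have hpr0 := pr_nonneg (S := S) ha v
  have hpsi := sq_pr_le ha hT hk hB hkB (v := v)
  have hoff := off_nonneg H v
  have hoff1 := off_le_one H v
  rw [psi_one hw]
  by_cases hv' : v ∈ H'
  · rw [off_of_mem hv']
    have : off H v * (1 - 0) * wt a S v / totalWt a S = off H v * pr a S v := by
      rw [pr]; ring
    rw [this, zero_mul, zero_div, mul_zero, add_zero, mul_comm]
    gcongr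
    nlinarith
  · rw [off_of_notMem hv', sub_self, mul_zero, zero_mul, zero_div, zero_add, one_mul]
    nlinarith [sq_nonneg (pr a S v)]

theorem prAdjOff_le (ha : 0 ≤ a) (hT : 0 < totalWt a S) (hk : 1 ≤ k₂) (hB : 1 ≤ B)
    (hkB : k₂ ≤ B * totalWt a S) {b : ℕ} (hb : ∀ F ∈ S, F.card ≤ b) (hk₁ : 1 ≤ k₁) :
    prAdjOff a O H S ≤
      potential a (fun v => off H v * (1 - off H' v)) 1 S / totalWt a S +
        potential a (off O) k₁ S / totalWt a S +
        k₁ * b * B * (potential a (off H') k₂ S / totalWt a S) := by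
  classical
  set T := totalWt a S with hTdef
  have hp0 := fun v => pr_nonneg (S := S) ha v
  have hsum1 := sum_pr_le_one a S
  set I : ℕ → ℝ := fun v => off H v * (1 - off H' v) * pr a S v with hI
  set P : ℕ → ℝ := fun u => off O u * psi k₁ (wt a S u) / T with hP
  have hI0 : ∀ v, 0 ≤ I v := fun v =>
    mul_nonneg (mul_nonneg (off_nonneg H v) (sub_nonneg.2 (off_le_one _ v))) (hp0 v)
  have hP0 : ∀ v, 0 ≤ P v := fun v => div_nonneg
    (mul_nonneg (off_nonneg O v) (psi_nonneg hk₁ (wt_nonneg ha v))) hT.le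
  set D : ℕ → ℕ → ℝ := fun u v => if Adj S u v then off H' v * pr a S v * (k₁ / T) else 0 with hD
  have hD0 : ∀ u v, 0 ≤ D u v := fun u v => by
    simp only [hD]
    split_ifs
    · have := off_nonneg H' v
      have := hp0 v
      positivity
    · exact le_rfl
  -- For an adjacent pair, either `v` lies in the layer `H' \ H`, or `u` has weight at least `k₁`
  -- and is paid for by the potential off `O`, or `u` has share at most `k₁ / T`. In the last case
  -- the number of neighbours of `v` is at most `b` times its weight, so summing over `u` produces
  -- the squared share of `v`.
  have key : ∀ u ∈ vertices S, ∀ v ∈ vertices S, pr a S u * pr a S v * adjOff O H S u v ≤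
      pr a S u * I v + P u * pr a S v + D u v := by
    intro u hu v hv
    have n1 := mul_nonneg (hp0 u) (hI0 v)
    have n2 := mul_nonneg (hP0 u) (hp0 v)
    have n3 := hD0 u v
    unfold adjOff
    split_ifs with h
    · obtain ⟨_, huO, hvH, hadj⟩ := h
      rw [mul_one]
      by_cases hv' : v ∈ H'
      · have : I v = pr a S v := by
          simp only [hI]
          rw [off_of_notMem hvH, off_of_mem hv']
          ring
        rw [this]
        linarith
      · rcases le_total (wt a S u) k₁ with hw | hw
        · have : D u v = pr a S v * (k₁ / T) := by
            simp only [hD]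
            rw [if_pos hadj, off_of_notMem hv', one_mul]
          rw [this]
          have h1 : pr a S u ≤ k₁ / T := by
            rw [pr]
            gcongr
          have := mul_le_mul_of_nonneg_right h1 (hp0 v)
          linarith
        · have : P u = pr a S u := by
            simp only [hP]
            rw [off_of_notMem huO, one_mul, psi, min_eq_right, pr]
            rw [le_div_iff₀ (by linarith)]
            nlinarith [wt_nonneg (S := S) ha u]
          rw [this]
          linarith
    · rw [mul_zero]
      linarith
  have hIs : ∑ v ∈ vertices S, I v =
      potential a (fun v => off H v * (1 - off H' v)) 1 S / T := by
    rw [potential, Finset.sum_div]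
    refine Finset.sum_congr rfl fun v hv => ?_
    simp only [hI]
    rw [psi_one (one_le_wt ha hv), pr, mul_div_assoc]
  have hPs : ∑ v ∈ vertices S, P v = potential a (off O) k₁ S / T := by
    rw [potential, Finset.sum_div]
  have hDs : ∑ u ∈ vertices S, ∑ v ∈ vertices S, D u v ≤
      k₁ * b * B * (potential a (off H') k₂ S / T) := by
    rw [Finset.sum_comm, potential, Finset.sum_div, Finset.mul_sum]
    refine Finset.sum_le_sum fun v hv => ?_
    simp only [hD]
    rw [← Finset.sum_filter, Finset.sum_const, nsmul_eq_mul]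
    have h1 : (((vertices S).filter fun u => Adj S u v).card : ℝ) ≤ b * wt a S v := by
      have : (((vertices S).filter fun u => Adj S u v).card : ℝ) ≤ b * facetDegree S v := by
        exact_mod_cast card_adj_le hb v
      refine this.trans (mul_le_mul_of_nonneg_left ?_ (Nat.cast_nonneg _))
      rw [wt_of_mem hv]
      linarith
    have h2 := off_nonneg H' v
    have h3 := hp0 v
    have h4 : (((vertices S).filter fun u => Adj S u v).card : ℝ) *
        (off H' v * pr a S v * (k₁ / T)) ≤ b * wt a S v * (off H' v * pr a S v * (k₁ / T)) := by
      gcongr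
    refine h4.trans ?_
    have h5 : (b : ℝ) * wt a S v * (off H' v * pr a S v * (k₁ / T)) =
        k₁ * b * off H' v * pr a S v ^ 2 := by
      rw [pr]; ring
    rw [h5]
    have h6 := sq_pr_le ha hT hk hB hkB (v := v)
    calc _ ≤ k₁ * b * off H' v * (B * (psi k₂ (wt a S v) / T)) := by gcongr
      _ = _ := by ring
  calc prAdjOff a O H S ≤ ∑ u ∈ vertices S, ∑ v ∈ vertices S,
        (pr a S u * I v + P u * pr a S v + D u v) :=
        Finset.sum_le_sum fun u hu => Finset.sum_le_sum fun v hv => key u hu v hv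
    _ = (∑ u ∈ vertices S, pr a S u) * (∑ v ∈ vertices S, I v) +
        (∑ u ∈ vertices S, P u) * (∑ v ∈ vertices S, pr a S v) +
        ∑ u ∈ vertices S, ∑ v ∈ vertices S, D u v := by
      simp only [Finset.sum_add_distrib, Finset.sum_mul_sum]
    _ ≤ 1 * (∑ v ∈ vertices S, I v) + (∑ u ∈ vertices S, P u) * 1 +
        ∑ u ∈ vertices S, ∑ v ∈ vertices S, D u v := by
      gcongr
      · exact Finset.sum_nonneg fun v _ => hI0 v
      · exact Finset.sum_nonneg fun v _ => hP0 v
    _ ≤ _ := by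
      rw [one_mul, mul_one, hIs, hPs]
      linarith

end Heavy

section Initial

variable {a : ℝ} {S : Facets}

theorem potential_mid_le (ha : 0 ≤ a) (hT : 0 < totalWt a S) (E E' : ℕ) :
    potential a (mid a E E' S) 1 S ≤
      totalWt a S * ∑ v ∈ vertices S, mid a E E' S v * pr a S v := by
  rw [potential, Finset.mul_sum]
  refine Finset.sum_le_sum fun v hv => ?_
  rw [psi_one (one_le_wt ha hv), pr]
  refine le_of_eq ?_
  field_simp

/-- A vertex outside the heavy set has weight below `T / Q ^ 2`; at scale at least `T / Q` its term
is at most its weight divided by `Q`. -/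
theorem potential_light_le (ha : 0 ≤ a) (hT : 0 < totalWt a S) {Q : ℕ} (hQ : 0 < Q) :
    potential a (off (heavy a (Q ^ 2) S)) (max 1 (totalWt a S / Q)) S ≤ totalWt a S / Q := by
  have hQ' : (0 : ℝ) < Q := by exact_mod_cast hQ
  conv_rhs => rw [totalWt, Finset.sum_div]
  refine Finset.sum_le_sum fun v hv => ?_
  have hw := wt_nonneg (S := S) ha v
  by_cases h : v ∈ heavy a (Q ^ 2) S
  · rw [off_of_mem h, zero_mul]
    positivity
  · rw [off_of_notMem h, one_mul]
    have h1 : (Q : ℝ) ^ 2 * pr a S v < 1 := by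
      by_contra hcon
      push Not at hcon
      exact h (Finset.mem_filter.2 ⟨hv, by push_cast; exact hcon⟩)
    rw [pr, mul_div_assoc', div_lt_one hT] at h1
    refine (min_le_left _ _).trans ?_
    have h2 : wt a S v ^ 2 / max 1 (totalWt a S / Q) ≤ wt a S v ^ 2 / (totalWt a S / Q) := by
      gcongr
      exact le_max_right _ _
    refine h2.trans ?_
    rw [div_div_eq_mul_div, div_le_div_iff₀ hT hQ']
    nlinarith

theorem potential_off_notable_le (ha : 0 ≤ a) (K E : ℕ) {k : ℝ} (hk : 0 < k) :
    potential a (off (notable a K E S)) k S ≤ totalWt a S * K / k := by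
  rw [potential, totalWt, Finset.sum_mul, Finset.sum_div]
  refine Finset.sum_le_sum fun v hv => ?_
  have hw := wt_nonneg (S := S) ha v
  by_cases h : v ∈ notable a K E S
  · rw [off_of_mem h, zero_mul]
    positivity
  · rw [off_of_notMem h, one_mul]
    have h1 : wt a S v ≤ K := by
      by_contra hcon
      push Not at hcon
      exact h (Finset.mem_filter.2 ⟨hv, Or.inr hcon⟩)
    refine (min_le_left _ _).trans ?_
    gcongr
    nlinarith

end Initial

end GeneSCs

/-! ### Choice of levels -/

namespace GeneSCs

namespace IsRegular

variable {z : PMF ℕ} {hz : z.support.Finite} {c a : ℝ} {x : ℕ → Facets} {η C κ : ℝ} {b : ℕ}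

-- Three potentials control the rare events: the layer between the two levels, the light vertices at
-- a scale proportional to the total weight, and the vertices off the notable set at a constant
-- scale. The admissible layer mass `θ` is independent of the level `E`, which makes the pigeonhole
-- over levels possible.
set_option maxHeartbeats 1000000 in
theorem exists_level (h : IsRegular hz c a x η C κ b) (ha : 0 ≤ a) (L : ℕ)
    (hmid : ∀ E E' : ℕ, Controlled z c a x fun R => potentialGain a (mid a E E' R) 1)
    (hlight : ∀ Q : ℕ, Controlled z c a x fun R =>
      potentialGain a (off (heavy a (Q ^ 2) R)) (max 1 (totalWt a R / Q)))
    (hoff : ∀ K E k : ℕ, Controlled z c a x fun R =>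
      potentialGain a (off (notable a K E R)) ((k : ℝ) + 1)) {ε : ℝ} (hε : 0 < ε) :
    ∃ θ : ℝ, 0 < θ ∧ ∀ E : ℕ, ∃ K Q : ℕ, 0 < K ∧ E ≤ Q ^ 2 ∧ ∀ᶠ n₀ : ℕ in atTop,
      ∑ v ∈ vertices (x n₀), mid a E (Q ^ 2) (x n₀) v * pr a (x n₀) v ≤ θ →
      2 ^ E * ((Q : ℝ) ^ 2 + totalWt a (x n₀) / K + 1) ≤ ε * n₀ ∧
      ∀ n, n₀ ≤ n → n ≤ L * n₀ →
        collisionOff a (heavy a E (x n₀)) (x n) ≤ ε ∧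
        prAdjOff a (notable a K (Q ^ 2) (x n₀)) (heavy a E (x n₀)) (x n) ≤ ε := by
  obtain ⟨B, hB, hpot⟩ := h.exists_potential_le ha L
  have hη := h.pos
  have hC := h.pos'
  -- Within the window, the total weight at time `n₀` is at most `C / η` times any later total
  -- weight, and later total weights are at least one.
  set D : ℝ := 1 + C / η with hD
  have hD1 : 1 ≤ D := by
    have : 0 ≤ C / η := by positivity
    linarith
  set δ : ℝ := ε * η / (8 * B) with hδ
  have hδ0 : 0 < δ := by positivity
  refine ⟨δ / C, by positivity, fun E => ?_⟩
  -- `K` makes the set of vertices of weight above `K` small even after multiplication by `2 ^ E`.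
  -- Then `k` makes the potential off the notable set small, and only then is `Q` chosen, since the
  -- bound on adjacent pairs costs a factor `k' * b * D` on the potential of the light vertices.
  obtain ⟨K, hK⟩ := exists_nat_gt (2 * 2 ^ E * C / ε)
  have hK0 : (0 : ℝ) < K := lt_of_le_of_lt (by positivity) hK
  obtain ⟨k, hk⟩ := exists_nat_gt ((C * K + (1 + a) ^ 2) / δ)
  set k' : ℝ := (k : ℝ) + 1 with hk'
  have hk'0 : 0 < k' := by positivity
  have hk'1 : 1 ≤ k' := by
    have := k.cast_nonneg (α := ℝ)
    linarith
  have hkδ : (C * K + (1 + a) ^ 2) / k' ≤ δ := by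
    rw [div_lt_iff₀ hδ0] at hk
    rw [div_le_iff₀ hk'0]
    nlinarith
  set ω : ℝ := ε / (4 * (D + k' * b * D)) with hω
  have hω0 : 0 < ω := by positivity
  have hωD : (D + k' * b * D) * ω = ε / 4 := by
    have : D + k' * b * D ≠ 0 := by positivity
    rw [hω]
    field_simp
  have hωD1 : 0 ≤ D * ω := by positivity
  have hωD2 : 0 ≤ k' * b * D * ω := by positivity
  set δ₂ : ℝ := ω * η / (3 * B) with hδ₂
  have hδ₂0 : 0 < δ₂ := by positivity
  obtain ⟨Q₀, hQ₀⟩ := exists_nat_gt (C / δ₂)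
  -- Adding `E + 1` ensures `Q > 0` and `E ≤ Q ^ 2`, so that the levels increase.
  set Q : ℕ := Q₀ + E + 1 with hQ
  have hQ0 : 0 < Q := by omega
  have hQ0' : (0 : ℝ) < Q := by exact_mod_cast hQ0
  have hQδ : C / Q ≤ δ₂ := by
    rw [div_lt_iff₀ hδ₂0] at hQ₀
    rw [div_le_iff₀ hQ0']
    have : (Q₀ : ℝ) ≤ Q := by exact_mod_cast (by omega : Q₀ ≤ Q)
    nlinarith
  have hEQ : E ≤ Q ^ 2 := (show E ≤ Q by omega).trans (Nat.le_self_pow (by norm_num) Q)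
  refine ⟨K, Q, by exact_mod_cast hK0, hEQ, ?_⟩
  have p1 := hpot (mid a E (Q ^ 2)) (fun _ => 1) (fun _ => 0) (mid_nonneg a E (Q ^ 2))
    (fun _ => le_rfl) (fun _ => le_rfl)
    (fun S v hv => by rw [mid_of_notMem hv, zero_mul]) (hmid E (Q ^ 2)) δ hδ0
  have p2 := hpot (fun R => off (heavy a (Q ^ 2) R)) (fun R => max 1 (totalWt a R / Q))
    (fun R => (1 + a) ^ 2 / max 1 (totalWt a R / Q)) (fun R => off_nonneg _)
    (fun R => le_max_left _ _) (fun R => by positivity)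
    (fun S v hv => (mul_le_of_le_one_left (psi_nonneg (le_max_left _ _) (by linarith))
      (off_le_one _ v)).trans (min_le_left _ _)) (hlight Q) δ₂ hδ₂0
  have p3 := hpot (fun R => off (notable a K (Q ^ 2) R)) (fun _ => k')
    (fun _ => (1 + a) ^ 2 / k') (fun R => off_nonneg _)
    (fun R => hk'1) (fun R => by positivity)
    (fun S v hv => (mul_le_of_le_one_left (psi_nonneg hk'1 (by linarith))
      (off_le_one _ v)).trans (min_le_left _ _)) (hoff K (Q ^ 2) k) δ hδ0
  filter_upwards [p1, p2, p3, eventually_forall_ge_atTop.2 h.le_card, h.totalWt_le,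
    eventually_forall_ge_atTop.2 h.spread, eventually_gt_atTop 0,
    eventually_ge_atTop ⌈(1 + a) ^ 2 * Q / (η * δ₂)⌉₊,
    eventually_ge_atTop ⌈2 * 2 ^ E * ((Q : ℝ) ^ 2 + 1) / ε⌉₊]
    with n₀ p1 p2 p3 hcard hT hspr hn₀ hn₁ hn₂ hθ
  have hn₀' : (0 : ℝ) < n₀ := by exact_mod_cast hn₀
  replace hn₁ := Nat.ceil_le.1 hn₁
  replace hn₂ := Nat.ceil_le.1 hn₂
  set R := x n₀ with hR
  have hT0 : η * n₀ ≤ totalWt a R := (hcard n₀ le_rfl).trans (card_le_totalWt ha _)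
  have hTpos : 0 < totalWt a R := (hspr n₀ le_rfl).totalWt_pos
  refine ⟨?_, fun n hn hnL => ?_⟩
  · rw [div_le_iff₀ hε] at hn₂
    rw [div_lt_iff₀ hε] at hK
    have h1 : totalWt a R / K ≤ C * n₀ / K := by gcongr
    have h2 : 2 ^ E * (C * n₀ / K) ≤ ε * n₀ / 2 := by
      rw [← mul_div_assoc, div_le_div_iff₀ hK0 (by norm_num)]
      nlinarith
    have h3 : (2 : ℝ) ^ E * (totalWt a R / K) ≤ 2 ^ E * (C * n₀ / K) := by gcongr
    linarith
  · have hTn : η * n₀ ≤ totalWt a (x n) := by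
      refine le_trans ?_ ((hcard n hn).trans (card_le_totalWt ha _))
      have : (n₀ : ℝ) ≤ n := by exact_mod_cast hn
      gcongr
    have hTn0 : 0 < totalWt a (x n) := (hspr n hn).totalWt_pos
    have hTn1 : 1 ≤ totalWt a (x n) := by
      refine le_trans ?_ (card_le_totalWt ha _)
      have := (hspr n hn).card_lt
      exact_mod_cast (show 1 ≤ (vertices (x n)).card by omega)
    have hdiv : ∀ P A : ℝ, 0 ≤ A → P ≤ B * (A * n₀) → P / totalWt a (x n) ≤ B * A / η := by
      intro P A hA hP
      rw [div_le_div_iff₀ hTn0 hη]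
      have h1 := mul_le_mul_of_nonneg_left hTn (mul_nonneg hB.le hA)
      nlinarith
    have q1 : potential a (mid a E (Q ^ 2) R) 1 (x n) / totalWt a (x n) ≤ ε / 4 := by
      refine (hdiv _ (2 * δ) (by positivity) ((p1 n hn hnL).trans ?_)).trans (le_of_eq ?_)
      · refine mul_le_mul_of_nonneg_left ?_ hB.le
        have h1 := potential_mid_le (S := R) ha hTpos E (Q ^ 2)
        have h2 : totalWt a R * ∑ v ∈ vertices R, mid a E (Q ^ 2) R v * pr a R v ≤
            C * n₀ * (δ / C) := by
          have : 0 ≤ ∑ v ∈ vertices R, mid a E (Q ^ 2) R v * pr a R v :=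
            Finset.sum_nonneg fun v _ => mul_nonneg (mid_nonneg _ _ _ _ _) (pr_nonneg ha v)
          gcongr
        have h3 : C * n₀ * (δ / C) = δ * n₀ := by field_simp
        linarith
      · rw [hδ]; field_simp; norm_num
    have q2 : potential a (off (heavy a (Q ^ 2) R)) (max 1 (totalWt a R / Q)) (x n) /
        totalWt a (x n) ≤ ω := by
      refine (hdiv _ (3 * δ₂) (by positivity) ((p2 n hn hnL).trans ?_)).trans (le_of_eq ?_)
      · refine mul_le_mul_of_nonneg_left ?_ hB.le
        have h1 := potential_light_le (S := R) ha hTpos hQ0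
        have h2 : totalWt a R / Q ≤ δ₂ * n₀ := by
          calc totalWt a R / Q ≤ C * n₀ / Q := by gcongr
            _ = C / Q * n₀ := by ring
            _ ≤ _ := by gcongr
        have h3 : (1 + a) ^ 2 / max 1 (totalWt a R / Q) ≤ δ₂ := by
          have h4 : (1 + a) ^ 2 / max 1 (totalWt a R / Q) ≤ (1 + a) ^ 2 / (totalWt a R / Q) := by
            gcongr
            exact le_max_right _ _
          refine h4.trans ?_
          rw [div_div_eq_mul_div, div_le_iff₀ hTpos]
          rw [div_le_iff₀ (by positivity)] at hn₁
          nlinarith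
        have h5 := mul_le_mul_of_nonneg_right h3 hn₀'.le
        linarith
      · rw [hδ₂]; field_simp
    have q3 : potential a (off (notable a K (Q ^ 2) R)) k' (x n) / totalWt a (x n) ≤ ε / 4 := by
      refine (hdiv _ (2 * δ) (by positivity) ((p3 n hn hnL).trans ?_)).trans (le_of_eq ?_)
      · refine mul_le_mul_of_nonneg_left ?_ hB.le
        have h1 := potential_off_notable_le (S := R) ha K (Q ^ 2) hk'0
        have h2 : totalWt a R * K / k' ≤ C * n₀ * K / k' := by gcongr
        have h3 := mul_le_mul_of_nonneg_right hkδ hn₀'.le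
        have h4 : (C * K + (1 + a) ^ 2) / k' * n₀ =
            C * n₀ * K / k' + (1 + a) ^ 2 / k' * n₀ := by ring
        linarith
      · rw [hδ]; field_simp; norm_num
    have hkD : max 1 (totalWt a R / Q) ≤ D * totalWt a (x n) := by
      refine max_le ?_ ?_
      · nlinarith
      · have h1 : totalWt a R / Q ≤ totalWt a R :=
          div_le_self hTpos.le (by exact_mod_cast hQ0)
        have h2 : C * n₀ = C / η * (η * n₀) := by field_simp
        have h3 : C / η * (η * n₀) ≤ C / η * totalWt a (x n) := by gcongr
        rw [hD]
        linarith
    have c1 := collisionOff_le (H := heavy a E R) (H' := heavy a (Q ^ 2) R) ha hTn0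
      (le_max_left 1 (totalWt a R / Q)) hD1 hkD
    have c2 := prAdjOff_le (H := heavy a E R) (H' := heavy a (Q ^ 2) R)
      (O := notable a K (Q ^ 2) R) ha hTn0
      (le_max_left 1 (totalWt a R / Q)) hD1 hkD (h.facet_card_le n) hk'1
    change _ ≤ potential a (mid a E (Q ^ 2) R) 1 (x n) / _ + _ at c1
    change _ ≤ potential a (mid a E (Q ^ 2) R) 1 (x n) / _ + _ + _ at c2
    have r1 := mul_le_mul_of_nonneg_left q2 (show 0 ≤ D by linarith)
    have r2 := mul_le_mul_of_nonneg_left q2 (show 0 ≤ k' * b * D by positivity)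
    constructor <;> linarith

/-- For every window of times, there are sets `H ⊆ O` of vertices from a bounded family such that
collisions off `H` and adjacent pairs off `O` are unlikely throughout the window, while `O` is
small. -/
theorem exists_levels (h : IsRegular hz c a x η C κ b) (ha : 0 ≤ a) (L : ℕ)
    (hmid : ∀ E E' : ℕ, Controlled z c a x fun R => potentialGain a (mid a E E' R) 1)
    (hlight : ∀ Q : ℕ, Controlled z c a x fun R =>
      potentialGain a (off (heavy a (Q ^ 2) R)) (max 1 (totalWt a R / Q)))
    (hoff : ∀ K E k : ℕ, Controlled z c a x fun R =>
      potentialGain a (off (notable a K E R)) ((k : ℝ) + 1)) {ε : ℝ} (hε : 0 < ε) :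
    ∃ P : Finset (ℕ × ℕ × ℕ), (∀ p ∈ P, p.1 ≤ p.2.2) ∧ ∀ᶠ n₀ : ℕ in atTop, ∃ p ∈ P,
      2 ^ (heavy a p.1 (x n₀)).card * (((notable a p.2.1 p.2.2 (x n₀)).card : ℝ) + 1) ≤ ε * n₀ ∧
      ∀ n, n₀ ≤ n → n ≤ L * n₀ →
        collisionOff a (heavy a p.1 (x n₀)) (x n) ≤ ε ∧
        prAdjOff a (notable a p.2.1 p.2.2 (x n₀)) (heavy a p.1 (x n₀)) (x n) ≤ ε := by
  obtain ⟨θ, hθ, hlev⟩ := h.exists_level ha L hmid hlight hoff hε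
  choose K Q hK hEQ hev using hlev
  -- The finer level of each stage is the coarser level of the next, so the layers telescope.
  let E : ℕ → ℕ := fun j => (fun e => Q e ^ 2)^[j] 1
  have hE : ∀ j, E (j + 1) = Q (E j) ^ 2 := fun j => Function.iterate_succ_apply' _ _ _
  have hEm : Monotone E := monotone_nat_of_le_succ fun j => by
    rw [hE]
    exact hEQ _
  obtain ⟨J, hJ⟩ := exists_nat_gt (1 / θ)
  have hJ0' : (0 : ℝ) < J := lt_trans (by positivity) hJ
  have hJ0 : 0 < J := by exact_mod_cast hJ0'
  refine ⟨(Finset.range J).image fun j => (E j, K (E j), Q (E j) ^ 2), fun p hp => ?_, ?_⟩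
  · obtain ⟨j, _, rfl⟩ := Finset.mem_image.1 hp
    exact hEQ _
  · have hall : ∀ᶠ n₀ : ℕ in atTop, ∀ j ∈ Finset.range J,
        ∑ v ∈ vertices (x n₀), mid a (E j) (Q (E j) ^ 2) (x n₀) v * pr a (x n₀) v ≤ θ →
        2 ^ (E j) * ((Q (E j) : ℝ) ^ 2 + totalWt a (x n₀) / K (E j) + 1) ≤ ε * n₀ ∧
        ∀ n, n₀ ≤ n → n ≤ L * n₀ →
          collisionOff a (heavy a (E j) (x n₀)) (x n) ≤ ε ∧
          prAdjOff a (notable a (K (E j)) (Q (E j) ^ 2) (x n₀)) (heavy a (E j) (x n₀)) (x n) ≤ ε :=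
      (Filter.eventually_all_finset _).2 fun j _ => hev (E j)
    filter_upwards [hall] with n₀ hn₀
    obtain ⟨j, hj, hle⟩ := exists_mid_le ha hEm hJ0 (x n₀)
    rw [hE] at hle
    have hJθ : 1 / (J : ℝ) ≤ θ := by
      rw [div_lt_iff₀ hθ] at hJ
      rw [div_le_iff₀ hJ0']
      linarith
    obtain ⟨h1, h2⟩ := hn₀ j (Finset.mem_range.2 hj) (hle.trans hJθ)
    refine ⟨_, Finset.mem_image_of_mem _ (Finset.mem_range.2 hj), ?_, h2⟩
    refine le_trans ?_ h1
    have h3 := card_notable_le (S := x n₀) ha (hK (E j)) (Q (E j) ^ 2)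
    push_cast at h3
    have h4 : (2 : ℝ) ^ (heavy a (E j) (x n₀)).card ≤ 2 ^ E j :=
      pow_le_pow_right₀ (by norm_num) (card_heavy_le ha _ _)
    gcongr

end IsRegular

end GeneSCs

/-! ### Accounting for the incidences with the notable set -/

namespace GeneSCs

/-- The number of vertices that a step brings in as members of a new facet of maximal size. -/
noncomputable def bornMax (M : ℕ) (S S' : Facets) : ℝ :=
  ∑ G ∈ S' \ S, if G.card = M then ((G \ vertices S).card : ℝ) else 0

theorem abs_bornMax_le {z : PMF ℕ} {c a : ℝ} (M : ℕ) (S S' : Facets)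
    (h : S' ∈ (step z c a S).support) : |bornMax M S S'| ≤ M := by
  obtain ⟨G, _, _, rfl⟩ := mem_support_step h
  rw [bornMax, sum_addFacet_sdiff]
  split_ifs with h1 h2
  · simp
  · rw [Nat.abs_cast]
    exact_mod_cast h2 ▸ Finset.card_le_card Finset.sdiff_subset
  · simp

/-- Below the vertex target, every new facet contains a new vertex and hence cannot be subsumed, so
a sampled maximal size always yields a maximal facet with a newborn vertex. -/
theorem le_ex_bornMax {z : PMF ℕ} (hz : z.support.Finite) {c a : ℝ} {S : Facets} (hc : 0 < c)
    (ha : 0 ≤ a) (hM : maxSize hz ≠ 0) (hV : maxSize hz ≤ (vertices S).card)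
    (hS : c * (vertices S).card < S.card + 1) :
    (z (maxSize hz)).toReal ≤ ex (step z c a S) (bornMax (maxSize hz) S) := by
  set M := maxSize hz with hMdef
  let g : ℕ → Finset ℕ → ℝ := fun m _ => if m = M then 1 else 0
  refine le_trans (le_of_eq ?_) (le_ex_step (c := c) hz ha
    (fun m hm => (le_maxSize hz hm).trans hV) (f := bornMax M S) (g := g) ?_)
  · simp only [g]
    have h1 : ∀ m ∈ z.support, (ex (picks a S (m - newCount c S m)) fun _ =>
        if m = M then (1 : ℝ) else 0) = if m = M then 1 else 0 := fun m _ =>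
      ex_const (finite_support_picks S _) _
    rw [ex_congr h1, ex, tsum_eq_single M fun m hm => by simp [hm]]
    simp
  · intro m hm A hA hAm
    simp only [g]
    have hnn : ∀ S' : Facets, 0 ≤ bornMax M S S' := fun S' => Finset.sum_nonneg fun G _ => by
      split_ifs
      · exact Nat.cast_nonneg _
      · exact le_rfl
    split_ifs with hmM
    · have hj : newCount c S m ≠ 0 := fun h0 =>
        absurd ((newCount_eq_zero_iff hc (hmM ▸ hM)).1 h0) (not_le.2 hS)
      have hj' := newCount_le c S m
      rw [bornMax, sum_addFacet_sdiff, if_neg, if_pos, union_freshVertices_sdiff hA,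
        card_freshVertices]
      · exact_mod_cast Nat.one_le_iff_ne_zero.2 hj
      · rw [card_union_freshVertices hA]
        omega
      · rintro ⟨F, hF, hAF⟩
        have h1 : freshVertices S (newCount c S m) = ∅ := by
          rw [← union_freshVertices_sdiff hA, Finset.sdiff_eq_empty_iff_subset]
          exact hAF.trans (subset_vertices hF)
        have h2 := card_freshVertices S (newCount c S m)
        rw [h1, Finset.card_empty] at h2
        exact hj h2.symm
    · exact hnn _

/-- Such a facet is determined by its trace on `H` and by its at most one remaining vertex, which
lies in `O`. -/
theorem card_filter_few_le (S : Facets) (H O : Finset ℕ) :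
    (S.filter fun G => G ⊆ O ∧ (G \ H).card ≤ 1).card ≤ 2 ^ H.card * (O.card + 1) := by
  have hsub : (S.filter fun G => G ⊆ O ∧ (G \ H).card ≤ 1) ⊆
      (H.powerset ×ˢ insert ∅ (O.image fun v => {v})).image fun p => p.1 ∪ p.2 := by
    intro G hG
    rw [Finset.mem_filter] at hG
    rw [Finset.mem_image]
    refine ⟨(G ∩ H, G \ H), Finset.mem_product.2 ⟨?_, ?_⟩, ?_⟩
    · exact Finset.mem_powerset.2 Finset.inter_subset_right
    · rw [Finset.mem_insert, Finset.mem_image]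
      rcases (G \ H).eq_empty_or_nonempty with h | h
      · exact Or.inl h
      · obtain ⟨v, hv⟩ := Finset.card_eq_one.1 (le_antisymm hG.2.2 (Finset.card_pos.2 h))
        refine Or.inr ⟨v, hG.2.1 ?_, hv.symm⟩
        have : v ∈ G \ H := by
          rw [hv]
          exact Finset.mem_singleton_self v
        exact (Finset.mem_sdiff.1 this).1
    · rw [Finset.union_comm]
      exact Finset.sdiff_union_inter G H
  refine (Finset.card_le_card hsub).trans (Finset.card_image_le.trans ?_)
  rw [Finset.card_product, Finset.card_powerset]
  exact Nat.mul_le_mul_left _ ((Finset.card_insert_le _ _).trans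
    (Nat.succ_le_succ Finset.card_image_le))

theorem sum_wt_eq {a : ℝ} {S : Facets} {O : Finset ℕ} (hO : O ⊆ vertices S) :
    ∑ v ∈ O, wt a S v = ∑ G ∈ S, ((G ∩ O).card : ℝ) + a * O.card := by
  rw [Finset.sum_congr rfl fun v hv => wt_of_mem (hO hv), Finset.sum_add_distrib,
    Finset.sum_const, nsmul_eq_mul, mul_comm a]
  congr 1
  rw [← Nat.cast_sum, ← Nat.cast_sum, Nat.cast_inj]
  simp only [facetDegree, Finset.card_filter]
  rw [Finset.sum_comm]
  refine Finset.sum_congr rfl fun G _ => ?_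
  rw [← Finset.card_filter, Finset.filter_mem_eq_inter, Finset.inter_comm]

theorem one_sub_prOff {a : ℝ} {S : Facets} (hT : totalWt a S ≠ 0) {O : Finset ℕ}
    (hO : O ⊆ vertices S) : 1 - prOff a O S = (∑ v ∈ O, wt a S v) / totalWt a S := by
  have h1 : prOff a O S = ∑ v ∈ vertices S \ O, pr a S v := by
    rw [prOff, ← Finset.sum_sdiff hO]
    rw [Finset.sum_congr rfl fun v hv => by
      rw [off_of_notMem (Finset.mem_sdiff.1 hv).2, mul_one]]
    rw [add_eq_left]
    exact Finset.sum_eq_zero fun v hv => by rw [off_of_mem hv, mul_zero]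
  have h2 := sum_pr hT
  rw [← Finset.sum_sdiff hO] at h2
  rw [h1, Finset.sum_div]
  change _ = ∑ v ∈ O, pr a S v
  linarith

namespace IsPath

variable {z : PMF ℕ} {c a : ℝ} {x : ℕ → Facets}

/-- Telescoping over additions and removals. It relies on removed facets never reappearing: a facet
added after time `t` was not present at time `t`. -/
theorem sum_sdiff_eq (h : IsPath z c x) (w : Finset ℕ → ℝ) {t n : ℕ} (htn : t ≤ n) :
    ∑ G ∈ x n \ x t, w G = ∑ i ∈ Finset.Ico t n, ∑ G ∈ x (i + 1) \ x i, w G -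
      ∑ i ∈ Finset.Ico t n, ∑ G ∈ (x i \ x (i + 1)) \ x t, w G := by
  induction n, htn using Nat.le_induction with
  | base => simp
  | succ n hn ih =>
    rw [Finset.sum_Ico_succ_top hn, Finset.sum_Ico_succ_top hn]
    have e1 : x (n + 1) \ x t = ((x n \ x t) \ ((x n \ x (n + 1)) \ x t)) ∪ (x (n + 1) \ x n) := by
      ext G
      simp only [Finset.mem_union, Finset.mem_sdiff]
      constructor
      · rintro ⟨h1, h2⟩
        by_cases h3 : G ∈ x n
        · exact Or.inl ⟨⟨h3, h2⟩, fun h4 => h4.1.2 h1⟩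
        · exact Or.inr ⟨h1, h3⟩
      · rintro (⟨⟨h1, h2⟩, h3⟩ | ⟨h1, h2⟩)
        · refine ⟨?_, h2⟩
          by_contra h4
          exact h3 ⟨⟨h1, h4⟩, h2⟩
        · exact ⟨h1, fun h3 => h.notMem_of_removed h3 hn h2 (Nat.le_succ n) h1⟩
    have hdisj : Disjoint ((x n \ x t) \ ((x n \ x (n + 1)) \ x t)) (x (n + 1) \ x n) := by
      rw [Finset.disjoint_left]
      intro G h1 h2
      exact (Finset.mem_sdiff.1 h2).2 (Finset.mem_sdiff.1 (Finset.mem_sdiff.1 h1).1).1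
    have hsub : (x n \ x (n + 1)) \ x t ⊆ x n \ x t :=
      Finset.sdiff_subset_sdiff Finset.sdiff_subset subset_rfl
    have e2 := Finset.sum_sdiff (f := w) hsub
    rw [e1, Finset.sum_union hdisj]
    linarith

/-- The number of steps before the facet `G` is added. -/
noncomputable def bornAt (x : ℕ → Facets) (G : Finset ℕ) : ℕ := sInf {i | G ∈ x (i + 1)}

theorem bornAt_eq (h : IsPath z c x) {i : ℕ} {G : Finset ℕ} (hG : G ∈ x (i + 1) \ x i) :
    bornAt x G = i := by
  rw [Finset.mem_sdiff] at hG
  refine le_antisymm (Nat.sInf_le hG.1) ?_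
  by_contra hcon
  push Not at hcon
  have h1 : G ∈ x (bornAt x G + 1) := Nat.sInf_mem (s := {i | G ∈ x (i + 1)}) ⟨i, hG.1⟩
  exact h.notMem_of_removed h1 hcon hG.2 (Nat.le_succ i) hG.1

theorem bornAt_mem (h : IsPath z c x) {t n : ℕ} (htn : t ≤ n) {G : Finset ℕ}
    (hG : G ∈ x n \ x t) : t ≤ bornAt x G ∧ bornAt x G < n := by
  rw [Finset.mem_sdiff] at hG
  obtain ⟨l, hl, hl1, hl2⟩ : ∃ l, t ≤ l ∧ l < n ∧ G ∈ x (l + 1) \ x l := by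
    induction n, htn using Nat.le_induction with
    | base => exact absurd hG.1 hG.2
    | succ n hn ih =>
      by_cases hGn : G ∈ x n
      · obtain ⟨l, h1, h2, h3⟩ := ih ⟨hGn, hG.2⟩
        exact ⟨l, h1, by omega, h3⟩
      · exact ⟨n, hn, Nat.lt_succ_self n, Finset.mem_sdiff.2 ⟨hG.1, hGn⟩⟩
  rw [h.bornAt_eq hl2]
  exact ⟨hl, hl1⟩

/-- A facet added at time `i` is expected to have `y i` times its number of old vertices in `O`.
Summing over the facets that survive, deviations are collected in the excess, unsafe facets inside
`O` are bounded by their number, and removals are costly only for facets with negative excess.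
Newborn vertices of maximal facets are not old vertices at birth, and they are subtracted because
maximal facets persist. -/
theorem sum_card_inter_le (h : IsPath z c x) (hz : z.support.Finite) {b : ℕ}
    (hb : ∀ n, ∀ F ∈ x n, F.card ≤ b) (H O : Finset ℕ) {t n : ℕ} (htn : t ≤ n) {y : ℕ → ℝ} {X : ℝ}
    (hX : 0 ≤ X) (hyX : ∀ i, t ≤ i → i < n → y i ≤ X) (hy1 : ∀ i, t ≤ i → i < n → y i ≤ 1) :
    ∑ G ∈ x n, ((G ∩ O).card : ℝ) ≤ ∑ G ∈ x t, ((G ∩ O).card : ℝ) +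
      b * (2 ^ H.card * (O.card + 1)) +
      X * (∑ G ∈ x n, (G.card : ℝ) -
        ∑ i ∈ Finset.Ico t n, bornMax (maxSize hz) (x i) (x (i + 1))) +
      ∑ i ∈ Finset.Ico t n, ∑ G ∈ x (i + 1) \ x i, excess H O (vertices (x i)) (y i) G +
      b * ∑ i ∈ Finset.Ico t n, removedSafe H O (x i) (x (i + 1)) := by
  set M := maxSize hz with hM
  -- The vertex set just before the facet is added.
  set V : Finset ℕ → Finset ℕ := fun G => vertices (x (bornAt x G)) with hV
  set e : Finset ℕ → ℝ := fun G => excess H O (V G) (y (bornAt x G)) G with he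
  set q : Finset ℕ → ℝ := fun G => if G.card = M then ((G \ V G).card : ℝ) else 0 with hq
  have hk0 : ∀ G, (0 : ℝ) ≤ (G ∩ V G).card := fun G => Nat.cast_nonneg _
  -- every new facet
  have s1 : ∑ G ∈ x n \ x t, ((G ∩ O).card : ℝ) ≤
      ∑ G ∈ x n \ x t, e G + X * ∑ G ∈ x n \ x t, ((G ∩ V G).card : ℝ) +
      b * (2 ^ H.card * (O.card + 1)) := by
    have h1 : ∀ G ∈ x n \ x t, ((G ∩ O).card : ℝ) ≤ e G + X * (G ∩ V G).card +
        b * if G ⊆ O ∧ (G \ H).card ≤ 1 then 1 else 0 := by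
      intro G hG
      obtain ⟨h1, h2⟩ := h.bornAt_mem htn hG
      have h3 := mul_le_mul_of_nonneg_right (hyX _ h1 h2) (hk0 G)
      have h4 : ((G ∩ O).card : ℝ) ≤ b := by
        exact_mod_cast (Finset.card_le_card Finset.inter_subset_left).trans
          (hb n G (Finset.mem_sdiff.1 hG).1)
      have h5 := mul_nonneg hX (hk0 G)
      simp only [he, excess]
      split_ifs with h6 h7 h7 h8 h8
      · omega
      · linarith
      · linarith
      · exact absurd ⟨h7, by omega⟩ h8
      · exact absurd h8.1 h7
      · linarith [le_max_left (((G ∩ O).card : ℝ) - y (bornAt x G) * (G ∩ V G).card) 0]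
    refine (Finset.sum_le_sum h1).trans ?_
    rw [Finset.sum_add_distrib, Finset.sum_add_distrib, ← Finset.mul_sum, ← Finset.mul_sum,
      Finset.sum_boole]
    have h2 : (((x n \ x t).filter fun G => G ⊆ O ∧ (G \ H).card ≤ 1).card : ℝ) ≤
        2 ^ H.card * (O.card + 1) := by
      exact_mod_cast card_filter_few_le _ H O
    have h3 := mul_le_mul_of_nonneg_left h2 (b.cast_nonneg (α := ℝ))
    linarith
  have s2 : ∑ G ∈ x n \ x t, e G ≤
      ∑ i ∈ Finset.Ico t n, ∑ G ∈ x (i + 1) \ x i, excess H O (vertices (x i)) (y i) G +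
      b * ∑ i ∈ Finset.Ico t n, removedSafe H O (x i) (x (i + 1)) := by
    rw [h.sum_sdiff_eq e htn, sub_eq_add_neg, ← Finset.sum_neg_distrib, Finset.mul_sum]
    refine add_le_add (le_of_eq ?_) (Finset.sum_le_sum fun i hi => ?_)
    · refine Finset.sum_congr rfl fun i _ => Finset.sum_congr rfl fun G hG => ?_
      simp only [he, hV]
      rw [h.bornAt_eq hG]
    · rw [Finset.mem_Ico] at hi
      rw [← Finset.sum_neg_distrib, removedSafe, ← Finset.sum_boole, Finset.mul_sum]
      refine (Finset.sum_le_sum fun G hG => ?_).trans (Finset.sum_le_sum_of_subset_of_nonneg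
        Finset.sdiff_subset fun G _ _ => ?_)
      · have hGi : G ∈ x i \ x t := by
          simp only [Finset.mem_sdiff] at hG ⊢
          exact ⟨hG.1.1, hG.2⟩
        obtain ⟨h1, h2⟩ := h.bornAt_mem hi.1 hGi
        have h3 := mul_le_mul_of_nonneg_right (hy1 _ h1 (by omega)) (hk0 G)
        have h4 : ((G ∩ V G).card : ℝ) ≤ G.card := by
          exact_mod_cast Finset.card_le_card Finset.inter_subset_left
        have h5 : (G.card : ℝ) ≤ b := by exact_mod_cast hb i G (Finset.mem_sdiff.1 hGi).1
        have h6 : (0 : ℝ) ≤ (G ∩ O).card := Nat.cast_nonneg _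
        simp only [he, excess]
        split_ifs with h7 h8 h8 h8 h8
        · linarith
        · have : G ⊆ O := by
            by_contra hcon
            exact h8 ⟨hcon, h7⟩
          rw [Finset.inter_eq_left.2 this]
          linarith
        · exact absurd h8.2 h7
        · simp
        · exact absurd h8.2 h7
        · simp
      · split_ifs <;> simp
  have s3 : ∑ G ∈ x n \ x t, ((G ∩ V G).card : ℝ) ≤ ∑ G ∈ x n, (G.card : ℝ) -
        ∑ i ∈ Finset.Ico t n, bornMax M (x i) (x (i + 1)) := by
    have h1 : ∑ G ∈ x n \ x t, ((G ∩ V G).card : ℝ) ≤ ∑ G ∈ x n \ x t, ((G.card : ℝ) - q G) := by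
      refine Finset.sum_le_sum fun G _ => ?_
      rw [card_inter_eq_sub]
      simp only [hq]
      split_ifs
      · exact le_rfl
      · linarith [(G \ V G).card.cast_nonneg (α := ℝ)]
    rw [Finset.sum_sub_distrib, h.sum_sdiff_eq q htn] at h1
    have h2 : ∑ i ∈ Finset.Ico t n, ∑ G ∈ (x i \ x (i + 1)) \ x t, q G = 0 := by
      refine Finset.sum_eq_zero fun i _ => Finset.sum_eq_zero fun G hG => if_neg fun hc => ?_
      simp only [Finset.mem_sdiff] at hG
      exact hG.1.2 (h.maxFacet_mem_succ hz hG.1.1 hc)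
    have h3 : ∑ i ∈ Finset.Ico t n, ∑ G ∈ x (i + 1) \ x i, q G =
        ∑ i ∈ Finset.Ico t n, bornMax M (x i) (x (i + 1)) := by
      refine Finset.sum_congr rfl fun i _ => Finset.sum_congr rfl fun G hG => ?_
      simp only [hq, hV]
      rw [h.bornAt_eq hG]
    have h4 : ∑ G ∈ x n \ x t, (G.card : ℝ) ≤ ∑ G ∈ x n, (G.card : ℝ) :=
      Finset.sum_le_sum_of_subset_of_nonneg Finset.sdiff_subset fun _ _ _ => Nat.cast_nonneg _
    linarith
  have s4 : ∑ G ∈ x n, ((G ∩ O).card : ℝ) ≤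
      ∑ G ∈ x t, ((G ∩ O).card : ℝ) + ∑ G ∈ x n \ x t, ((G ∩ O).card : ℝ) := by
    rw [add_comm, ← Finset.sum_union Finset.sdiff_disjoint]
    refine Finset.sum_le_sum_of_subset_of_nonneg ?_ fun _ _ _ => Nat.cast_nonneg _
    rw [Finset.sdiff_union_self_eq_union]
    exact Finset.subset_union_left
  have s5 := mul_le_mul_of_nonneg_left s3 hX
  linarith

/-- New vertices appear only while the target is not met, at most `M` per step; with `M` vertices
available the picks never run out. -/
theorem card_vertices_sub_le (h : IsPath z c x) (hz : z.support.Finite)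
    (hz0 : ∀ m ∈ z.support, m ≠ 0) (hc : 0 < c) {t n : ℕ} (htn : t ≤ n)
    (hV : maxSize hz ≤ (vertices (x t)).card) :
    ((vertices (x n)).card : ℝ) - (vertices (x t)).card ≤ maxSize hz *
      ∑ i ∈ Finset.Ico t n, if c * (vertices (x i)).card < (x i).card + 1 then 1 else 0 := by
  induction n, htn using Nat.le_induction with
  | base => simp
  | succ n hn ih =>
    rw [Finset.sum_Ico_succ_top hn, mul_add]
    obtain ⟨m, hm, he⟩ := h.card_vertices_succ n fun m hm =>
      (le_maxSize hz hm).trans (hV.trans (h.card_vertices_mono hn))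
    have h1 : ((vertices (x (n + 1))).card : ℝ) - (vertices (x n)).card ≤ maxSize hz *
        if c * (vertices (x n)).card < (x n).card + 1 then 1 else 0 := by
      rw [he]
      split_ifs with h2
      · have : (newCount c (x n) m : ℝ) ≤ maxSize hz := by
          exact_mod_cast (newCount_le c _ m).trans (le_maxSize hz hm)
        push_cast
        linarith
      · rw [(newCount_eq_zero_iff hc (hz0 m hm)).2 (not_lt.1 h2)]
        simp
    linarith

end IsPath

end GeneSCs

/-! ### Contraction of the share of the notable set -/

namespace GeneSCs

/-- The functions of the initial and the last two states of a time window whose sums have to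
concentrate. -/
structure IsControlled {z : PMF ℕ} (hz : z.support.Finite) (c a : ℝ) (x : ℕ → Facets) :
    Prop where
  mid : ∀ E E' : ℕ, Controlled z c a x fun R => potentialGain a (mid a E E' R) 1
  light : ∀ Q : ℕ, Controlled z c a x fun R =>
    potentialGain a (off (heavy a (Q ^ 2) R)) (max 1 (totalWt a R / Q))
  ordinary : ∀ K E k : ℕ, Controlled z c a x fun R =>
    potentialGain a (off (notable a K E R)) ((k : ℝ) + 1)
  excess : ∀ E K N : ℕ, Controlled z c a x fun R S S' => ∑ G ∈ S' \ S,
    excess (heavy a E R) (notable a K N R) (vertices S) (1 - prOff a (notable a K N R) S) G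
  removed : ∀ E K N : ℕ, Controlled z c a x fun R =>
    removedSafe (heavy a E R) (notable a K N R)
  born : Controlled z c a x fun _ => bornMax (maxSize hz)

section Bounds

variable {z : PMF ℕ} {c a : ℝ}

theorem abs_sum_excess_le (hz : z.support.Finite) (ha : 0 ≤ a) (H O : Finset ℕ) {S S' : Facets}
    (h : S' ∈ (step z c a S).support) :
    |∑ G ∈ S' \ S, excess H O (vertices S) (1 - prOff a O S) G| ≤ maxSize hz := by
  obtain ⟨G, hG, _, rfl⟩ := mem_support_step h
  rw [sum_addFacet_sdiff]
  have h0 : 0 ≤ 1 - prOff a O S := by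
    rw [sub_nonneg]
    exact (Finset.sum_le_sum fun v _ => mul_le_of_le_one_right (pr_nonneg ha v)
      (off_le_one O v)).trans (sum_pr_le_one a S)
  have h1 : 1 - prOff a O S ≤ 1 := by linarith [prOff_nonneg ha O S]
  have h2 : (G.card : ℝ) ≤ maxSize hz := by exact_mod_cast le_maxSize hz hG
  have h3 : ((G ∩ O).card : ℝ) ≤ G.card := by
    exact_mod_cast Finset.card_le_card Finset.inter_subset_left
  have h4 : ((G ∩ vertices S).card : ℝ) ≤ G.card := by
    exact_mod_cast Finset.card_le_card Finset.inter_subset_left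
  have h5 : (0 : ℝ) ≤ (G ∩ O).card := Nat.cast_nonneg _
  have h6 : (0 : ℝ) ≤ (G ∩ vertices S).card := Nat.cast_nonneg _
  have h7 := mul_nonneg h0 h6
  have h8 := mul_le_mul_of_nonneg_right h1 h6
  have h9 : |((G ∩ O).card : ℝ) - (1 - prOff a O S) * (G ∩ vertices S).card| ≤ maxSize hz := by
    rw [abs_le]
    constructor <;> linarith
  unfold excess
  split_ifs
  · simp
  · exact h9
  · simp
  · refine (abs_le.2 ⟨?_, ?_⟩)
    · linarith [le_max_right (((G ∩ O).card : ℝ) - (1 - prOff a O S) * (G ∩ vertices S).card) 0]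
    · exact max_le (abs_le.1 h9).2 (by linarith)

theorem abs_removedSafe_le (hz : z.support.Finite) (H O : Finset ℕ) {S S' : Facets}
    (h : S' ∈ (step z c a S).support) : |removedSafe H O S S'| ≤ 2 ^ maxSize hz := by
  obtain ⟨G, hG, _, rfl⟩ := mem_support_step h
  rw [removedSafe, Nat.abs_cast]
  have : ((S \ addFacet S G).filter fun F => ¬ F ⊆ O ∧ 2 ≤ (F \ H).card).card ≤
      2 ^ maxSize hz := by
    refine (Finset.card_le_card (t := G.powerset) fun F hF => ?_).trans ?_
    · rw [Finset.mem_filter] at hF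
      exact Finset.mem_powerset.2 (Finset.mem_filter.1 (sdiff_addFacet_subset S G hF.1)).2
    · rw [Finset.card_powerset]
      exact Nat.pow_le_pow_right (by norm_num) (le_maxSize hz hG)
  exact_mod_cast this

end Bounds

/-- A sum from `t` to `n` is a difference of two sums starting at `n₀`, so the control extends to
all subintervals of the window. -/
theorem Controlled.sum_le {z : PMF ℕ} {c a : ℝ} {x : ℕ → Facets}
    {f : Facets → Facets → Facets → ℝ} (h : Controlled z c a x f) {δ : ℝ} (hδ : 0 < δ) (K : ℕ) :
    ∀ᶠ n₀ : ℕ in atTop, ∀ t n, n₀ ≤ t → t ≤ n → n ≤ K * n₀ →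
      |∑ i ∈ Finset.Ico t n, f (x n₀) (x i) (x (i + 1)) -
        ∑ i ∈ Finset.Ico t n, ex (step z c a (x i)) (f (x n₀) (x i))| ≤ δ * n₀ := by
  filter_upwards [h (δ / 2) (by positivity) K] with n₀ hn₀ t n ht htn hn
  have h1 := abs_le.1 (hn₀ t ht (htn.trans hn))
  have h2 := abs_le.1 (hn₀ n (ht.trans htn) hn)
  have h3 := Finset.sum_Ico_consecutive (fun i => f (x n₀) (x i) (x (i + 1)) -
    ex (step z c a (x i)) (f (x n₀) (x i))) ht htn
  rw [centredSum] at h1 h2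
  rw [← Finset.sum_sub_distrib, abs_le]
  constructor <;> linarith

namespace IsRegular

variable {z : PMF ℕ} {hz : z.support.Finite} {c a : ℝ} {x : ℕ → Facets} {η C κ : ℝ} {b : ℕ}

theorem le_C (h : IsRegular hz c a x η C κ b) (ha : 0 ≤ a) : η ≤ C := by
  obtain ⟨n, h1, h2, h3⟩ := (h.le_card.and (h.totalWt_le.and (eventually_gt_atTop 0))).exists
  have h4 : (0 : ℝ) < n := by exact_mod_cast h3
  have := (h1.trans (card_le_totalWt ha _)).trans h2
  exact le_of_mul_le_mul_right this h4

/-- The vertices born in facets of maximal size are a positive proportion of the total weight. -/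
theorem exists_le_sum_bornMax (h : IsRegular hz c a x η C κ b) (ha : 0 ≤ a) (hc : 0 < c)
    (hz0 : ∀ m ∈ z.support, m ≠ 0)
    (hctl : Controlled z c a x fun _ => bornMax (maxSize hz)) :
    ∃ q : ℝ, 0 < q ∧ q < 1 ∧ ∃ Λ : ℕ, ∀ l, Λ ≤ l → ∀ L : ℕ, ∀ᶠ n₀ : ℕ in atTop, ∀ t n, n₀ ≤ t →
      l * t ≤ n → n ≤ L * n₀ → t ≤ n →
      q * totalWt a (x n) ≤ ∑ i ∈ Finset.Ico t n, bornMax (maxSize hz) (x i) (x (i + 1)) := by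
  set M := maxSize hz with hM
  have hM0 : M ≠ 0 := hz0 _ (maxSize_mem hz)
  have hM0' : (0 : ℝ) < M := by exact_mod_cast Nat.pos_of_ne_zero hM0
  have hη := h.pos
  have hC := h.pos'
  have hηC := h.le_C ha
  set ζ : ℝ := (z M).toReal with hζ
  have hζ0 : 0 < ζ := ENNReal.toReal_pos ((PMF.mem_support_iff _ _).1 (maxSize_mem hz))
    (PMF.apply_ne_top z M)
  have hζ1 : ζ ≤ 1 := ENNReal.toReal_le_of_le_ofReal zero_le_one (by simpa using PMF.coe_le_one z M)
  -- Each step in which vertices can appear brings at most `M` of them, and at least one expected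
  -- newborn vertex per `1 / ζ` such steps lies in a maximal facet.
  set ξ : ℝ := ζ / M with hξ
  have hξ0 : 0 < ξ := by positivity
  have hξ1 : ξ ≤ 1 := by
    rw [hξ, div_le_one hM0']
    exact hζ1.trans (by exact_mod_cast Nat.one_le_iff_ne_zero.2 hM0)
  -- If `n ≥ Λ * t`, the vertices present at time `t` are at most half of the lower bound `η * n`
  -- for those present at time `n`.
  obtain ⟨Λ, hΛ⟩ := exists_nat_gt (2 * C / η)
  refine ⟨ξ * η / (4 * C), by positivity, ?_, Λ, fun l hl L => ?_⟩
  · rw [div_lt_one (by positivity)]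
    nlinarith
  filter_upwards [hctl.sum_le (δ := ξ * η / 4) (by positivity) L,
    eventually_forall_ge_atTop.2 h.le_card, eventually_forall_ge_atTop.2 h.totalWt_le,
    eventually_forall_ge_atTop.2 h.spread] with n₀ h1 h2 h3 h4 t n ht hlt hn htn
  have e1 := (abs_le.1 (h1 t n ht htn hn)).1
  have e2 : ζ * ∑ i ∈ Finset.Ico t n,
      (if c * (vertices (x i)).card < (x i).card + 1 then (1 : ℝ) else 0) ≤
      ∑ i ∈ Finset.Ico t n, ex (step z c a (x i)) (bornMax M (x i)) := by
    rw [Finset.mul_sum]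
    refine Finset.sum_le_sum fun i hi => ?_
    rw [Finset.mem_Ico] at hi
    have hV := (h4 i (ht.trans hi.1)).card_lt
    split_ifs with h5
    · rw [mul_one]
      exact le_ex_bornMax hz hc ha hM0 hV.le h5
    · rw [mul_zero]
      refine ex_nonneg fun S' _ => Finset.sum_nonneg fun G _ => ?_
      split_ifs
      · exact Nat.cast_nonneg _
      · exact le_rfl
  have e3 := h.isPath.card_vertices_sub_le hz hz0 hc htn (h4 t ht).card_lt.le
  have e4 : ξ * (((vertices (x n)).card : ℝ) - (vertices (x t)).card) ≤
      ζ * ∑ i ∈ Finset.Ico t n,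
        (if c * (vertices (x i)).card < (x i).card + 1 then (1 : ℝ) else 0) := by
    refine (mul_le_mul_of_nonneg_left e3 hξ0.le).trans (le_of_eq ?_)
    rw [← mul_assoc, hξ, div_mul_cancel₀ _ hM0'.ne']
  have e5 := (card_le_totalWt ha (x t)).trans (h3 t ht)
  have e6 := h2 n (ht.trans htn)
  have e7 := h3 n (ht.trans htn)
  have e8 : C * t ≤ η / 2 * n := by
    have h5 : (Λ : ℝ) * t ≤ n := by exact_mod_cast (Nat.mul_le_mul_right t hl).trans hlt
    rw [div_lt_iff₀ hη] at hΛ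
    have h6 : 2 * C * t ≤ Λ * η * t := mul_le_mul_of_nonneg_right hΛ.le (Nat.cast_nonneg t)
    nlinarith
  have e9 : ξ * (η / 2 * n) ≤ ξ * (((vertices (x n)).card : ℝ) - (vertices (x t)).card) := by
    refine mul_le_mul_of_nonneg_left ?_ hξ0.le
    linarith
  have e10 : (n₀ : ℝ) ≤ n := by exact_mod_cast ht.trans htn
  have e11 : ξ * η / (4 * C) * totalWt a (x n) ≤ ξ * η / 4 * n := by
    calc _ ≤ ξ * η / (4 * C) * (C * n) := by gcongr
      _ = _ := by field_simp
  have e12 : ξ * η / 4 * n₀ ≤ ξ * η / 4 * n := by gcongr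
  linarith

/-- After time is multiplied by `l`, the old weight is at most of order `n / l`. All later
incidences with `O` come at a rate at most `X`, but a proportion `q` of the total weight consists of
incidences of newborn vertices, which are not in `O`. Hence the factor `1 - q`. -/
theorem exists_contraction (h : IsRegular hz c a x η C κ b) (ha : 0 ≤ a) (hc : 0 < c)
    (hz0 : ∀ m ∈ z.support, m ≠ 0) (hctl : IsControlled hz c a x) :
    ∃ q A : ℝ, 0 < q ∧ q < 1 ∧ 0 < A ∧ ∃ Λ : ℕ, ∀ l, Λ ≤ l → 0 < l → ∀ L E K N : ℕ, E ≤ N →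
      ∀ ε : ℝ, 0 < ε → ∀ᶠ n₀ : ℕ in atTop,
      2 ^ (heavy a E (x n₀)).card * (((notable a K N (x n₀)).card : ℝ) + 1) ≤ ε * n₀ →
      (∀ n, n₀ ≤ n → n ≤ L * n₀ →
        collisionOff a (heavy a E (x n₀)) (x n) ≤ ε ∧
        prAdjOff a (notable a K N (x n₀)) (heavy a E (x n₀)) (x n) ≤ ε) →
      ∀ (t : ℕ) (X : ℝ), n₀ ≤ t → 0 ≤ X →
        (∀ n, t ≤ n → n ≤ L * n₀ → 1 - prOff a (notable a K N (x n₀)) (x n) ≤ X) →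
        ∀ n, l * t ≤ n → n ≤ L * n₀ →
          1 - prOff a (notable a K N (x n₀)) (x n) ≤ (1 - q) * X + A * (1 / l + ε) := by
  set M := maxSize hz with hM
  have hη := h.pos
  have hC := h.pos'
  obtain ⟨q, hq0, hq1, Λ, hborn⟩ := h.exists_le_sum_bornMax ha hc hz0 hctl.born
  set A₁ : ℝ := b + (4 * M ^ 3 * κ ^ 2 + 1) + b * (2 ^ M * (M * κ) ^ 2 + 1) with hA₁
  have hA₁0 : 0 < A₁ := by positivity
  refine ⟨q, (C + A₁) / η, hq0, hq1, by positivity, Λ, fun l hl hl0 L E K N hEN ε hε => ?_⟩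
  filter_upwards [hborn l hl L, (hctl.excess E K N).sum_le hε L,
    (hctl.removed E K N).sum_le hε L, eventually_forall_ge_atTop.2 h.le_card,
    eventually_forall_ge_atTop.2 h.totalWt_le, eventually_forall_ge_atTop.2 h.spread]
    with n₀ h1 h2 h3 h4 h5 h6 hfew hrare t X ht hX hXn n hn hnL
  set R := x n₀ with hR
  set H := heavy a E R with hH
  set O := notable a K N R with hO
  have hHO : H ⊆ O := (heavy_mono ha hEN R).trans (heavy_subset_notable a K N R)
  have hOV : ∀ i, n₀ ≤ i → O ⊆ vertices (x i) := fun i hi =>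
    (notable_subset a K N R).trans (h.isPath.vertices_mono hi)
  have htn : t ≤ n := (Nat.le_mul_of_pos_left t hl0).trans hn
  have hn₀n := ht.trans htn
  have hspr := h6 n hn₀n
  have hT := hspr.totalWt_pos
  have hTn : η * n ≤ totalWt a (x n) := (h4 n hn₀n).trans (card_le_totalWt ha _)
  have hnn : (n₀ : ℝ) ≤ n := by exact_mod_cast hn₀n
  have hεn : ε * n₀ ≤ ε * n := by gcongr
  have hl0' : (0 : ℝ) < l := by exact_mod_cast hl0
  have key := h.isPath.sum_card_inter_le hz h.facet_card_le H O htn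
    (y := fun i => 1 - prOff a O (x i)) hX (fun i hi hin => hXn i hi (hin.le.trans hnL))
    (fun i _ _ => by linarith [prOff_nonneg ha O (x i)])
  have hWn := sum_wt_eq (a := a) (hOV n hn₀n)
  have hWt := sum_wt_eq (a := a) (hOV t ht)
  have hWtT : ∑ v ∈ O, wt a (x t) v ≤ totalWt a (x t) :=
    Finset.sum_le_sum_of_subset_of_nonneg (hOV t ht) fun v _ _ => wt_nonneg ha v
  have hTt := h5 t ht
  have hlt : C * t ≤ C * (1 / l) * n := by
    have : (l : ℝ) * t ≤ n := by exact_mod_cast hn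
    rw [mul_one_div, div_mul_eq_mul_div, le_div_iff₀ hl0']
    nlinarith
  have hB := h1 t n ht hn hnL htn
  have hD : ∑ G ∈ x n, (G.card : ℝ) ≤ totalWt a (x n) := by
    rw [totalWt_eq]
    have := mul_nonneg ha ((vertices (x n)).card.cast_nonneg (α := ℝ))
    linarith
  have hXD : X * (∑ G ∈ x n, (G.card : ℝ) -
      ∑ i ∈ Finset.Ico t n, bornMax (maxSize hz) (x i) (x (i + 1))) ≤
      X * ((1 - q) * totalWt a (x n)) := by
    refine mul_le_mul_of_nonneg_left ?_ hX
    linarith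
  have hcount : ∀ B : ℝ, 0 ≤ B → ∑ i ∈ Finset.Ico t n, B ≤ B * n := fun B hB => by
    rw [Finset.sum_const, Nat.card_Ico, nsmul_eq_mul, mul_comm]
    have : ((n - t : ℕ) : ℝ) ≤ n := by exact_mod_cast Nat.sub_le n t
    gcongr
  have hexc := (abs_le.1 (h2 t n ht htn hnL)).2
  have hexc' : ∑ i ∈ Finset.Ico t n, ex (step z c a (x i)) (fun S' => ∑ G ∈ S' \ x i,
      excess H O (vertices (x i)) (1 - prOff a O (x i)) G) ≤ 4 * M ^ 3 * κ ^ 2 * ε * n := by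
    refine le_trans (Finset.sum_le_sum fun i hi => ?_) (hcount _ (by positivity))
    rw [Finset.mem_Ico] at hi
    have hi0 := ht.trans hi.1
    refine (ex_excess_step_le hz (h6 i hi0) hHO (hOV i hi0)).trans ?_
    obtain ⟨r1, r2⟩ := hrare i hi0 (hi.2.le.trans hnL)
    have : 2 * (M : ℝ) ^ 3 * κ ^ 2 * (collisionOff a H (x i) + prAdjOff a O H (x i)) ≤
        2 * (M : ℝ) ^ 3 * κ ^ 2 * (ε + ε) := by gcongr
    linarith
  have hrem := (abs_le.1 (h3 t n ht htn hnL)).2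
  have hrem' : ∑ i ∈ Finset.Ico t n, ex (step z c a (x i)) (removedSafe H O (x i)) ≤
      2 ^ M * (M * κ) ^ 2 * ε * n := by
    refine le_trans (Finset.sum_le_sum fun i hi => ?_) (hcount _ (by positivity))
    rw [Finset.mem_Ico] at hi
    have hi0 := ht.trans hi.1
    refine (ex_removedSafe_le hz (h6 i hi0)).trans ?_
    obtain ⟨r1, r2⟩ := hrare i hi0 (hi.2.le.trans hnL)
    gcongr
  have hb0 := b.cast_nonneg (α := ℝ)
  have hfew' := mul_le_mul_of_nonneg_left (hfew.trans hεn) hb0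
  have hrem'' := mul_le_mul_of_nonneg_left (show ∑ i ∈ Finset.Ico t n,
    removedSafe H O (x i) (x (i + 1)) ≤ (2 ^ M * (M * κ) ^ 2 + 1) * (ε * n) by linarith) hb0
  have hfinal : ∑ v ∈ O, wt a (x n) v ≤
      C * (1 / l) * n + A₁ * (ε * n) + X * ((1 - q) * totalWt a (x n)) := by
    rw [hA₁]
    linarith
  rw [one_sub_prOff hT.ne' (hOV n hn₀n), div_le_iff₀ hT]
  refine hfinal.trans ?_
  have h7 : C * (1 / l) * n + A₁ * (ε * n) ≤ (C + A₁) * (1 / l + ε) * n := by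
    have : 0 ≤ 1 / (l : ℝ) := by positivity
    have n0 : (0 : ℝ) ≤ n := Nat.cast_nonneg n
    have i1 : 0 ≤ C * ε * n := by positivity
    have i2 : 0 ≤ A₁ * (1 / l) * n := by positivity
    linarith
  have h8 : (C + A₁) * (1 / l + ε) * n ≤ (C + A₁) / η * (1 / l + ε) * totalWt a (x n) := by
    have e : (C + A₁) * (1 / l + ε) * n = (C + A₁) / η * (1 / l + ε) * (η * n) := by field_simp
    rw [e]
    gcongr
  linarith

end IsRegular

end GeneSCs

/-! ### Collisions and adjacent picks are asymptotically rare -/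

namespace GeneSCs

section Total

variable {a : ℝ} {S : Facets}

theorem collisionOff_empty_le (ha : 0 ≤ a) {H O : Finset ℕ} (hHO : H ⊆ O) :
    collisionOff a ∅ S ≤ (∑ v ∈ vertices S, pr a S v - prOff a O S) + collisionOff a H S := by
  rw [collisionOff, prOff, collisionOff, ← Finset.sum_sub_distrib, ← Finset.sum_add_distrib]
  refine Finset.sum_le_sum fun v _ => ?_
  have h0 := pr_nonneg (S := S) ha v
  have h1 := pr_le_one (S := S) ha v
  rw [off_of_notMem (Finset.notMem_empty v)]
  by_cases hv : v ∈ O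
  · rw [off_of_mem hv]
    nlinarith [mul_nonneg (sq_nonneg (pr a S v)) (off_nonneg H v)]
  · rw [off_of_notMem hv, off_of_notMem fun h => hv (hHO h)]
    linarith

/-- A pair with a member in `O` costs at most twice the share of `O`; any other pair is off `O` and
hence off `H`. -/
theorem prAdjOff_empty_le (ha : 0 ≤ a) {H O : Finset ℕ} (hHO : H ⊆ O) :
    prAdjOff a ∅ ∅ S ≤
      2 * (∑ v ∈ vertices S, pr a S v - prOff a O S) + prAdjOff a O H S := by
  have hp := fun v => pr_nonneg (S := S) ha v
  have hs := sum_pr_le_one a S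
  set r : ℕ → ℝ := fun v => pr a S v * (1 - off O v) with hr
  have hr0 : ∀ v, 0 ≤ r v := fun v => mul_nonneg (hp v) (sub_nonneg.2 (off_le_one O v))
  have hrs : ∑ v ∈ vertices S, r v = ∑ v ∈ vertices S, pr a S v - prOff a O S := by
    rw [prOff, ← Finset.sum_sub_distrib]
    exact Finset.sum_congr rfl fun v _ => by simp only [hr]; ring
  have key : ∀ u ∈ vertices S, ∀ v ∈ vertices S, pr a S u * pr a S v * adjOff ∅ ∅ S u v ≤
      r u * pr a S v + pr a S u * r v + pr a S u * pr a S v * adjOff O H S u v := by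
    intro u _ v _
    have n1 := mul_nonneg (hr0 u) (hp v)
    have n2 := mul_nonneg (hp u) (hr0 v)
    have n3 := mul_nonneg (mul_nonneg (hp u) (hp v)) (adjOff_nonneg O H S u v)
    have n4 := mul_nonneg (hp u) (hp v)
    have n5 : adjOff ∅ ∅ S u v ≤ 1 := by
      unfold adjOff
      split_ifs <;> norm_num
    by_cases hu : u ∈ O
    · have : r u = pr a S u := by simp only [hr]; rw [off_of_mem hu]; ring
      rw [this] at n1 ⊢
      nlinarith
    · by_cases hv : v ∈ O
      · have : r v = pr a S v := by simp only [hr]; rw [off_of_mem hv]; ring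
        rw [this] at n2 ⊢
        nlinarith
      · have : adjOff ∅ ∅ S u v = adjOff O H S u v := by
          unfold adjOff
          by_cases hh : u ≠ v ∧ Adj S u v
          · rw [if_pos ⟨hh.1, Finset.notMem_empty u, Finset.notMem_empty v, hh.2⟩,
              if_pos ⟨hh.1, hu, fun h => hv (hHO h), hh.2⟩]
          · rw [if_neg fun h => hh ⟨h.1, h.2.2.2⟩, if_neg fun h => hh ⟨h.1, h.2.2.2⟩]
        rw [this]
        linarith
  calc prAdjOff a ∅ ∅ S ≤ ∑ u ∈ vertices S, ∑ v ∈ vertices S,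
        (r u * pr a S v + pr a S u * r v + pr a S u * pr a S v * adjOff O H S u v) :=
        Finset.sum_le_sum fun u hu => Finset.sum_le_sum fun v hv => key u hu v hv
    _ = (∑ u ∈ vertices S, r u) * (∑ v ∈ vertices S, pr a S v) +
        (∑ u ∈ vertices S, pr a S u) * (∑ v ∈ vertices S, r v) + prAdjOff a O H S := by
      simp only [Finset.sum_add_distrib, Finset.sum_mul_sum, prAdjOff]
    _ ≤ (∑ u ∈ vertices S, r u) * 1 + 1 * (∑ v ∈ vertices S, r v) + prAdjOff a O H S := by
      have : 0 ≤ ∑ v ∈ vertices S, r v := Finset.sum_nonneg fun v _ => hr0 v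
      gcongr
    _ = _ := by
      rw [hrs]
      ring

end Total

namespace IsRegular

variable {z : PMF ℕ} {hz : z.support.Finite} {c a : ℝ} {x : ℕ → Facets} {η C κ : ℝ} {b : ℕ}

/-- In the long run, two picks rarely coincide and are rarely adjacent. -/
theorem eventually_rare (h : IsRegular hz c a x η C κ b) (ha : 0 ≤ a) (hc : 0 < c)
    (hz0 : ∀ m ∈ z.support, m ≠ 0) (hctl : IsControlled hz c a x) {ε : ℝ} (hε : 0 < ε) :
    ∀ᶠ n : ℕ in atTop, collisionOff a ∅ (x n) ≤ ε ∧ prAdjOff a ∅ ∅ (x n) ≤ ε := by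
  obtain ⟨q, A, hq0, hq1, hA, Λ, hcon⟩ := h.exists_contraction ha hc hz0 hctl
  obtain ⟨l₀, hl₀⟩ := exists_nat_gt (8 * A / (q * ε))
  -- At least `2`, so that consecutive windows overlap despite rounding in `n / l ^ j`; `l₀` makes
  -- the contribution of the old weight small.
  set l := Λ + l₀ + 2 with hl
  have hl0 : 0 < l := by omega
  have hl0' : (0 : ℝ) < l := by exact_mod_cast hl0
  have hlε : A * (1 / l) / q ≤ ε / 8 := by
    rw [div_lt_iff₀ (by positivity)] at hl₀
    have : (l₀ : ℝ) ≤ l := by exact_mod_cast (by omega : l₀ ≤ l)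
    have : (l₀ : ℝ) * (q * ε) ≤ l * (q * ε) := by gcongr
    rw [mul_one_div, div_div, div_le_iff₀ (by positivity)]
    linarith
  obtain ⟨j, hj⟩ := exists_pow_lt_of_lt_one (show 0 < ε / 8 by positivity)
    (show 1 - q < 1 by linarith)
  set ε' : ℝ := min (ε / 8) (q * ε / (8 * A)) with hε'
  have hε'0 : 0 < ε' := lt_min (by positivity) (by positivity)
  have hε'1 : ε' ≤ ε / 8 := min_le_left _ _
  have hε'2 : A * ε' / q ≤ ε / 8 := by
    have h1 : A * ε' ≤ A * (q * ε / (8 * A)) := mul_le_mul_of_nonneg_left (min_le_right _ _) hA.le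
    rw [div_le_iff₀ hq0]
    refine h1.trans (le_of_eq ?_)
    field_simp
  set L := l ^ (j + 1) with hL
  obtain ⟨P, hPE, hP⟩ := h.exists_levels ha L hctl.mid hctl.light hctl.ordinary hε'0
  have hall : ∀ᶠ n₀ : ℕ in atTop, ∀ p ∈ P,
      2 ^ (heavy a p.1 (x n₀)).card * (((notable a p.2.1 p.2.2 (x n₀)).card : ℝ) + 1) ≤ ε' * n₀ →
      (∀ n, n₀ ≤ n → n ≤ L * n₀ →
        collisionOff a (heavy a p.1 (x n₀)) (x n) ≤ ε' ∧
        prAdjOff a (notable a p.2.1 p.2.2 (x n₀)) (heavy a p.1 (x n₀)) (x n) ≤ ε') →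
      ∀ (t : ℕ) (X : ℝ), n₀ ≤ t → 0 ≤ X →
        (∀ n, t ≤ n → n ≤ L * n₀ → 1 - prOff a (notable a p.2.1 p.2.2 (x n₀)) (x n) ≤ X) →
        ∀ n, l * t ≤ n → n ≤ L * n₀ →
          1 - prOff a (notable a p.2.1 p.2.2 (x n₀)) (x n) ≤ (1 - q) * X + A * (1 / l + ε') :=
    (Filter.eventually_all_finset _).2 fun p hp =>
      hcon l (by omega) hl0 L p.1 p.2.1 p.2.2 (hPE p hp) ε' hε'0
  have hwin : ∀ᶠ n₀ : ℕ in atTop, ∀ n, l ^ j * n₀ ≤ n → n ≤ L * n₀ →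
      collisionOff a ∅ (x n) ≤ ε ∧ prAdjOff a ∅ ∅ (x n) ≤ ε := by
    filter_upwards [hP, hall, eventually_forall_ge_atTop.2 h.spread] with n₀ hP hall hspr n hn hnL
    obtain ⟨p, hp, hfew, hrare⟩ := hP
    have hstep := hall p hp hfew hrare
    set H := heavy a p.1 (x n₀) with hH
    set O := notable a p.2.1 p.2.2 (x n₀) with hO
    have hHO : H ⊆ O := (heavy_mono ha (hPE p hp) _).trans (heavy_subset_notable a _ _ _)
    -- The fixed point of `X ↦ (1 - q) * X + A * (1 / l + ε')`.
    set θ := A * (1 / l + ε') / q with hθ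
    have hθ0 : 0 ≤ θ := by positivity
    have hθq : θ * q = A * (1 / l + ε') := div_mul_cancel₀ _ hq0.ne'
    have hiter : ∀ i, ∀ m, l ^ i * n₀ ≤ m → m ≤ L * n₀ → 1 - prOff a O (x m) ≤ (1 - q) ^ i + θ := by
      intro i
      induction i with
      | zero =>
        intro m _ _
        have := prOff_nonneg ha O (x m)
        rw [pow_zero]
        linarith
      | succ i ih =>
        intro m hm hmL
        have h1 := hstep (l ^ i * n₀) ((1 - q) ^ i + θ)
          (Nat.le_mul_of_pos_left n₀ (Nat.pow_pos hl0))
          (add_nonneg (pow_nonneg (by linarith) i) hθ0) ih m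
          (by rwa [← mul_assoc, ← pow_succ']) hmL
        refine h1.trans (le_of_eq ?_)
        rw [pow_succ', ← hθq]
        ring
    have hn₀ : n₀ ≤ n := (Nat.le_mul_of_pos_left n₀ (Nat.pow_pos hl0)).trans hn
    have h1 := hiter j n hn hnL
    have h2 : θ ≤ ε / 4 := by
      have : θ = A * (1 / l) / q + A * ε' / q := by rw [hθ]; ring
      linarith
    obtain ⟨h3, h4⟩ := hrare n hn₀ hnL
    have h5 := sum_pr (hspr n hn₀).totalWt_pos.ne'
    have h6 := collisionOff_empty_le (S := x n) ha hHO
    have h7 := prAdjOff_empty_le (S := x n) ha hHO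
    rw [h5] at h6 h7
    constructor <;> linarith
  obtain ⟨N, hN⟩ := eventually_atTop.1 hwin
  have hlj : 0 < l ^ j := Nat.pow_pos hl0
  filter_upwards [eventually_ge_atTop (l ^ j * (N + 1))] with n hn
  -- Every large `n` lies in the final part `[l ^ j * n₀, l ^ (j + 1) * n₀]` of the window starting
  -- at `n₀ = n / l ^ j`, after `j` contractions.
  have h1 : N + 1 ≤ n / l ^ j := (Nat.le_div_iff_mul_le hlj).2 (by rwa [mul_comm])
  refine hN (n / l ^ j) (by omega) n (Nat.mul_div_le n _) ?_
  have h2 : n < l ^ j * (n / l ^ j + 1) := Nat.lt_mul_div_succ n hlj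
  rw [hL, pow_succ, mul_assoc]
  refine h2.le.trans (Nat.mul_le_mul_left _ ?_)
  calc n / l ^ j + 1 ≤ 2 * (n / l ^ j) := by omega
    _ ≤ l * (n / l ^ j) := Nat.mul_le_mul_right _ (by omega)

end IsRegular

end GeneSCs

/-! ### Mean increments of the statistics -/

namespace GeneSCs

/-- The indicator function of the vertices that are facets. -/
noncomputable def single (S : Facets) (v : ℕ) : ℝ := if {v} ∈ S then 1 else 0

/-- An upper bound for the probability that the facet of the next step is comparable with some
facet. -/
noncomputable def clashBound (a : ℝ) (M : ℕ) (κ : ℝ) (S : Facets) : ℝ :=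
  (M * κ) ^ 2 * prAdjOff a ∅ ∅ S + M * κ * ∑ v ∈ vertices S, pr a S v * single S v

/-- The mean number of new vertices of a step. -/
noncomputable def meanNew (z : PMF ℕ) (c : ℝ) (S : Facets) : ℝ :=
  ex z fun m => (newCount c S m : ℝ)

/-- The number of vertices of facet degree `k`. -/
noncomputable def degreeCount (k : ℕ) (S : Facets) : ℝ :=
  ((vertices S).filter fun v => facetDegree S v = k).card

/-- The sum of the facet sizes. -/
noncomputable def sizeSum (S : Facets) : ℝ := ∑ F ∈ S, (F.card : ℝ)

/-- The number of vertices, as a real number. -/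
noncomputable def vertexCount (S : Facets) : ℝ := (vertices S).card

/-- The number of facets, as a real number. -/
noncomputable def facetCount (S : Facets) : ℝ := S.card

section OneStep

variable {z : PMF ℕ} {c a κ : ℝ} {S : Facets}

theorem single_nonneg (S : Facets) (v : ℕ) : 0 ≤ single S v := by
  unfold single; split_ifs <;> norm_num

/-- The smaller of two comparable facets consists of picked old vertices. If it has at least two
vertices, it contains an adjacent pair; otherwise it is an existing facet with one vertex. -/
theorem one_le_clash {A G : Finset ℕ} (h0 : ∅ ∉ S) (hG : 2 ≤ G.card) (hA : G ∩ vertices S = A)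
    {F : Finset ℕ} (hF : F ∈ S) (h : F ⊆ G ∨ G ⊆ F) :
    1 ≤ ∑ u ∈ A, ∑ v ∈ A, adjOff ∅ ∅ S u v + ∑ v ∈ A, single S v := by
  have n1 : 0 ≤ ∑ u ∈ A, ∑ v ∈ A, adjOff ∅ ∅ S u v := Finset.sum_nonneg fun u _ =>
    Finset.sum_nonneg fun v _ => adjOff_nonneg _ _ S u v
  have n2 : 0 ≤ ∑ v ∈ A, single S v := Finset.sum_nonneg fun v _ => single_nonneg S v
  have hsub : ∀ B : Finset ℕ, B ⊆ F → B ⊆ A → 2 ≤ B.card →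
      1 ≤ ∑ u ∈ A, ∑ v ∈ A, adjOff ∅ ∅ S u v := fun B h1 h2 h3 =>
    one_le_sum_adjOff hF h1 h2 (fun h => by
      rw [Finset.subset_empty.1 h, Finset.card_empty] at h3
      omega) (by rwa [Finset.sdiff_empty])
  rcases h with h | h
  · have hFA : F ⊆ A := hA ▸ Finset.subset_inter h (subset_vertices hF)
    rcases Nat.lt_or_ge F.card 2 with h2 | h2
    · have hF1 : F.card = 1 := by
        have : F.card ≠ 0 := fun hc => h0 (Finset.card_eq_zero.1 hc ▸ hF)
        omega
      obtain ⟨v, rfl⟩ := Finset.card_eq_one.1 hF1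
      have h3 : single S v = 1 := if_pos hF
      have h4 := Finset.single_le_sum (f := single S) (fun w _ => single_nonneg S w)
        (Finset.singleton_subset_iff.1 hFA)
      linarith
    · linarith [hsub F subset_rfl hFA h2]
  · have hGA : G = A := by
      rw [← hA]
      exact (Finset.inter_eq_left.2 (h.trans (subset_vertices hF))).symm
    linarith [hsub G h hGA.subset hG]

/-- The effect of a step may be computed as if the new facet were incomparable with all others, at
the cost of `B` times a bound for the probability of the contrary. -/
theorem abs_ex_step_sub_le (hz : z.support.Finite) (hz2 : ∀ m ∈ z.support, 2 ≤ m)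
    (h : Spread a (maxSize hz) κ S) (h0 : ∅ ∉ S) {f : Facets → ℝ} {g : ℕ → Finset ℕ → ℝ} {B : ℝ}
    (hB : 0 ≤ B)
    (hle : ∀ m ∈ z.support, ∀ A ⊆ vertices S, A.card = m - newCount c S m →
      |f (addFacet S (A ∪ freshVertices S (newCount c S m))) - g m A| ≤ B)
    (heq : ∀ m ∈ z.support, ∀ A ⊆ vertices S, A.card = m - newCount c S m →
      (∀ F ∈ S, ¬ F ⊆ A ∪ freshVertices S (newCount c S m) ∧
        ¬ A ∪ freshVertices S (newCount c S m) ⊆ F) →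
      f (addFacet S (A ∪ freshVertices S (newCount c S m))) = g m A) :
    |ex (step z c a S) f - ex z fun m => ex (picks a S (m - newCount c S m)) (g m)| ≤
      B * clashBound a (maxSize hz) κ S := by
  set M := maxSize hz with hM
  have ha := h.nonneg
  have hκ := h.one_le
  have hV : ∀ m ∈ z.support, m ≤ (vertices S).card := fun m hm =>
    (le_maxSize hz hm).trans h.card_lt.le
  let K : Finset ℕ → ℝ := fun A =>
    ∑ u ∈ A, ∑ v ∈ A, adjOff ∅ ∅ S u v + ∑ v ∈ A, single S v
  have hK0 : ∀ A, 0 ≤ K A := fun A => add_nonneg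
    (Finset.sum_nonneg fun u _ => Finset.sum_nonneg fun v _ => adjOff_nonneg _ _ S u v)
    (Finset.sum_nonneg fun v _ => single_nonneg S v)
  have hfg : ∀ m ∈ z.support, ∀ A ⊆ vertices S, A.card = m - newCount c S m →
      |f (addFacet S (A ∪ freshVertices S (newCount c S m))) - g m A| ≤ B * K A := by
    intro m hm A hA hAm
    by_cases hc : ∀ F ∈ S, ¬ F ⊆ A ∪ freshVertices S (newCount c S m) ∧
        ¬ A ∪ freshVertices S (newCount c S m) ⊆ F
    · rw [heq m hm A hA hAm hc, sub_self, abs_zero]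
      exact mul_nonneg hB (hK0 A)
    · push Not at hc
      obtain ⟨F, hF, hcmp⟩ := hc
      have hcard : (A ∪ freshVertices S (newCount c S m)).card = m := by
        rw [card_union_freshVertices hA]
        have := newCount_le c S m
        omega
      have h1 := one_le_clash h0 (hcard ▸ hz2 m hm) (union_freshVertices_inter hA _) hF
        (by tauto)
      exact (hle m hm A hA hAm).trans (le_mul_of_one_le_right hB h1)
  have hKex : (ex z fun m => ex (picks a S (m - newCount c S m)) K) ≤ clashBound a M κ S := by
    refine ex_le_const hz fun m hm => ?_
    have hmM : m - newCount c S m ≤ M := (Nat.sub_le _ _).trans (le_maxSize hz hm)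
    have hmM' : ((m - newCount c S m : ℕ) : ℝ) ≤ M := by exact_mod_cast hmM
    simp only [K]
    rw [ex_add (finite_support_picks S _)]
    have h1 := h.ex_picks_pairs_le hmM (adjOff_nonneg ∅ ∅ S) (adjOff_self ∅ ∅ S)
    have h2 := h.ex_picks_sum_le hmM (single_nonneg S)
    change _ ≤ (((m - newCount c S m : ℕ) : ℝ) * κ) ^ 2 * prAdjOff a ∅ ∅ S at h1
    have h3 := prAdjOff_nonneg ha ∅ ∅ S
    have h4 : 0 ≤ ∑ v ∈ vertices S, pr a S v * single S v := Finset.sum_nonneg fun v _ =>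
      mul_nonneg (pr_nonneg ha v) (single_nonneg S v)
    refine (add_le_add h1 h2).trans ?_
    unfold clashBound
    gcongr
  have hBK : ∀ m, ex (picks a S (m - newCount c S m)) (fun A => B * K A) =
      B * ex (picks a S (m - newCount c S m)) K := fun m => ex_mul_left _ _ _
  have hup := ex_step_mono (c := c) hz ha hV (f := f) (g := fun m A => g m A + B * K A)
    fun m hm A hA hAm => by linarith [(abs_le.1 (hfg m hm A hA hAm)).2]
  have hlo := le_ex_step (c := c) hz ha hV (f := f) (g := fun m A => g m A - B * K A)
    fun m hm A hA hAm => by linarith [(abs_le.1 (hfg m hm A hA hAm)).1]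
  simp only [ex_add (finite_support_picks S _), ex_sub (finite_support_picks S _), hBK] at hup hlo
  rw [ex_add hz, ex_mul_left] at hup
  rw [ex_sub hz, ex_mul_left] at hlo
  have h5 := mul_le_mul_of_nonneg_left hKex hB
  rw [abs_le]
  constructor <;> linarith

theorem sum_addFacet_of_incomparable {G : Finset ℕ} (h : ∀ F ∈ S, ¬ F ⊆ G ∧ ¬ G ⊆ F)
    (w : Finset ℕ → ℝ) : ∑ F ∈ addFacet S G, w F = ∑ F ∈ S, w F + w G := by
  obtain ⟨h1, h2⟩ := addFacet_of_incomparable h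
  rw [h1, Finset.sum_insert h2, add_comm]

theorem abs_sum_addFacet_sub_le {G : Finset ℕ} {M : ℕ} (hG : G.card ≤ M) {w : Finset ℕ → ℝ} {B : ℝ}
    (hw : ∀ F, F.card ≤ M → |w F| ≤ B) :
    |∑ F ∈ addFacet S G, w F - ∑ F ∈ S, w F| ≤ (2 ^ M + 1) * B := by
  have hB : 0 ≤ B := (abs_nonneg _).trans (hw G hG)
  have e : ∑ F ∈ addFacet S G, w F - ∑ F ∈ S, w F =
      ∑ F ∈ addFacet S G \ S, w F - ∑ F ∈ S \ addFacet S G, w F := by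
    rw [← Finset.sum_sdiff_sub_sum_sdiff]
  have h1 : |∑ F ∈ addFacet S G \ S, w F| ≤ B := by
    rw [sum_addFacet_sdiff]
    split_ifs
    · rwa [abs_zero]
    · exact hw G hG
  have h2 : |∑ F ∈ S \ addFacet S G, w F| ≤ 2 ^ M * B := by
    have hsub : S \ addFacet S G ⊆ G.powerset := fun F hF =>
      Finset.mem_powerset.2 (Finset.mem_filter.1 (sdiff_addFacet_subset S G hF)).2
    have hcard : ((S \ addFacet S G).card : ℝ) ≤ 2 ^ M := by
      have : (S \ addFacet S G).card ≤ 2 ^ M := by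
        refine (Finset.card_le_card hsub).trans ?_
        rw [Finset.card_powerset]
        exact Nat.pow_le_pow_right (by norm_num) hG
      exact_mod_cast this
    refine (Finset.abs_sum_le_sum_abs _ _).trans ?_
    refine (Finset.sum_le_card_nsmul _ _ B fun F hF => hw F ?_).trans ?_
    · exact (Finset.card_le_card (Finset.mem_powerset.1 (hsub hF))).trans hG
    · rw [nsmul_eq_mul]
      gcongr
  rw [e]
  refine (abs_sub _ _).trans ?_
  linarith

theorem abs_sum_sub_le (hz : z.support.Finite) {w : Finset ℕ → ℝ} {B : ℝ}
    (hw : ∀ F, F.card ≤ maxSize hz → |w F| ≤ B) {S' : Facets}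
    (hS' : S' ∈ (step z c a S).support) :
    |∑ F ∈ S', w F - ∑ F ∈ S, w F| ≤ (2 ^ maxSize hz + 1) * B := by
  obtain ⟨G, hG, _, rfl⟩ := mem_support_step hS'
  exact abs_sum_addFacet_sub_le (le_maxSize hz hG) hw

/-- The mean increment of a sum over the facets of a function of their size. -/
theorem abs_ex_sum_sub_le (hz : z.support.Finite) (hz2 : ∀ m ∈ z.support, 2 ≤ m)
    (h : Spread a (maxSize hz) κ S) (h0 : ∅ ∉ S) {w : ℕ → ℝ} {B : ℝ}
    (hw : ∀ m ≤ maxSize hz, |w m| ≤ B) :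
    |ex (step z c a S) (fun S' => ∑ F ∈ S', w F.card - ∑ F ∈ S, w F.card) - ex z w| ≤
      (2 ^ maxSize hz + 2) * B * clashBound a (maxSize hz) κ S := by
  set M := maxSize hz with hM
  have hB : 0 ≤ B := (abs_nonneg _).trans (hw 0 (Nat.zero_le _))
  have hcard : ∀ m A, A ⊆ vertices S → A.card = m - newCount c S m →
      (A ∪ freshVertices S (newCount c S m)).card = m := fun m A hA hAm => by
    rw [card_union_freshVertices hA]
    have := newCount_le c S m
    omega
  have key := abs_ex_step_sub_le (c := c) hz hz2 h h0
    (f := fun S' => ∑ F ∈ S', w F.card - ∑ F ∈ S, w F.card) (g := fun m _ => w m)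
    (B := (2 ^ M + 2) * B) (by positivity)
    (fun m hm A hA hAm => by
      have hmM := le_maxSize hz hm
      have h1 := abs_sum_addFacet_sub_le (S := S) (w := fun F => w F.card)
        ((hcard m A hA hAm).trans_le hmM) fun F hF => hw _ hF
      have h2 := hw m hmM
      refine (abs_sub _ _).trans ?_
      linarith)
    (fun m hm A hA hAm hinc => by
      rw [sum_addFacet_of_incomparable hinc fun F => w F.card, hcard m A hA hAm]
      ring)
  simp only [ex_const (finite_support_picks S _)] at key
  exact key

/-- Exact, with no error for subsumption, which never changes the set of vertices. -/
theorem ex_vertexCount_sub (hz : z.support.Finite) (ha : 0 ≤ a)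
    (hV : ∀ m ∈ z.support, m ≤ (vertices S).card) :
    ex (step z c a S) (fun S' => vertexCount S' - vertexCount S) = meanNew z c S := by
  have e : ∀ m ∈ z.support, ∀ A ⊆ vertices S, A.card = m - newCount c S m →
      vertexCount (addFacet S (A ∪ freshVertices S (newCount c S m))) - vertexCount S =
        newCount c S m := by
    intro m _ A hA _
    unfold vertexCount
    rw [vertices_addFacet, ← Finset.union_assoc, Finset.union_eq_left.2 hA,
      card_union_freshVertices subset_rfl]
    push_cast
    ring
  have h1 := ex_step_mono (c := c) hz ha hV (f := fun S' => vertexCount S' - vertexCount S)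
    (g := fun m _ => newCount c S m) fun m hm A hA hAm => (e m hm A hA hAm).le
  have h2 := le_ex_step (c := c) hz ha hV (f := fun S' => vertexCount S' - vertexCount S)
    (g := fun m _ => newCount c S m) fun m hm A hA hAm => (e m hm A hA hAm).ge
  simp only [ex_const (finite_support_picks S _)] at h1 h2
  exact le_antisymm h1 h2

theorem abs_vertexCount_sub_le (hz : z.support.Finite) {S' : Facets}
    (hS' : S' ∈ (step z c a S).support) : |vertexCount S' - vertexCount S| ≤ maxSize hz := by
  obtain ⟨G, hG, _, rfl⟩ := mem_support_step hS'
  have h1 : (vertices S).card ≤ (vertices (addFacet S G)).card := by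
    rw [vertices_addFacet]
    exact Finset.card_le_card Finset.subset_union_left
  have h2 : (vertices (addFacet S G)).card ≤ (vertices S).card + maxSize hz := by
    rw [vertices_addFacet]
    exact (Finset.card_union_le _ _).trans (Nat.add_le_add_left (le_maxSize hz hG) _)
  have h1' : vertexCount S ≤ vertexCount (addFacet S G) := Nat.cast_le.2 h1
  have h2' : vertexCount (addFacet S G) ≤ vertexCount S + maxSize hz := by
    unfold vertexCount
    exact_mod_cast h2
  rw [abs_le]
  constructor <;> linarith

/-- The indicator function of the vertices of facet degree `k`. -/
noncomputable def hasDegree (k : ℕ) (S : Facets) (v : ℕ) : ℝ := if facetDegree S v = k then 1 else 0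

theorem hasDegree_nonneg (k : ℕ) (S : Facets) (v : ℕ) : 0 ≤ hasDegree k S v := by
  unfold hasDegree; split_ifs <;> norm_num

theorem hasDegree_le_one (k : ℕ) (S : Facets) (v : ℕ) : hasDegree k S v ≤ 1 := by
  unfold hasDegree; split_ifs <;> norm_num

theorem degreeCount_succ_eq {k : ℕ} {W : Finset ℕ} (hW : vertices S ⊆ W) :
    degreeCount (k + 1) S = ∑ v ∈ W, hasDegree (k + 1) S v := by
  rw [degreeCount, ← Finset.sum_boole]
  refine Finset.sum_subset hW fun v _ hv => if_neg ?_
  rw [facetDegree_eq_zero hv]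
  omega

theorem degreeCount_addFacet_sub (k : ℕ) (G : Finset ℕ) :
    degreeCount (k + 1) (addFacet S G) - degreeCount (k + 1) S =
      ∑ v ∈ G, (hasDegree (k + 1) (addFacet S G) v - hasDegree (k + 1) S v) := by
  have hW : vertices (addFacet S G) = (vertices S \ G) ∪ G := by
    rw [vertices_addFacet, Finset.sdiff_union_self_eq_union]
  rw [degreeCount_succ_eq hW.subset, degreeCount_succ_eq (S := S) (W := (vertices S \ G) ∪ G)
    (by rw [Finset.sdiff_union_self_eq_union]; exact Finset.subset_union_left),
    ← Finset.sum_sub_distrib, Finset.sum_union Finset.sdiff_disjoint, add_eq_right]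
  refine Finset.sum_eq_zero fun v hv => ?_
  rw [hasDegree, hasDegree, facetDegree_addFacet_of_notMem (Finset.mem_sdiff.1 hv).2, sub_self]

theorem abs_degreeCount_addFacet_sub_le (k : ℕ) (G : Finset ℕ) :
    |degreeCount (k + 1) (addFacet S G) - degreeCount (k + 1) S| ≤ G.card := by
  rw [degreeCount_addFacet_sub]
  refine (Finset.abs_sum_le_sum_abs _ _).trans ?_
  rw [← mul_one (G.card : ℝ), ← nsmul_eq_mul]
  refine Finset.sum_le_card_nsmul _ _ _ fun v _ => ?_
  rw [abs_le]
  constructor <;> linarith [hasDegree_nonneg (k + 1) (addFacet S G) v, hasDegree_nonneg (k + 1) S v,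
    hasDegree_le_one (k + 1) (addFacet S G) v, hasDegree_le_one (k + 1) S v]

theorem abs_degreeCount_sub_le (hz : z.support.Finite) (k : ℕ) {S' : Facets}
    (hS' : S' ∈ (step z c a S).support) :
    |degreeCount (k + 1) S' - degreeCount (k + 1) S| ≤ maxSize hz := by
  obtain ⟨G, hG, _, rfl⟩ := mem_support_step hS'
  exact (abs_degreeCount_addFacet_sub_le k G).trans (by exact_mod_cast le_maxSize hz hG)

theorem sum_pr_mul_hasDegree (k : ℕ) :
    ∑ v ∈ vertices S, pr a S v * hasDegree k S v = (k + a) * degreeCount k S / totalWt a S := by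
  rw [degreeCount, ← Finset.sum_boole, Finset.mul_sum, Finset.sum_div]
  refine Finset.sum_congr rfl fun v hv => ?_
  rw [pr, wt_of_mem hv, hasDegree]
  split_ifs with h
  · rw [h]
    ring
  · simp

theorem Spread.abs_ex_picks_sum_sub_le {M : ℕ} (h : Spread a M κ S) {m : ℕ} (hm : m ≤ M)
    {g : ℕ → ℝ} (hg : ∀ v, 0 ≤ g v) (hg1 : ∀ v, g v ≤ 1) :
    |ex (picks a S m) (fun A => ∑ v ∈ A, g v) - m * ∑ v ∈ vertices S, pr a S v * g v| ≤
      M ^ 2 * κ ^ 2 * collisionOff a ∅ S := by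
  have hκ := h.one_le
  have hc : ∑ v ∈ vertices S, pr a S v ^ 2 = collisionOff a ∅ S :=
    Finset.sum_congr rfl fun v _ => by rw [off_of_notMem (Finset.notMem_empty v), mul_one]
  have hc0 := collisionOff_nonneg a ∅ S
  have h1 := h.ex_picks_sum_le' hm hg hg1
  have h2 := h.le_ex_picks_sum hm hg
  have h3 : ∑ v ∈ vertices S, pr a S v ^ 2 * g v ≤ collisionOff a ∅ S := by
    rw [← hc]
    exact Finset.sum_le_sum fun v _ => mul_le_of_le_one_right (sq_nonneg _) (hg1 v)
  have h3' : 0 ≤ ∑ v ∈ vertices S, pr a S v ^ 2 * g v :=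
    Finset.sum_nonneg fun v _ => mul_nonneg (sq_nonneg _) (hg v)
  rw [hc] at h1
  have hmM : (m : ℝ) ≤ M := by exact_mod_cast hm
  have hκ2 : κ ≤ κ ^ 2 := by nlinarith
  have h4 : (m : ℝ) ^ 2 * κ ^ 2 * collisionOff a ∅ S ≤ M ^ 2 * κ ^ 2 * collisionOff a ∅ S := by
    gcongr
  have h5 : (m : ℝ) ^ 2 * κ * ∑ v ∈ vertices S, pr a S v ^ 2 * g v ≤
      M ^ 2 * κ ^ 2 * collisionOff a ∅ S := by
    gcongr
  rw [abs_le]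
  constructor <;> linarith

/-- The mean increment of the number of vertices of a given facet degree. -/
theorem abs_ex_degreeCount_sub_le (hz : z.support.Finite) (hz2 : ∀ m ∈ z.support, 2 ≤ m)
    (h : Spread a (maxSize hz) κ S) (h0 : ∅ ∉ S) (k : ℕ) :
    |ex (step z c a S) (fun S' => degreeCount (k + 1) S' - degreeCount (k + 1) S) -
      ((ex z (fun m => (m : ℝ)) - meanNew z c S) * ((k + a) * degreeCount k S / totalWt a S -
        (k + 1 + a) * degreeCount (k + 1) S / totalWt a S) +
        meanNew z c S * if k = 0 then 1 else 0)| ≤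
      3 * maxSize hz * clashBound a (maxSize hz) κ S +
        2 * (maxSize hz ^ 2 * κ ^ 2 * collisionOff a ∅ S) := by
  set M := maxSize hz with hM
  set g : ℕ → Finset ℕ → ℝ := fun m A => (∑ v ∈ A, hasDegree k S v -
    ∑ v ∈ A, hasDegree (k + 1) S v) + newCount c S m * if k = 0 then 1 else 0 with hg
  set P : ℝ := (k + a) * degreeCount k S / totalWt a S -
        (k + 1 + a) * degreeCount (k + 1) S / totalWt a S with hP
  have hcard : ∀ m A, A ⊆ vertices S → A.card = m - newCount c S m →
      (A ∪ freshVertices S (newCount c S m)).card = m := fun m A hA hAm => by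
    rw [card_union_freshVertices hA]
    have := newCount_le c S m
    omega
  have hgG : ∀ m A, A ⊆ vertices S → g m A = ∑ v ∈ A ∪ freshVertices S (newCount c S m),
      (hasDegree k S v - hasDegree (k + 1) S v) := by
    intro m A hA
    rw [Finset.sum_union (disjoint_freshVertices hA _), Finset.sum_sub_distrib]
    simp only [hg]
    congr 1
    have : ∀ v ∈ freshVertices S (newCount c S m), hasDegree k S v - hasDegree (k + 1) S v =
        if k = 0 then 1 else 0 := by
      intro v hv
      have hd := facetDegree_eq_zero fun hv' : v ∈ vertices S => notMem_freshVertices hv' hv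
      rw [hasDegree, hasDegree, hd, if_neg (show ¬ (0 = k + 1) by omega), sub_zero]
      simp [eq_comm]
    rw [Finset.sum_congr rfl this, Finset.sum_const, card_freshVertices, nsmul_eq_mul]
  have key := abs_ex_step_sub_le (c := c) hz hz2 h h0
    (f := fun S' => degreeCount (k + 1) S' - degreeCount (k + 1) S) (g := g)
    (B := 3 * M) (by positivity)
    (fun m hm A hA hAm => by
      have hmM : (m : ℝ) ≤ M := by exact_mod_cast le_maxSize hz hm
      have h1 := abs_degreeCount_addFacet_sub_le (S := S) k
        (A ∪ freshVertices S (newCount c S m))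
      have h2 : |g m A| ≤ (A ∪ freshVertices S (newCount c S m)).card := by
        rw [hgG m A hA]
        refine (Finset.abs_sum_le_sum_abs _ _).trans ?_
        rw [← mul_one (Finset.card _ : ℝ), ← nsmul_eq_mul]
        refine Finset.sum_le_card_nsmul _ _ _ fun v _ => ?_
        rw [abs_le]
        constructor <;> linarith [hasDegree_nonneg (k + 1) S v, hasDegree_nonneg k S v,
          hasDegree_le_one (k + 1) S v, hasDegree_le_one k S v]
      rw [hcard m A hA hAm] at h1 h2
      refine (abs_sub _ _).trans ?_
      linarith [M.cast_nonneg (α := ℝ)])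
    (fun m hm A hA hAm hinc => by
      rw [degreeCount_addFacet_sub, hgG m A hA]
      refine Finset.sum_congr rfl fun v hv => ?_
      have hd := facetDegree_addFacet_of_incomparable hinc hv
      congr 1
      unfold hasDegree
      rw [hd]
      simp)
  have hgex : ∀ m ∈ z.support, |ex (picks a S (m - newCount c S m)) (g m) -
      (((m : ℝ) - newCount c S m) * P + newCount c S m * if k = 0 then 1 else 0)| ≤
      2 * (M ^ 2 * κ ^ 2 * collisionOff a ∅ S) := by
    intro m hm
    have hmM : m - newCount c S m ≤ M := (Nat.sub_le _ _).trans (le_maxSize hz hm)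
    have h1 := h.abs_ex_picks_sum_sub_le hmM (hasDegree_nonneg k S) (hasDegree_le_one k S)
    have h2 := h.abs_ex_picks_sum_sub_le hmM (hasDegree_nonneg (k + 1) S)
      (hasDegree_le_one (k + 1) S)
    rw [sum_pr_mul_hasDegree, Nat.cast_sub (newCount_le c S m)] at h1 h2
    have hfin := finite_support_picks (a := a) S (m - newCount c S m)
    simp only [hg]
    rw [ex_add hfin, ex_sub hfin, ex_const hfin]
    push_cast at h2
    have e : ∀ x y p r q w : ℝ, x - y + w - (q * (p - r) + w) = (x - q * p) - (y - q * r) :=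
      fun x y p r q w => by ring
    rw [hP, e]
    refine (abs_sub _ _).trans ?_
    linarith
  have hsum : |(ex z fun m => ex (picks a S (m - newCount c S m)) (g m)) -
      ((ex z (fun m => (m : ℝ)) - meanNew z c S) * P +
        meanNew z c S * if k = 0 then 1 else 0)| ≤ 2 * (M ^ 2 * κ ^ 2 * collisionOff a ∅ S) := by
    have e : (ex z (fun m => (m : ℝ)) - meanNew z c S) * P +
        meanNew z c S * (if k = 0 then 1 else 0) =
        ex z fun m => ((m : ℝ) - newCount c S m) * P + newCount c S m * if k = 0 then 1 else 0 := by
      have e1 : ∀ m : ℕ, ((m : ℝ) - newCount c S m) * P = P * ((m : ℝ) - newCount c S m) :=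
        fun m => mul_comm _ _
      have e2 : ∀ m : ℕ, (newCount c S m * if k = 0 then (1 : ℝ) else 0) =
        (if k = 0 then (1 : ℝ) else 0) * newCount c S m := fun m => mul_comm _ _
      simp only [e1, e2]
      rw [ex_add hz, ex_mul_left, ex_mul_left, ex_sub hz]
      unfold meanNew
      ring
    rw [e, ← ex_sub hz]
    exact (abs_ex_le hz _).trans (ex_le_const hz hgex)
  refine (abs_sub_le _ (ex z fun m => ex (picks a S (m - newCount c S m)) (g m)) _).trans ?_
  exact add_le_add key hsum

end OneStep

end GeneSCs

/-! ### Deterministic averaging lemmas -/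

namespace GeneSCs

section Sequences

theorem tendsto_sum_div {u : ℕ → ℝ} {l : ℝ} (h : Tendsto u atTop (𝓝 l)) :
    Tendsto (fun n : ℕ => (∑ i ∈ Finset.range n, u i) / n) atTop (𝓝 l) := by
  refine h.cesaro.congr fun n => ?_
  rw [div_eq_inv_mul]

theorem tendsto_const_div (x : ℝ) : Tendsto (fun n : ℕ => x / n) atTop (𝓝 0) :=
  tendsto_const_div_atTop_nhds_zero_nat x

theorem tendsto_div_of_increments {y e : ℕ → ℝ} {l : ℝ}
    (h : Tendsto (fun n : ℕ => (∑ i ∈ Finset.range n, (y (i + 1) - y i - e i)) / n) atTop (𝓝 0))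
    (he : Tendsto (fun n : ℕ => (∑ i ∈ Finset.range n, e i) / n) atTop (𝓝 l)) :
    Tendsto (fun n : ℕ => y n / n) atTop (𝓝 l) := by
  have h1 := ((h.add he).add (tendsto_const_div (y 0)))
  rw [zero_add, add_zero] at h1
  refine h1.congr fun n => ?_
  rw [Finset.sum_sub_distrib, Finset.sum_range_sub]
  ring

/-- Converse to `tendsto_div_of_increments`. It recovers the average number of new vertices per step
from the growth of `|V|`; the individual means need not converge. -/
theorem tendsto_sum_of_div {y e : ℕ → ℝ} {l : ℝ}
    (h : Tendsto (fun n : ℕ => (∑ i ∈ Finset.range n, (y (i + 1) - y i - e i)) / n) atTop (𝓝 0))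
    (hy : Tendsto (fun n : ℕ => y n / n) atTop (𝓝 l)) :
    Tendsto (fun n : ℕ => (∑ i ∈ Finset.range n, e i) / n) atTop (𝓝 l) := by
  have h1 := (hy.sub h).sub (tendsto_const_div (y 0))
  rw [sub_zero, sub_zero] at h1
  refine h1.congr fun n => ?_
  rw [Finset.sum_sub_distrib, Finset.sum_range_sub]
  ring

theorem exists_le_of_tendsto_div {y : ℕ → ℝ} {l : ℝ}
    (h : Tendsto (fun n : ℕ => y n / n) atTop (𝓝 l)) {ε : ℝ} (hε : 0 < ε) :
    ∃ K : ℝ, 0 ≤ K ∧ ∀ n : ℕ, |y n - l * n| ≤ ε * n + K := by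
  obtain ⟨N, hN⟩ := (Metric.tendsto_atTop.1 h) ε hε
  refine ⟨∑ i ∈ Finset.range (N + 1), |y i - l * i|,
    Finset.sum_nonneg fun _ _ => abs_nonneg _, fun n => ?_⟩
  have hsum : 0 ≤ ∑ i ∈ Finset.range (N + 1), |y i - l * i| :=
    Finset.sum_nonneg fun _ _ => abs_nonneg _
  have hn0 : (0 : ℝ) ≤ n := Nat.cast_nonneg n
  rcases Nat.lt_or_ge n (N + 1) with hn | hn
  · have := Finset.single_le_sum (f := fun i : ℕ => |y i - l * i|) (fun _ _ => abs_nonneg _)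
      (Finset.mem_range.2 hn)
    have : 0 ≤ ε * n := by positivity
    linarith
  · have h1 := hN n (by omega)
    have hn1 : (0 : ℝ) < n := by exact_mod_cast (show 0 < n by omega)
    rw [Real.dist_eq, div_sub' hn1.ne', abs_div, abs_of_pos hn1, div_lt_iff₀ hn1] at h1
    rw [mul_comm l]
    linarith

theorem tendsto_div_of_forall {y : ℕ → ℝ} {l : ℝ}
    (h : ∀ ε : ℝ, 0 < ε → ∃ K : ℝ, ∀ᶠ n : ℕ in atTop, |y n - l * n| ≤ ε * n + K) :
    Tendsto (fun n : ℕ => y n / n) atTop (𝓝 l) := by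
  rw [Metric.tendsto_atTop']
  intro ε hε
  obtain ⟨K, hK⟩ := h (ε / 2) (by positivity)
  obtain ⟨m, hm⟩ := exists_nat_gt (2 * K / ε)
  obtain ⟨N, hN⟩ := eventually_atTop.1 hK
  refine ⟨max N m, fun n hn => ?_⟩
  have hn1 : (0 : ℝ) < n := by exact_mod_cast (Nat.zero_le _).trans_lt hn
  have hnm : (m : ℝ) < n := by exact_mod_cast (le_max_right N m).trans_lt hn
  have h1 := hN n ((le_max_left N m).trans hn.le)
  rw [Real.dist_eq, div_sub' hn1.ne', abs_div, abs_of_pos hn1, div_lt_iff₀ hn1, mul_comm (n : ℝ)]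
  rw [div_lt_iff₀ hε] at hm
  nlinarith

/-- A sequence that is not pushed above a line and has a sufficient drift below it follows the
line. -/
theorem tendsto_div_of_drift {V F e : ℕ → ℝ} {c s B : ℝ} (hc : 0 < c) (hs : 1 / c ≤ s)
    (hF : Tendsto (fun n : ℕ => F n / n) atTop (𝓝 1))
    (hS : Tendsto (fun n : ℕ => (∑ i ∈ Finset.range n, (V (i + 1) - V i - e i)) / n) atTop (𝓝 0))
    (hup : ∀ᶠ i in atTop, V (i + 1) ≤ max (V i) ((F i + 1) / c + 1))
    (he : ∀ᶠ i in atTop, 0 ≤ e i)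
    (he' : ∀ᶠ i in atTop, V i + B ≤ (F i + 1) / c → s ≤ e i) :
    Tendsto (fun n : ℕ => V n / n) atTop (𝓝 (1 / c)) := by
  refine tendsto_div_of_forall fun ε hε => ?_
  obtain ⟨N, hN⟩ := eventually_atTop.1 (hup.and (he.and he'))
  set ε₁ : ℝ := ε * c / 4 with hε₁
  have hε₁0 : 0 < ε₁ := by positivity
  have hε₁c : ε₁ / c = ε / 4 := by rw [hε₁]; field_simp
  obtain ⟨K₁, hK₁, hF'⟩ := exists_le_of_tendsto_div hF hε₁0
  obtain ⟨K₂, hK₂, hS'⟩ := exists_le_of_tendsto_div hS (show 0 < ε / 4 by positivity)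
  set S : ℕ → ℝ := fun n => ∑ i ∈ Finset.range n, (V (i + 1) - V i - e i) with hSdef
  have hFu : ∀ i : ℕ, (F i + 1) / c ≤ (1 / c + ε / 4) * i + (K₁ + 1) / c := by
    intro i
    have h1 := (abs_le.1 (hF' i)).2
    have h2 : (F i + 1) / c ≤ ((1 + ε₁) * i + (K₁ + 1)) / c :=
      div_le_div_of_nonneg_right (by linarith) hc.le
    have h3 : ((1 + ε₁) * i + (K₁ + 1)) / c = (1 / c + ε₁ / c) * i + (K₁ + 1) / c := by ring
    rw [h3, hε₁c] at h2
    exact h2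
  have hFl : ∀ i : ℕ, (1 / c - ε / 4) * i - K₁ / c ≤ (F i + 1) / c := by
    intro i
    have h1 := (abs_le.1 (hF' i)).1
    have h2 : ((1 - ε₁) * i - K₁) / c ≤ (F i + 1) / c :=
      div_le_div_of_nonneg_right (by linarith) hc.le
    have h3 : ((1 - ε₁) * i - K₁) / c = (1 / c - ε₁ / c) * i - K₁ / c := by ring
    rw [h3, hε₁c] at h2
    exact h2
  have hc' : 0 < 1 / c := by positivity
  have hK₁c : 0 ≤ K₁ / c := by positivity
  have hu : ∀ n, N ≤ n → V n ≤ (1 / c + ε / 4) * n + (|V N| + (K₁ + 1) / c + 1) := by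
    intro n hn
    have hKc : 0 ≤ (K₁ + 1) / c := by positivity
    induction n, hn using Nat.le_induction with
    | base =>
      have h1 : 0 ≤ (1 / c + ε / 4) * N := by positivity
      linarith [le_abs_self (V N)]
    | succ n hn ih =>
      refine (hN n hn).1.trans (max_le ?_ ?_)
      · push_cast
        nlinarith
      · have := hFu n
        push_cast
        nlinarith [abs_nonneg (V N)]
  -- The constant makes the lower bound true at time `N` and again whenever `V` is within `B` of the
  -- target. In the remaining steps `V - S` rises by at least `s ≥ 1 / c`, faster than the line.
  set K₃ : ℝ := |V N - S N| + |1 / c - ε / 2| * N + (K₁ / c + |B| + K₂ + 1 / c) with hK₃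
  have hl : ∀ n, N ≤ n → (1 / c - ε / 2) * n - K₃ ≤ V n - S n := by
    intro n hn
    induction n, hn using Nat.le_induction with
    | base =>
      have h1 : (1 / c - ε / 2) * N ≤ |1 / c - ε / 2| * N :=
        mul_le_mul_of_nonneg_right (le_abs_self _) (Nat.cast_nonneg N)
      rw [hK₃]
      linarith [neg_abs_le (V N - S N), abs_nonneg B]
    | succ n hn ih =>
      obtain ⟨_, h2, h3⟩ := hN n hn
      have h4 : S (n + 1) = S n + (V (n + 1) - V n - e n) := Finset.sum_range_succ _ _
      have h5 := (abs_le.1 (hS' n)).2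
      rw [zero_mul, sub_zero] at h5
      change S n ≤ _ at h5
      have h6 : 0 ≤ |1 / c - ε / 2| * N := by positivity
      push_cast
      rcases le_or_gt (V n + B) ((F n + 1) / c) with h | h
      · have := h3 h
        linarith
      · have h7 := hFl n
        rw [hK₃]
        linarith [abs_nonneg (V N - S N), le_abs_self B]
  refine ⟨max (|V N| + (K₁ + 1) / c + 1) (K₃ + K₂), ?_⟩
  filter_upwards [eventually_ge_atTop N] with n hn
  have h1 := hu n hn
  have h2 := hl n hn
  have h3 := (abs_le.1 (hS' n)).1
  rw [zero_mul, sub_zero] at h3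
  change _ ≤ S n at h3
  have hn0 : 0 ≤ ε * n := by positivity
  have h4 := le_max_left (|V N| + (K₁ + 1) / c + 1) (K₃ + K₂)
  have h5 := le_max_right (|V N| + (K₁ + 1) / c + 1) (K₃ + K₂)
  rw [abs_le]
  constructor <;> linarith

/-- The linear recursion `y (n + 1) = y n - α n * y n / n + b n + o(1)` in the mean. -/
theorem tendsto_div_of_recursion {y d α β : ℕ → ℝ} {A l b : ℝ} (hα0 : ∀ᶠ i in atTop, 0 ≤ α i)
    (hαA : ∀ᶠ i in atTop, α i ≤ A) (hl : 0 ≤ l)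
    (hy : Tendsto (fun n : ℕ => (∑ i ∈ Finset.range n, (y (i + 1) - y i - d i)) / n) atTop (𝓝 0))
    (hd : Tendsto (fun i : ℕ => d i - (β i - α i * (y i / i))) atTop (𝓝 0))
    (hα : Tendsto (fun n : ℕ => (∑ i ∈ Finset.range n, α i) / n) atTop (𝓝 l))
    (hβ : Tendsto (fun n : ℕ => (∑ i ∈ Finset.range n, β i) / n) atTop (𝓝 b)) :
    Tendsto (fun n : ℕ => y n / n) atTop (𝓝 (b / (1 + l))) := by
  set L := b / (1 + l) with hL
  have hL' : L + l * L = b := by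
    rw [hL]
    field_simp
  set u : ℕ → ℝ := fun n => y n - L * n with hu
  -- The residual of the homogeneous recursion for `u`; its averages tend to zero although neither
  -- `α` nor `β` has to converge.
  set g : ℕ → ℝ := fun i => u (i + 1) - u i + α i * (u i / i) with hg
  set G : ℕ → ℝ := fun n => ∑ i ∈ Finset.range n, g i with hG
  have hG0 : Tendsto (fun n : ℕ => G n / n) atTop (𝓝 0) := by
    have h1 := ((hy.add (tendsto_sum_div hd)).add hβ).sub (hα.const_mul L)
    have h2 : Tendsto (fun i : ℕ => α i * L * (1 - (i : ℝ) / i) - L) atTop (𝓝 (-L)) := by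
      refine tendsto_const_nhds.congr' ?_
      filter_upwards [eventually_gt_atTop 0] with i hi
      have : (i : ℝ) ≠ 0 := by exact_mod_cast hi.ne'
      rw [div_self this]
      ring
    have h3 := h1.add (tendsto_sum_div h2)
    rw [show (0 : ℝ) + 0 + b - L * l + -L = 0 by linarith] at h3
    refine h3.congr fun n => ?_
    rw [← add_div, ← add_div, ← Finset.sum_add_distrib, ← Finset.sum_add_distrib,
      mul_div_assoc', Finset.mul_sum, ← sub_div, ← Finset.sum_sub_distrib, ← add_div,
      ← Finset.sum_add_distrib]
    congr 1
    refine Finset.sum_congr rfl fun i _ => ?_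
    simp only [hg, hu]
    push_cast
    ring
  obtain ⟨N, hN⟩ := eventually_atTop.1 (hα0.and hαA)
  obtain ⟨m, hm⟩ := exists_nat_gt A
  -- Subtracting the accumulated residuals leaves `v (n + 1) = (1 - α n / n) * v n - α n * (G n /
  -- n)`. From `N'` on, `α n / n ≤ 1`, so `|v|` grows at most by summands that tend to zero.
  set v : ℕ → ℝ := fun n => u n - G n with hv
  set N' := N + m + 1 with hN'
  have hvn : ∀ n, N' ≤ n → |v n| ≤ |v N'| + ∑ i ∈ Finset.range n, A * |G i / i| := by
    have hA : 0 ≤ A := (hN N le_rfl).1.trans (hN N le_rfl).2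
    intro n hn
    induction n, hn using Nat.le_induction with
    | base =>
      have : 0 ≤ ∑ i ∈ Finset.range N', A * |G i / i| :=
        Finset.sum_nonneg fun i _ => by positivity
      linarith
    | succ n hn ih =>
      obtain ⟨h1, h2⟩ := hN n (by omega)
      have hn0 : (0 : ℝ) < n := by exact_mod_cast (show 0 < n by omega)
      have hmn : (m : ℝ) ≤ n := by exact_mod_cast (show m ≤ n by omega)
      have e1 : v (n + 1) = (1 - α n / n) * v n - α n * (G n / n) := by
        have : G (n + 1) = G n + g n := Finset.sum_range_succ _ _
        simp only [hv, this, hg]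
        ring
      have h3 : α n / n ≤ 1 := by
        rw [div_le_one hn0]
        linarith
      have h4 : 0 ≤ α n / n := by positivity
      rw [Finset.sum_range_succ, e1]
      refine (abs_sub _ _).trans ?_
      rw [abs_mul, abs_mul, abs_of_nonneg (show 0 ≤ 1 - α n / n by linarith), abs_of_nonneg h1]
      have h5 : (1 - α n / n) * |v n| ≤ |v n| := mul_le_of_le_one_left (abs_nonneg _) (by linarith)
      have h6 : α n * |G n / n| ≤ A * |G n / n| := mul_le_mul_of_nonneg_right h2 (abs_nonneg _)
      linarith
  have hv0 : Tendsto (fun n : ℕ => v n / n) atTop (𝓝 0) := by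
    have h1 : Tendsto (fun i : ℕ => A * |G i / i|) atTop (𝓝 0) := by
      simpa using hG0.abs.const_mul A
    have h2 := (tendsto_const_div |v N'|).add (tendsto_sum_div h1)
    rw [add_zero] at h2
    refine squeeze_zero_norm' ?_ h2
    filter_upwards [eventually_ge_atTop N'] with n hn
    rw [Real.norm_eq_abs, abs_div, Nat.abs_cast, ← add_div]
    gcongr
    exact hvn n hn
  have h1 := (hv0.add hG0).add (tendsto_const_nhds (x := L))
  rw [add_zero, zero_add] at h1
  refine h1.congr' ?_
  filter_upwards [eventually_gt_atTop 0] with n hn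
  have : (n : ℝ) ≠ 0 := by exact_mod_cast hn.ne'
  simp only [hv, hu]
  field_simp
  ring

end Sequences

end GeneSCs

/-! ### Limits of the facet, vertex and degree counts -/

namespace GeneSCs

/-- The limit of the number of vertices of facet degree `k` per step. -/
noncomputable def degreeLimit (c s a : ℝ) : ℕ → ℝ
  | 0 => 0
  | k + 1 => ((s - 1 / c) * ((k + a) * (degreeLimit c s a k / (s + a / c))) +
      1 / c * (if k = 0 then 1 else 0)) / (1 + (s - 1 / c) * ((k + 1 + a) / (s + a / c)))

/-- The law of large numbers holds for the increments of `φ` along the path `x`. -/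
def Averages (z : PMF ℕ) (c a : ℝ) (x : ℕ → Facets) (φ : Facets → ℝ) : Prop :=
  Tendsto (fun n : ℕ => (∑ i ∈ Finset.range n, (φ (x (i + 1)) - φ (x i) -
    ex (step z c a (x i)) fun S' => φ S' - φ (x i))) / n) atTop (𝓝 0)

theorem meanNew_nonneg (z : PMF ℕ) (c : ℝ) (S : Facets) : 0 ≤ meanNew z c S :=
  ex_nonneg fun _ _ => Nat.cast_nonneg _

theorem meanNew_le {z : PMF ℕ} (hz : z.support.Finite) (c : ℝ) (S : Facets) :
    meanNew z c S ≤ ex z fun m => (m : ℝ) :=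
  ex_mono hz fun m _ => by exact_mod_cast newCount_le c S m

theorem meanNew_eq {z : PMF ℕ} (hz : z.support.Finite) {c : ℝ} {S : Facets}
    (h : vertexCount S + maxSize hz ≤ (facetCount S + 1) / c) :
    meanNew z c S = ex z fun m => (m : ℝ) := by
  refine ex_congr fun m hm => ?_
  have h1 : (vertices S).card + maxSize hz ≤ ⌈((S.card : ℝ) + 1) / c⌉₊ := by
    have : (((vertices S).card + maxSize hz : ℕ) : ℝ) ≤ ⌈((S.card : ℝ) + 1) / c⌉₊ := by
      push_cast
      exact h.trans (Nat.le_ceil _)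
    exact_mod_cast this
  have h2 := le_maxSize hz hm
  rw [newCount, min_eq_left (by omega)]

/-- Replaces `N / T` and `i / T` by their limits in the mean increment. The term with `N'` keeps `N'
/ i`, because this is the unknown of the recursion. -/
theorem abs_recursion_error_le {d s ν p q N N' V T τ L χ e i : ℝ} (hi : 0 < i) (hT : T ≠ 0)
    (h0 : 0 ≤ s - ν) (h1 : s - ν ≤ s) (hp : 0 ≤ p) (hq : 0 ≤ q) (hN' : 0 ≤ N') (hN'V : N' ≤ V)
    (hd : |d - ((s - ν) * (p * N / T - q * N' / T) + ν * χ)| ≤ e) :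
    |d - ((s - ν) * (p * (L / τ)) + ν * χ - (s - ν) * (q / τ) * (N' / i))| ≤
      e + s * (p * |N / i * (i / T) - L / τ| + q * (V / i * |i / T - 1 / τ|)) := by
  have eq : d - ((s - ν) * (p * (L / τ)) + ν * χ - (s - ν) * (q / τ) * (N' / i)) =
      (d - ((s - ν) * (p * N / T - q * N' / T) + ν * χ)) +
      (s - ν) * (p * (N / i * (i / T) - L / τ) - q * (N' / i * (i / T - 1 / τ))) := by
    have e1 : N / i * (i / T) = N / T := by field_simp
    have e2 : N' / i * (i / T - 1 / τ) = N' / T - N' / i / τ := by field_simp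
    rw [e1, e2]
    ring
  rw [eq]
  refine (abs_add_le _ _).trans (add_le_add hd ?_)
  rw [abs_mul, abs_of_nonneg h0]
  refine mul_le_mul h1 ?_ (abs_nonneg _) (h0.trans h1)
  refine (abs_sub _ _).trans (add_le_add ?_ ?_)
  · rw [abs_mul, abs_of_nonneg hp]
  · rw [abs_mul, abs_mul, abs_of_nonneg (div_nonneg hN' hi.le), abs_of_nonneg hq]
    gcongr

namespace IsPath

variable {z : PMF ℕ} {c : ℝ} {x : ℕ → Facets}

theorem mem_zero_or (h : IsPath z c x) {n : ℕ} {F : Finset ℕ} (hF : F ∈ x n) :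
    F ∈ x 0 ∨ F.card ∈ z.support := by
  induction n with
  | zero => exact Or.inl hF
  | succ n ih =>
    by_cases hFn : F ∈ x n
    · exact ih hFn
    · obtain ⟨G, hG, _, he⟩ := h.exists_facet n
      rw [he] at hF
      rw [(eq_of_mem_addFacet_of_notMem hF hFn).1]
      exact Or.inr hG

theorem vertexCount_succ_le (h : IsPath z c x) (hz : z.support.Finite) {n : ℕ} (hc : 0 < c)
    (hV : maxSize hz ≤ (vertices (x n)).card) :
    vertexCount (x (n + 1)) ≤ max (vertexCount (x n)) ((facetCount (x n) + 1) / c + 1) := by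
  obtain ⟨m, _, he⟩ := h.card_vertices_succ n fun m hm => (le_maxSize hz hm).trans hV
  have h1 : (vertices (x (n + 1))).card ≤
      max (vertices (x n)).card ⌈(((x n).card : ℝ) + 1) / c⌉₊ := by
    rw [he, newCount]
    omega
  have h2 : ((vertices (x (n + 1))).card : ℝ) ≤
      max ((vertices (x n)).card : ℝ) (⌈(((x n).card : ℝ) + 1) / c⌉₊ : ℝ) := by exact_mod_cast h1
  refine h2.trans (max_le_max le_rfl ?_)
  exact (Nat.ceil_lt_add_one (by positivity)).le

end IsPath

namespace IsRegular

variable {z : PMF ℕ} {hz : z.support.Finite} {c a : ℝ} {x : ℕ → Facets} {η C κ : ℝ} {b : ℕ}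

theorem tendsto_collisionOff (h : IsRegular hz c a x η C κ b) (ha : 0 ≤ a) (hc : 0 < c)
    (hz0 : ∀ m ∈ z.support, m ≠ 0) (hctl : IsControlled hz c a x) :
    Tendsto (fun n => collisionOff a ∅ (x n)) atTop (𝓝 0) := by
  rw [Metric.tendsto_nhds]
  intro ε hε
  filter_upwards [h.eventually_rare ha hc hz0 hctl (half_pos hε)] with n hn
  rw [Real.dist_eq, sub_zero, abs_of_nonneg (collisionOff_nonneg a ∅ _)]
  linarith [hn.1]

theorem tendsto_prAdjOff (h : IsRegular hz c a x η C κ b) (ha : 0 ≤ a) (hc : 0 < c)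
    (hz0 : ∀ m ∈ z.support, m ≠ 0) (hctl : IsControlled hz c a x) :
    Tendsto (fun n => prAdjOff a ∅ ∅ (x n)) atTop (𝓝 0) := by
  rw [Metric.tendsto_nhds]
  intro ε hε
  filter_upwards [h.eventually_rare ha hc hz0 hctl (half_pos hε)] with n hn
  rw [Real.dist_eq, sub_zero, abs_of_nonneg (prAdjOff_nonneg ha ∅ ∅ _)]
  linarith [hn.2]

/-- Facets with a single vertex can only stem from the initial complex, so at most `|V₀|` vertices
are involved, each with a share at most the square root of the collision probability. -/
theorem tendsto_clashBound (h : IsRegular hz c a x η C κ b) (ha : 0 ≤ a) (hc : 0 < c)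
    (hz2 : ∀ m ∈ z.support, 2 ≤ m) (hctl : IsControlled hz c a x) :
    Tendsto (fun n => clashBound a (maxSize hz) κ (x n)) atTop (𝓝 0) := by
  have hz0 : ∀ m ∈ z.support, m ≠ 0 := fun m hm => by have := hz2 m hm; omega
  have h1 := h.tendsto_collisionOff ha hc hz0 hctl
  have h2 := h.tendsto_prAdjOff ha hc hz0 hctl
  have h3 : Tendsto (fun n => ∑ v ∈ vertices (x n), pr a (x n) v * single (x n) v) atTop
      (𝓝 0) := by
    have h4 := (h1.sqrt).const_mul ((vertices (x 0)).card : ℝ)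
    rw [Real.sqrt_zero, mul_zero] at h4
    refine squeeze_zero (fun n => Finset.sum_nonneg fun v _ =>
      mul_nonneg (pr_nonneg ha v) (single_nonneg _ v)) (fun n => ?_) h4
    have h5 : ∑ v ∈ vertices (x n), pr a (x n) v * single (x n) v =
        ∑ v ∈ vertices (x 0), pr a (x n) v * single (x n) v := by
      refine (Finset.sum_subset (h.isPath.vertices_mono (Nat.zero_le n)) fun v _ hv => ?_).symm
      rw [single, if_neg, mul_zero]
      intro hs
      rcases h.isPath.mem_zero_or hs with h0 | h0
      · exact hv (subset_vertices h0 (Finset.mem_singleton_self v))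
      · have := hz2 _ h0
        rw [Finset.card_singleton] at this
        omega
    rw [h5, ← nsmul_eq_mul]
    refine Finset.sum_le_card_nsmul _ _ _ fun v hv => ?_
    have hv' := h.isPath.vertices_mono (Nat.zero_le n) hv
    have h6 : single (x n) v ≤ 1 := by
      unfold single
      split_ifs <;> norm_num
    refine (mul_le_of_le_one_right (pr_nonneg ha v) h6).trans (Real.le_sqrt_of_sq_le ?_)
    have h7 := Finset.single_le_sum (f := fun v => pr a (x n) v ^ 2 * off ∅ v)
      (fun w _ => mul_nonneg (sq_nonneg _) (off_nonneg ∅ w)) hv'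
    beta_reduce at h7
    rw [off_of_notMem (Finset.notMem_empty v), mul_one] at h7
    exact h7
  have h4 := (h2.const_mul (((maxSize hz : ℝ) * κ) ^ 2)).add (h3.const_mul ((maxSize hz : ℝ) * κ))
  simpa [clashBound] using h4

theorem tendsto_sum_facets_div (h : IsRegular hz c a x η C κ b) (ha : 0 ≤ a) (hc : 0 < c)
    (hz2 : ∀ m ∈ z.support, 2 ≤ m) (hctl : IsControlled hz c a x) (h0 : ∅ ∉ x 0)
    {w : ℕ → ℝ} {B : ℝ} (hw : ∀ m ≤ maxSize hz, |w m| ≤ B)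
    (havg : Averages z c a x fun S => ∑ F ∈ S, w F.card) :
    Tendsto (fun n : ℕ => (∑ F ∈ x n, w F.card) / n) atTop (𝓝 (ex z w)) := by
  have hn0 : ∀ n, ∅ ∉ x n := fun n hn => by
    rcases h.isPath.mem_zero_or hn with h1 | h1
    · exact h0 h1
    · simpa using hz2 _ h1
  refine tendsto_div_of_increments havg (tendsto_sum_div ?_)
  have h1 := (h.tendsto_clashBound ha hc hz2 hctl).const_mul ((2 ^ maxSize hz + 2) * B)
  rw [mul_zero] at h1
  rw [tendsto_iff_dist_tendsto_zero]
  refine squeeze_zero' (Eventually.of_forall fun _ => dist_nonneg) ?_ h1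
  filter_upwards [h.spread] with n hn
  rw [Real.dist_eq]
  exact abs_ex_sum_sub_le hz hz2 hn (hn0 n) hw

theorem tendsto_facetCount_div (h : IsRegular hz c a x η C κ b) (ha : 0 ≤ a) (hc : 0 < c)
    (hz2 : ∀ m ∈ z.support, 2 ≤ m) (hctl : IsControlled hz c a x) (h0 : ∅ ∉ x 0)
    (havg : Averages z c a x facetCount) :
    Tendsto (fun n : ℕ => facetCount (x n) / n) atTop (𝓝 1) := by
  have e : ∀ S, facetCount S = ∑ F ∈ S, (fun _ => (1 : ℝ)) F.card := fun S => by
    simp [facetCount]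
  have e' : facetCount = fun S => ∑ F ∈ S, (fun _ => (1 : ℝ)) F.card := funext e
  rw [e'] at havg
  have h1 := h.tendsto_sum_facets_div ha hc hz2 hctl h0 (w := fun _ => 1) (B := 1)
    (fun m _ => by simp) havg
  rw [ex_const hz] at h1
  exact h1.congr fun n => by rw [e]

theorem tendsto_sizeSum_div (h : IsRegular hz c a x η C κ b) (ha : 0 ≤ a) (hc : 0 < c)
    (hz2 : ∀ m ∈ z.support, 2 ≤ m) (hctl : IsControlled hz c a x) (h0 : ∅ ∉ x 0)
    (havg : Averages z c a x sizeSum) :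
    Tendsto (fun n : ℕ => sizeSum (x n) / n) atTop (𝓝 (ex z fun m => (m : ℝ))) :=
  h.tendsto_sum_facets_div ha hc hz2 hctl h0 (w := fun m => (m : ℝ)) (B := maxSize hz)
    (fun m hm => by rw [Nat.abs_cast]; exact_mod_cast hm) havg

theorem eventually_ex_vertexCount (h : IsRegular hz c a x η C κ b) (ha : 0 ≤ a) :
    ∀ᶠ i in atTop, ex (step z c a (x i)) (fun S' => vertexCount S' - vertexCount (x i)) =
      meanNew z c (x i) := by
  filter_upwards [h.spread] with i hi
  exact ex_vertexCount_sub hz ha fun m hm => (le_maxSize hz hm).trans hi.card_lt.le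

/-- When `|V|` is at least `M` below its target, all vertices of the new facet are new, a drift of
`s > 1 / c`, while the rule for new vertices forbids overshooting. -/
theorem tendsto_vertexCount_div (h : IsRegular hz c a x η C κ b) (ha : 0 ≤ a) (hc : 0 < c)
    (hz2 : ∀ m ∈ z.support, 2 ≤ m) (hctl : IsControlled hz c a x) (h0 : ∅ ∉ x 0)
    (hcs : 1 < c * ex z fun m => (m : ℝ))
    (havF : Averages z c a x facetCount) (havV : Averages z c a x vertexCount) :
    Tendsto (fun n : ℕ => vertexCount (x n) / n) atTop (𝓝 (1 / c)) := by
  refine tendsto_div_of_drift (B := maxSize hz) hc (s := ex z fun m => (m : ℝ)) ?_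
    (h.tendsto_facetCount_div ha hc hz2 hctl h0 havF) havV ?_ ?_ ?_
  · rw [div_le_iff₀ hc]
    linarith
  · filter_upwards [h.spread] with i hi
    exact h.isPath.vertexCount_succ_le hz hc hi.card_lt.le
  · filter_upwards [h.eventually_ex_vertexCount ha] with i hi
    rw [hi]
    exact meanNew_nonneg z c _
  · filter_upwards [h.eventually_ex_vertexCount ha] with i hi hle
    rw [hi, meanNew_eq hz hle]

theorem tendsto_totalWt_div (h : IsRegular hz c a x η C κ b) (ha : 0 ≤ a) (hc : 0 < c)
    (hz2 : ∀ m ∈ z.support, 2 ≤ m) (hctl : IsControlled hz c a x) (h0 : ∅ ∉ x 0)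
    (hcs : 1 < c * ex z fun m => (m : ℝ))
    (havF : Averages z c a x facetCount) (havV : Averages z c a x vertexCount)
    (havD : Averages z c a x sizeSum) :
    Tendsto (fun n : ℕ => totalWt a (x n) / n) atTop (𝓝 ((ex z fun m => (m : ℝ)) + a / c)) := by
  have h1 := (h.tendsto_sizeSum_div ha hc hz2 hctl h0 havD).add
    ((h.tendsto_vertexCount_div ha hc hz2 hctl h0 hcs havF havV).const_mul a)
  rw [mul_one_div] at h1
  refine h1.congr fun n => ?_
  rw [totalWt_eq, sizeSum, vertexCount]
  ring

/-- Induction on the degree: the count for degree `k` feeds that for `k + 1`. The coefficients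
contain the mean number of new vertices, of which only the time average is known, so a recursion
with averaged coefficients is used. -/
theorem tendsto_degreeCount_div (h : IsRegular hz c a x η C κ b) (ha : 0 ≤ a) (hc : 0 < c)
    (hz2 : ∀ m ∈ z.support, 2 ≤ m) (hctl : IsControlled hz c a x) (h0 : ∅ ∉ x 0)
    (hcs : 1 < c * ex z fun m => (m : ℝ))
    (havF : Averages z c a x facetCount) (havV : Averages z c a x vertexCount)
    (havD : Averages z c a x sizeSum) (havN : ∀ k, Averages z c a x (degreeCount (k + 1)))
    (k : ℕ) :
    Tendsto (fun n : ℕ => degreeCount k (x n) / n) atTop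
      (𝓝 (degreeLimit c (ex z fun m => (m : ℝ)) a k)) := by
  have hz0 : ∀ m ∈ z.support, m ≠ 0 := fun m hm => by have := hz2 m hm; omega
  have hn0 : ∀ n, ∅ ∉ x n := fun n hn => by
    rcases h.isPath.mem_zero_or hn with h1 | h1
    · exact h0 h1
    · simpa using hz2 _ h1
  set s := ex z fun m => (m : ℝ) with hs
  have hs0 : 0 < s := by
    by_contra hcon
    push Not at hcon
    nlinarith
  have hsc : 0 < s - 1 / c := by
    rw [sub_pos, div_lt_iff₀ hc]
    linarith
  set τ := s + a / c with hτ
  have hτ0 : 0 < τ := by positivity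
  have hT := h.tendsto_totalWt_div ha hc hz2 hctl h0 hcs havF havV havD
  have hV := h.tendsto_vertexCount_div ha hc hz2 hctl h0 hcs havF havV
  set ν : ℕ → ℝ := fun i =>
    ex (step z c a (x i)) fun S' => vertexCount S' - vertexCount (x i) with hν
  have hνe := h.eventually_ex_vertexCount ha
  have hν01 : ∀ᶠ i in atTop, 0 ≤ s - ν i ∧ s - ν i ≤ s := by
    filter_upwards [hνe] with i hi
    simp only [hν]
    rw [hi]
    constructor <;> linarith [meanNew_nonneg z c (x i), meanNew_le hz c (x i)]
  have hνavg : Tendsto (fun n : ℕ => (∑ i ∈ Finset.range n, ν i) / n) atTop (𝓝 (1 / c)) :=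
    tendsto_sum_of_div (y := fun n => vertexCount (x n)) (e := ν) havV hV
  have hρavg : Tendsto (fun n : ℕ => (∑ i ∈ Finset.range n, (s - ν i)) / n) atTop
      (𝓝 (s - 1 / c)) := by
    refine ((tendsto_sum_div (tendsto_const_nhds (x := s))).sub hνavg).congr fun n => ?_
    rw [Finset.sum_sub_distrib, sub_div]
  have hTinv : Tendsto (fun n : ℕ => (n : ℝ) / totalWt a (x n)) atTop (𝓝 (1 / τ)) := by
    have h1 := hT.inv₀ hτ0.ne'
    rw [← one_div] at h1
    exact h1.congr fun n => inv_div _ _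
  induction k with
  | zero =>
    refine tendsto_const_nhds.congr fun n => ?_
    have : ((vertices (x n)).filter fun v => facetDegree (x n) v = 0) = ∅ :=
      Finset.filter_false_of_mem fun v hv => (facetDegree_pos hv).ne'
    rw [degreeCount, this]
    simp [degreeLimit]
  | succ k ih =>
    rw [degreeLimit]
    refine tendsto_div_of_recursion (A := s * ((k + 1 + a) / τ))
      (y := fun n => degreeCount (k + 1) (x n)) (d := fun i => ex (step z c a (x i)) fun S' =>
        degreeCount (k + 1) S' - degreeCount (k + 1) (x i))
      (α := fun i => (s - ν i) * ((k + 1 + a) / τ))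
      (β := fun i => (s - ν i) * ((k + a) * (degreeLimit c s a k / τ)) +
        ν i * (if k = 0 then 1 else 0)) ?_ ?_ (by positivity) (havN k) ?_ ?_ ?_
    · filter_upwards [hν01] with i hi
      exact mul_nonneg hi.1 (by positivity)
    · filter_upwards [hν01] with i hi
      exact mul_le_mul_of_nonneg_right hi.2 (by positivity)
    · have e1 := (((h.tendsto_clashBound ha hc hz2 hctl).const_mul (3 * (maxSize hz : ℝ))).add
        (((h.tendsto_collisionOff ha hc hz0 hctl).const_mul ((maxSize hz : ℝ) ^ 2 * κ ^ 2)).const_mul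
          2))
      have e2 : Tendsto (fun n : ℕ => degreeCount k (x n) / n * (n / totalWt a (x n)) -
          degreeLimit c s a k / τ) atTop (𝓝 0) := by
        have := (ih.mul hTinv).sub (tendsto_const_nhds (x := degreeLimit c s a k / τ))
        rwa [mul_one_div, sub_self] at this
      have e3 : Tendsto (fun n : ℕ => vertexCount (x n) / n * |n / totalWt a (x n) - 1 / τ|) atTop
          (𝓝 0) := by
        have := hV.mul ((hTinv.sub (tendsto_const_nhds (x := 1 / τ))).abs)
        rwa [sub_self, abs_zero, mul_zero] at this
      have e4 := e1.add (((e2.abs.const_mul ((k : ℝ) + a)).add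
        (e3.const_mul ((k : ℝ) + 1 + a))).const_mul s)
      simp only [mul_zero, add_zero, abs_zero] at e4
      refine squeeze_zero_norm' ?_ e4
      filter_upwards [h.spread, hν01, hνe, eventually_gt_atTop 0] with i hi hi01 hie hipos
      have hi' : (0 : ℝ) < i := by exact_mod_cast hipos
      have h1 := abs_ex_degreeCount_sub_le (c := c) hz hz2 hi (hn0 i) k
      have hνi : meanNew z c (x i) = ν i := hie.symm
      rw [hνi, ← hs] at h1
      have hN'V : degreeCount (k + 1) (x i) ≤ vertexCount (x i) := by
        rw [degreeCount, vertexCount]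
        exact_mod_cast Finset.card_filter_le _ _
      exact abs_recursion_error_le hi' hi.totalWt_pos.ne' hi01.1 hi01.2 (by positivity)
        (by positivity) (Nat.cast_nonneg _) hN'V h1
    · refine (hρavg.mul_const ((k + 1 + a) / τ)).congr fun n => ?_
      rw [← Finset.sum_mul]
      ring
    · refine ((hρavg.mul_const ((k + a) * (degreeLimit c s a k / τ))).add
        (hνavg.mul_const (if k = 0 then 1 else 0))).congr fun n => ?_
      rw [Finset.sum_add_distrib, ← Finset.sum_mul, ← Finset.sum_mul]
      ring

end IsRegular

end GeneSCs

/-! ### Beta functions and the limiting distribution -/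

namespace GeneSCs

open ProbabilityTheory (beta)

theorem beta_pos {x y : ℝ} (hx : 0 < x) (hy : 0 < y) : 0 < beta x y :=
  div_pos (mul_pos (Real.Gamma_pos_of_pos hx) (Real.Gamma_pos_of_pos hy))
    (Real.Gamma_pos_of_pos (add_pos hx hy))

theorem beta_add_one_left {x y : ℝ} (hx : 0 < x) (hy : 0 < y) :
    beta (x + 1) y = beta x y * (x / (x + y)) := by
  have h : x + 1 + y = x + y + 1 := by ring
  have h1 := (Real.Gamma_pos_of_pos (add_pos hx hy)).ne'
  rw [beta, beta, h, Real.Gamma_add_one hx.ne', Real.Gamma_add_one (by positivity)]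
  field_simp

theorem beta_add_one_right {x y : ℝ} (hx : 0 < x) (hy : 0 < y) :
    beta x (y + 1) = beta x y * (y / (x + y)) := by
  have h1 := (Real.Gamma_pos_of_pos (add_pos hx hy)).ne'
  rw [beta, beta, ← add_assoc, Real.Gamma_add_one hy.ne', Real.Gamma_add_one (by positivity)]
  field_simp

theorem beta_sub_beta_add_one_left {x y : ℝ} (hx : 0 < x) (hy : 0 < y) :
    beta x y - beta (x + 1) y = beta x (y + 1) := by
  rw [beta_add_one_left hx hy, beta_add_one_right hx hy]
  field_simp
  ring

theorem Gamma_add_nat_add_one {s : ℝ} (hs : 0 < s) (n : ℕ) :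
    Real.Gamma (s + n + 1) = Real.Gamma s * ∏ j ∈ Finset.range (n + 1), (s + j) := by
  induction n with
  | zero => simp [Real.Gamma_add_one hs.ne', mul_comm]
  | succ n ih =>
    have h : s + ((n + 1 : ℕ) : ℝ) = s + n + 1 := by push_cast; ring
    rw [Finset.prod_range_succ, h, Real.Gamma_add_one (by positivity), ih]
    ring

/-- The Gamma function ratio `Γ(n + t) / Γ(n + s)` is asymptotic to `n ^ (t - s)`. -/
theorem tendsto_Gamma_div_Gamma {s t : ℝ} (hs : 0 < s) (ht : 0 < t) :
    Tendsto (fun n : ℕ => Real.Gamma (s + n + 1) / Real.Gamma (t + n + 1) * (n : ℝ) ^ (t - s))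
      atTop (𝓝 1) := by
  have h := (Real.GammaSeq_tendsto_Gamma t).div (Real.GammaSeq_tendsto_Gamma s)
    (Real.Gamma_pos_of_pos hs).ne'
  have h2 := (h.const_mul (Real.Gamma s / Real.Gamma t))
  have hg1 := (Real.Gamma_pos_of_pos hs).ne'
  have hg2 := (Real.Gamma_pos_of_pos ht).ne'
  have e : Real.Gamma s / Real.Gamma t * (Real.Gamma t / Real.Gamma s) = 1 := by field_simp
  rw [e] at h2
  refine h2.congr' ?_
  filter_upwards [eventually_gt_atTop 0] with n hn
  have hn' : (0 : ℝ) < n := by exact_mod_cast hn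
  have hp1 : 0 < ∏ j ∈ Finset.range (n + 1), (s + j) :=
    Finset.prod_pos fun j _ => by positivity
  have hp2 : 0 < ∏ j ∈ Finset.range (n + 1), (t + j) :=
    Finset.prod_pos fun j _ => by positivity
  have hf : (0 : ℝ) < (n.factorial : ℝ) := by exact_mod_cast n.factorial_pos
  have hns := Real.rpow_pos_of_pos hn' s
  rw [Pi.div_apply, Real.GammaSeq, Real.GammaSeq, Gamma_add_nat_add_one hs,
    Gamma_add_nat_add_one ht, Real.rpow_sub hn']
  field_simp

theorem tendsto_add_rpow_div_rpow (r d : ℝ) :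
    Tendsto (fun n : ℕ => ((n : ℝ) + d) ^ r / (n : ℝ) ^ r) atTop (𝓝 1) := by
  have h : Tendsto (fun n : ℕ => (1 + d / (n : ℝ)) ^ r) atTop (𝓝 1) := by
    have h1 : Tendsto (fun n : ℕ => 1 + d / (n : ℝ)) atTop (𝓝 1) := by
      simpa using tendsto_const_nhds.add (tendsto_const_div_atTop_nhds_zero_nat d) (a := (1 : ℝ))
    simpa using h1.rpow_const (p := r) (Or.inl one_ne_zero)
  refine h.congr' ?_
  filter_upwards [eventually_gt_atTop 0, eventually_gt_atTop ⌈-d⌉₊] with n hn hd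
  have hn' : (0 : ℝ) < n := by exact_mod_cast hn
  have hd' : -d < n := Nat.lt_of_ceil_lt hd
  rw [← Real.div_rpow (by linarith) hn'.le]
  congr 1
  field_simp

theorem tendsto_beta_mul_rpow {x y : ℝ} (hx : 0 ≤ x) (hy : 0 < y) :
    Tendsto (fun n : ℕ => beta (n + x) y * (n : ℝ) ^ y) atTop (𝓝 (Real.Gamma y)) := by
  have h := tendsto_Gamma_div_Gamma (s := x + 1) (t := x + 1 + y) (by linarith) (by linarith)
  have h1 := (h.mul (tendsto_add_rpow_div_rpow y 2)).const_mul (Real.Gamma y)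
  rw [mul_one, mul_one] at h1
  -- The shift brings the argument into the form `s + n + 1` with `s = x + 1`, positive also for `x
  -- = 0`.
  rw [← tendsto_add_atTop_iff_nat 2]
  refine h1.congr' ?_
  filter_upwards [eventually_gt_atTop 0] with n hn
  have hn' : (0 : ℝ) < n := by exact_mod_cast hn
  have e1 : ((n + 2 : ℕ) : ℝ) + x = x + 1 + n + 1 := by push_cast; ring
  have e2 : x + 1 + n + 1 + y = x + 1 + y + n + 1 := by ring
  have e3 : x + 1 + y - (x + 1) = y := by ring
  have := Real.rpow_pos_of_pos hn' y
  rw [beta, e1, e2, e3]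
  push_cast
  field_simp

theorem tendsto_beta_zero {x y : ℝ} (hx : 0 ≤ x) (hy : 0 < y) :
    Tendsto (fun n : ℕ => beta (n + x) y) atTop (𝓝 0) := by
  have h := (tendsto_beta_mul_rpow hx hy).mul
    ((tendsto_rpow_neg_atTop hy).comp tendsto_natCast_atTop_atTop)
  rw [mul_zero] at h
  refine h.congr' ?_
  filter_upwards [eventually_gt_atTop 0] with n hn
  have hn' : (0 : ℝ) < n := by exact_mod_cast hn
  have := Real.rpow_pos_of_pos hn' y
  rw [Function.comp, Real.rpow_neg hn'.le]
  field_simp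

/-- The sum telescopes by `beta_sub_beta_add_one_left`. -/
theorem hasSum_beta {x y : ℝ} (hx : 0 < x) (hy : 0 < y) :
    HasSum (fun n : ℕ => beta (n + x) (y + 1)) (beta x y) := by
  rw [hasSum_iff_tendsto_nat_of_nonneg fun n => (beta_pos (by positivity) (by positivity)).le]
  have h (n : ℕ) : ∑ i ∈ Finset.range n, beta (i + x) (y + 1) = beta x y - beta (n + x) y := by
    induction n with
    | zero => simp
    | succ n ih =>
      rw [Finset.sum_range_succ, ih, ← beta_sub_beta_add_one_left (by positivity) hy]
      push_cast
      rw [add_right_comm (n : ℝ) x 1]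
      ring
  simp_rw [h]
  simpa using (tendsto_const_nhds (x := beta x y)).sub (tendsto_beta_zero hx.le hy)

/-- The limiting distribution of the facet degrees. -/
noncomputable def degreeLaw (c s a : ℝ) (k : ℕ) : ℝ :=
  beta (k + a) (1 + (c * s + a) / (c * s - 1)) / beta (1 + a) (1 + (c * s + a) / (c * s - 1)) *
    ((c * s + a) / (c * s - 1 + c * s * (1 + a)))

section degreeLaw

variable {c s a : ℝ}

theorem div_sub_one_pos (ha : 0 ≤ a) (hcs : 1 < c * s) : 0 < (c * s + a) / (c * s - 1) :=
  div_pos (by linarith) (by linarith)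

theorem hasSum_degreeLaw (ha : 0 ≤ a) (hcs : 1 < c * s) :
    HasSum (fun k => degreeLaw c s a (k + 1)) 1 := by
  have hβ := div_sub_one_pos ha hcs
  have h := ((hasSum_beta (x := 1 + a) (by linarith) hβ).div_const
    (beta (1 + a) (1 + (c * s + a) / (c * s - 1)))).mul_right
    ((c * s + a) / (c * s - 1 + c * s * (1 + a)))
  have h1 := beta_pos (x := 1 + a) (by linarith) hβ
  have h2 : 0 < c * s - 1 := by linarith
  have h3 : 0 < c * s - 1 + c * s * (1 + a) := by nlinarith
  have h4 : 0 < c * s + a := by linarith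
  have h5 : 1 + a + (c * s + a) / (c * s - 1) =
    (c * s - 1 + c * s * (1 + a)) / (c * s - 1) := by
    field_simp
    ring
  have h6 : beta (1 + a) ((c * s + a) / (c * s - 1)) /
      beta (1 + a) (1 + (c * s + a) / (c * s - 1)) *
      ((c * s + a) / (c * s - 1 + c * s * (1 + a))) = 1 := by
    rw [add_comm 1 ((c * s + a) / (c * s - 1)), beta_add_one_right (by linarith) hβ, h5]
    generalize beta (1 + a) ((c * s + a) / (c * s - 1)) = b at h1
    generalize c * s - 1 + c * s * (1 + a) = w at h3
    field_simp
  rw [h6] at h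
  have h7 (k : ℕ) : ((k + 1 : ℕ) : ℝ) + a = k + (1 + a) := by push_cast; ring
  simp_rw [degreeLaw, h7]
  rwa [add_comm ((c * s + a) / (c * s - 1)) 1] at h

/-- `beta (k + a) y` is asymptotic to `Γ(y) * k ^ (-y)`, and the exponent `y = 1 + (c * s + a) / (c
* s - 1)` equals `2 + (1 + a) / (c * s - 1)`. -/
theorem isEquivalent_degreeLaw (ha : 0 ≤ a) (hcs : 1 < c * s) :
    ∃ C : ℝ, 0 < C ∧
      degreeLaw c s a ~[atTop] fun k : ℕ => C * (k : ℝ) ^ (-(2 + (1 + a) / (c * s - 1))) := by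
  have h2 : 0 < c * s - 1 := by linarith
  have e : 2 + (1 + a) / (c * s - 1) = 1 + (c * s + a) / (c * s - 1) := by field_simp; ring
  rw [e]
  set y := 1 + (c * s + a) / (c * s - 1) with hy
  have hy0 : 0 < y := by have := div_sub_one_pos ha hcs; linarith
  have h3 : 0 < c * s - 1 + c * s * (1 + a) := by nlinarith
  have hB := beta_pos (x := 1 + a) (by linarith) hy0
  have hG := Real.Gamma_pos_of_pos hy0
  have hq : 0 < (c * s + a) / (c * s - 1 + c * s * (1 + a)) := div_pos (by linarith) h3
  refine ⟨Real.Gamma y / beta (1 + a) y * ((c * s + a) / (c * s - 1 + c * s * (1 + a))),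
    by positivity, Asymptotics.isEquivalent_of_tendsto_one ?_⟩
  have h := (tendsto_beta_mul_rpow ha hy0).div_const (Real.Gamma y)
  rw [div_self hG.ne'] at h
  refine h.congr' ?_
  filter_upwards [eventually_gt_atTop 0] with n hn
  have hn' : (0 : ℝ) < n := by exact_mod_cast hn
  have := Real.rpow_pos_of_pos hn' y
  rw [Pi.div_apply, degreeLaw, ← hy, Real.rpow_neg hn'.le, add_comm (n : ℝ) a]
  generalize (c * s + a) / (c * s - 1 + c * s * (1 + a)) = q at hq
  field_simp

/-- The recursion has ratio `(k + a) / (k + a + y)` between degrees `k` and `k + 1`, where `y` is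
the second argument of the Beta function; this is the functional equation of `beta` in its first
argument. -/
theorem degreeLimit_div_eq (hc : 0 < c) (ha : 0 ≤ a) (hcs : 1 < c * s) (k : ℕ) :
    degreeLimit c s a (k + 1) / (1 / c) = degreeLaw c s a (k + 1) := by
  have h2 : 0 < c * s - 1 := by linarith
  have h4 : 0 < c * s + a := by linarith
  have hβ := div_sub_one_pos ha hcs
  have e1 : s - 1 / c = (c * s - 1) / c := by field_simp
  have e2 : s + a / c = (c * s + a) / c := by field_simp
  have h3 : 0 < c * s - 1 + c * s * (1 + a) := by nlinarith
  induction k with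
  | zero =>
    have hB := beta_pos (x := 1 + a) (y := 1 + (c * s + a) / (c * s - 1)) (by linarith)
      (by linarith)
    have h6 : c * s + a + (c * s - 1) * (1 + a) ≠ 0 := by
      have : 0 ≤ (c * s - 1) * (1 + a) := by positivity
      linarith
    rw [degreeLimit, degreeLimit, degreeLaw, e1, e2]
    simp only [Nat.cast_zero, zero_add, zero_div, mul_zero, if_true, Nat.cast_one, mul_one,
      div_self hB.ne', one_mul]
    have h7 : 1 + (c * s - 1) / c * ((1 + a) / ((c * s + a) / c)) =
        (c * s - 1 + c * s * (1 + a)) / (c * s + a) := by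
      field_simp
      ring
    rw [h7]
    field_simp
  | succ k ih =>
    have hk : (0 : ℝ) ≤ k := Nat.cast_nonneg k
    have hB := beta_add_one_left (x := ((k + 1 : ℕ) : ℝ) + a)
      (y := 1 + (c * s + a) / (c * s - 1)) (by positivity) (by linarith)
    have e3 : ((k + 1 + 1 : ℕ) : ℝ) + a = ((k + 1 : ℕ) : ℝ) + a + 1 := by push_cast; ring
    have hs : degreeLaw c s a (k + 1 + 1) = degreeLaw c s a (k + 1) *
        ((((k + 1 : ℕ) : ℝ) + a) / (((k + 1 : ℕ) : ℝ) + a + (1 + (c * s + a) / (c * s - 1)))) := by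
      rw [degreeLaw, e3, hB, degreeLaw]
      ring
    rw [hs, ← ih, degreeLimit, e1, e2, if_neg (Nat.succ_ne_zero k)]
    push_cast
    generalize degreeLimit c s a (k + 1) = d
    have h8 : 1 + (c * s - 1) / c * ((k + 1 + 1 + a) / ((c * s + a) / c)) =
        (c * s - 1) * (k + 1 + a + (1 + (c * s + a) / (c * s - 1))) / (c * s + a) := by
      field_simp
      ring
    rw [h8]
    have h9 : 0 < k + 1 + a + (1 + (c * s + a) / (c * s - 1)) := by positivity
    generalize k + 1 + a + (1 + (c * s + a) / (c * s - 1)) = w at h9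
    field_simp
    ring

end degreeLaw

end GeneSCs

/-! ### Almost sure statements for runs and the theorem -/

namespace GeneSCs

theorem isPath_of_mem_support {z : PMF ℕ} {c a : ℝ} {x : ℕ → Facets} (ha : 0 ≤ a)
    (h : ∀ n, x (n + 1) ∈ (step z c a (x n)).support) : IsPath z c x where
  exists_facet n := mem_support_step (h n)
  card_vertices_succ n hV := card_vertices_of_mem_support_step ha hV (h n)

namespace IsRun

variable {Ω : Type*} [MeasurableSpace Ω] {μ : Measure Ω} [IsProbabilityMeasure μ]
  {z : PMF ℕ} {c a : ℝ} {S₀ : Facets} {X : ℕ → Ω → Facets}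

theorem ae_isControlled (h : IsRun z c a S₀ μ X) (hz : z.support.Finite) (ha : 0 ≤ a) :
    ∀ᵐ ω ∂μ, IsControlled hz c a fun n => X n ω := by
  have hmid := ae_all_iff.2 fun E : ℕ => ae_all_iff.2 fun E' : ℕ =>
    ae_abs_centredSum_le hz h (f := fun R => potentialGain a (mid a E E' R) 1)
      (C := maxSize hz * (4 + a)) fun R S S' hS' => potentialGain_le hz ha
        (mid_nonneg a E E' R) (mid_le_one a E E' R) le_rfl hS'
  have hlight := ae_all_iff.2 fun Q : ℕ => ae_abs_centredSum_le hz h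
    (f := fun R => potentialGain a (off (heavy a (Q ^ 2) R)) (max 1 (totalWt a R / Q)))
      (C := maxSize hz * (4 + a)) fun R S S' hS' => potentialGain_le hz ha
        (off_nonneg _) (off_le_one _) (le_max_left _ _) hS'
  have hord := ae_all_iff.2 fun K : ℕ => ae_all_iff.2 fun E : ℕ => ae_all_iff.2 fun k : ℕ =>
    ae_abs_centredSum_le hz h
      (f := fun R => potentialGain a (off (notable a K E R)) ((k : ℝ) + 1))
      (C := maxSize hz * (4 + a)) fun R S S' hS' => potentialGain_le hz ha
        (off_nonneg _) (off_le_one _) (by linarith [Nat.cast_nonneg (α := ℝ) k]) hS'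
  have hexc := ae_all_iff.2 fun E : ℕ => ae_all_iff.2 fun K : ℕ => ae_all_iff.2 fun N : ℕ =>
    ae_abs_centredSum_le hz h (f := fun R S S' => ∑ G ∈ S' \ S,
      excess (heavy a E R) (notable a K N R) (vertices S) (1 - prOff a (notable a K N R) S) G)
      fun R S S' hS' => abs_sum_excess_le hz ha _ _ hS'
  have hrem := ae_all_iff.2 fun E : ℕ => ae_all_iff.2 fun K : ℕ => ae_all_iff.2 fun N : ℕ =>
    ae_abs_centredSum_le hz h (f := fun R => removedSafe (heavy a E R) (notable a K N R))
      fun R S S' hS' => abs_removedSafe_le hz _ _ hS'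
  have hborn := ae_abs_centredSum_le hz h (f := fun _ => bornMax (maxSize hz))
      fun R S S' hS' => abs_bornMax_le _ S S' hS'
  filter_upwards [hmid, hlight, hord, hexc, hrem, hborn] with ω h1 h2 h3 h4 h5 h6
  exact ⟨h1, h2, h3, h4, h5, h6⟩

theorem ae_averages (h : IsRun z c a S₀ μ X) (hz : z.support.Finite) {φ : Facets → ℝ} {C : ℝ}
    (hφ : ∀ S, ∀ S' ∈ (step z c a S).support, |φ S' - φ S| ≤ C) :
    ∀ᵐ ω ∂μ, Averages z c a (fun n => X n ω) φ :=
  ae_tendsto_centredSum_div hz h (f := fun S S' => φ S' - φ S) hφ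

/-- Countably many laws of large numbers hold simultaneously almost surely. On the intersection,
growth of the vertex set makes the path regular, with constants depending on `ω`, and the
deterministic limits apply. -/
theorem ae_tendsto_densities (h : IsRun z c a S₀ μ X) (hz : z.support.Finite)
    (hz2 : ∀ m ∈ z.support, 2 ≤ m) (hc : 0 < c) (ha : 0 ≤ a)
    (hcs : 1 < c * ex z fun m => (m : ℝ)) (h0 : ∅ ∉ S₀) :
    ∀ᵐ ω ∂μ, Tendsto (fun n => (vertices (X n ω)).card) atTop atTop →
      Tendsto (fun n : ℕ => facetCount (X n ω) / n) atTop (𝓝 1) ∧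
      Tendsto (fun n : ℕ => vertexCount (X n ω) / n) atTop (𝓝 (1 / c)) ∧
      Tendsto (fun n : ℕ => sizeSum (X n ω) / n) atTop (𝓝 (ex z fun m => (m : ℝ))) ∧
      ∀ k, Tendsto (fun n : ℕ => degreeCount k (X n ω) / n) atTop
        (𝓝 (degreeLimit c (ex z fun m => (m : ℝ)) a k)) := by
  have hnew := ae_tendsto_centredSum_div hz h (f := newMax (maxSize hz))
    fun S S' hS' => abs_newMax_le _ S S' hS'
  have hF := h.ae_averages hz (φ := facetCount) (C := (2 ^ maxSize hz + 1) * 1)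
    fun S S' hS' => by
      simpa [facetCount] using abs_sum_sub_le hz (w := fun _ => 1) (B := 1) (by simp) hS'
  have hD := h.ae_averages hz (φ := sizeSum)
    fun S S' hS' => abs_sum_sub_le hz (w := fun F => (F.card : ℝ)) (B := maxSize hz)
      (fun F hF => by rw [Nat.abs_cast]; exact_mod_cast hF) hS'
  have hV := h.ae_averages hz (φ := vertexCount) fun S S' hS' => abs_vertexCount_sub_le hz hS'
  have hN := ae_all_iff.2 fun k : ℕ => h.ae_averages hz (φ := degreeCount (k + 1))
    fun S S' hS' => abs_degreeCount_sub_le hz k hS'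
  filter_upwards [ae_mem_support_step h, h.init, h.ae_isControlled hz ha, hnew, hF, hD, hV, hN]
    with ω hmem hinit hctl hnew hF hD hV hN hgrow
  have hpath := isPath_of_mem_support (x := fun n => X n ω) ha hmem
  obtain ⟨η, C, κ, hη, hC, hev⟩ := hpath.exists_regular hz hz2 hc ha hnew hgrow
  have hreg : IsRegular hz c a (fun n => X n ω) η C κ
      (max (maxSize hz) ((X 0 ω).sup Finset.card)) :=
    ⟨hpath, hη, hC, hpath.facet_card_le hz (le_max_left _ _) fun F hF =>
      (Finset.le_sup (f := Finset.card) hF).trans (le_max_right _ _),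
      hev.mono fun _ h => h.1, hev.mono fun _ h => h.2.1, hev.mono fun _ h => h.2.2⟩
  have h0' : ∅ ∉ X 0 ω := by rwa [hinit]
  exact ⟨hreg.tendsto_facetCount_div ha hc hz2 hctl h0' hF,
    hreg.tendsto_vertexCount_div ha hc hz2 hctl h0' hcs hF hV,
    hreg.tendsto_sizeSum_div ha hc hz2 hctl h0' hD,
    hreg.tendsto_degreeCount_div ha hc hz2 hctl h0' hcs hF hV hD hN⟩

end IsRun

theorem meanSize_eq_ex (z : PMF ℕ) : meanSize z = ex z fun m => (m : ℝ) :=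
  tsum_congr fun _ => mul_comm _ _

theorem tendsto_div_of_tendsto_div_nat {f g : ℕ → ℝ} {p q : ℝ}
    (hf : Tendsto (fun n : ℕ => f n / n) atTop (𝓝 p))
    (hg : Tendsto (fun n : ℕ => g n / n) atTop (𝓝 q)) (hq : q ≠ 0) :
    Tendsto (fun n => f n / g n) atTop (𝓝 (p / q)) := by
  refine (hf.div hg hq).congr' ?_
  filter_upwards [eventually_gt_atTop 0] with n hn
  exact div_div_div_cancel_right₀ (Nat.cast_ne_zero.2 hn.ne') _ _

end GeneSCs

theorem theorem1 (z : PMF ℕ) (hz : z.support.Finite) (hz2 : ∀ m ∈ z.support, 2 ≤ m)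
    (c a s : ℝ) (hc : 0 < c) (ha : 0 ≤ a) (hs : s = GeneSCs.meanSize z) (hcs : 1 < c * s) :
    -- the limiting facet degree distribution, a power law
    ∃ p : ℕ → ℝ,
      (∀ k : ℕ, 1 ≤ k → p k =
        ProbabilityTheory.beta (k + a) (1 + (c * s + a) / (c * s - 1)) /
          ProbabilityTheory.beta (1 + a) (1 + (c * s + a) / (c * s - 1)) *
          ((c * s + a) / (c * s - 1 + c * s * (1 + a)))) ∧
      HasSum (fun k : ℕ => p (k + 1)) 1 ∧
      (∃ C : ℝ, 0 < C ∧
        p ~[atTop] fun k : ℕ => C * (k : ℝ) ^ (-(2 + (1 + a) / (c * s - 1)))) ∧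
      -- almost surely, if the complex grows without bound, its facet degrees follow `p`
      (∀ (Ω : Type u) [MeasurableSpace Ω] (μ : Measure Ω) [IsProbabilityMeasure μ]
        (S₀ : GeneSCs.Facets) (X : ℕ → Ω → GeneSCs.Facets),
        GeneSCs.IsFacetFamily S₀ → GeneSCs.IsRun z c a S₀ μ X →
        ∀ᵐ ω ∂μ, Tendsto (fun n => (GeneSCs.vertices (X n ω)).card) atTop atTop →
          Tendsto (fun n => GeneSCs.facetDensity (X n ω)) atTop (𝓝 c) ∧
          Tendsto (fun n => GeneSCs.averageFacetSize (X n ω)) atTop (𝓝 s) ∧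
          ∀ k : ℕ, 1 ≤ k →
            Tendsto (fun n => GeneSCs.degreeFraction (X n ω) k) atTop (𝓝 (p k))) ∧
      -- and it does grow without bound from every sufficiently large initial complex
      (∃ N₀ : ℕ, ∀ (Ω : Type u) [MeasurableSpace Ω] (μ : Measure Ω) [IsProbabilityMeasure μ]
        (S₀ : GeneSCs.Facets) (X : ℕ → Ω → GeneSCs.Facets),
        GeneSCs.IsFacetFamily S₀ → (∀ F ∈ S₀, F.card ∈ z.support) →
        N₀ ≤ (GeneSCs.vertices S₀).card → GeneSCs.IsRun z c a S₀ μ X →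
        ∀ᵐ ω ∂μ, Tendsto (fun n => (GeneSCs.vertices (X n ω)).card) atTop atTop) := by
  have hs' := hs.trans (GeneSCs.meanSize_eq_ex z)
  refine ⟨GeneSCs.degreeLaw c s a, fun k _ => rfl, GeneSCs.hasSum_degreeLaw ha hcs,
    GeneSCs.isEquivalent_degreeLaw ha hcs, ?_, ?_⟩
  · intro Ω _ μ _ S₀ X hS₀ hX
    filter_upwards [hX.ae_tendsto_densities hz hz2 hc ha (hs' ▸ hcs) hS₀.1] with ω hω hgrow
    obtain ⟨hF, hV, hD, hN⟩ := hω hgrow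
    rw [← hs'] at hD hN
    have hc' : 1 / c ≠ 0 := by positivity
    refine ⟨?_, ?_, fun k hk => ?_⟩
    · have := GeneSCs.tendsto_div_of_tendsto_div_nat hF hV hc'
      rwa [one_div_one_div] at this
    · have := GeneSCs.tendsto_div_of_tendsto_div_nat hD hF one_ne_zero
      rwa [div_one] at this
    · obtain ⟨k, rfl⟩ := Nat.exists_eq_add_of_le' hk
      have := GeneSCs.tendsto_div_of_tendsto_div_nat (hN (k + 1)) hV hc'
      rwa [GeneSCs.degreeLimit_div_eq hc ha hcs] at this
  -- All facet sizes stay at most the maximal size, so the bound `b = M` works uniformly and `N`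
  -- depends only on `z`, `c` and `a`.
  · obtain ⟨σ, hσ, N, hN⟩ := GeneSCs.exists_le_ex_newMax hz hz2 hc ha (GeneSCs.maxSize hz)
    refine ⟨N, fun Ω _ μ _ S₀ X _ hsize hcard hX => ?_⟩
    filter_upwards [GeneSCs.ae_mem_support_step hX, hX.init,
      GeneSCs.ae_tendsto_centredSum_div hz hX (f := GeneSCs.newMax (GeneSCs.maxSize hz))
        fun S S' hS' => GeneSCs.abs_newMax_le _ S S' hS'] with ω hmem hinit hnew
    refine (GeneSCs.isPath_of_mem_support (x := fun n => X n ω) ha hmem).tendsto_card_vertices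
      hz hσ hN hnew ?_ ?_
    · intro F hF
      rw [hinit] at hF
      exact GeneSCs.le_maxSize hz (hsize F hF)
    · rwa [hinit]
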